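/- Let $\mathbb{T}=\mathbb{R}/\mathbb{Z}$ with its usual (arc-length) metric. For every continuous real function $f:\mathbb{T}\to\mathbb{R}$ and every $\alpha\in(0,1)$ there is a homeomorphism $h:\mathbb{T}\to\mathbb{T}$ such that both $h$ and its inverse $h^{-1}$ are Hölder of order $\alpha$, and such that $f\circ h$ has bounded Fourier sums: there is a constant $C<\infty$ with \[ \Big|\sum_{k=-n}^{n}\widehat{f\circ h}(k)\,e^{2\pi i k x}\Big|\le C\qquad\text{for all } n\ge 0 \text{ and all } x\in\mathbb{T}, \] where $\widehat{g}(k)=\int_{\mathbb{T}} g(t)\,e^{-2\pi i k t}\,dt$. -/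

import Mathlib

open scoped NNReal

/-- The `n`-th symmetric partial sum `S_n(g; x) = ∑_{|k| ≤ n} ĝ(k) e^{2πikx}` of the Fourier series
of a function `g` on the circle `𝕋 = ℝ/ℤ`. -/
noncomputable def fourierPartialSum (g : UnitAddCircle → ℂ) (n : ℕ) (x : UnitAddCircle) : ℂ :=
  ∑ k ∈ Finset.Icc (-(n : ℤ)) (n : ℤ), fourierCoeff g k * fourier k x

/-! The homeomorphism is a composition of piecewise linear maps, one for each dyadic level: the map
of level m displaces the points of each cell of length 2^-m by a tent of slope at most q, with a
free parameter in every cell. For small q all such compositions are bi-Hölder of order α with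
uniform constants (`cellComp_holder`, `cellComp_inv_holder`), whatever the parameters. The
parameters are then chosen so as to derandomize a random homeomorphism.

Integration by parts against the Dirichlet kernel (`norm_dirichlet_integral_le`) reduces boundedness
of the partial sums to a bound O(L (νL)^-c) for the integral of f ∘ h against a character of
frequency ν over any interval of length L. On a dyadic interval of level j, f ∘ h is telescoped into
its average over all levels from j on, plus, for each m ≥ j, the increment caused by fixing the
parameters of level m. Averaging over a uniform parameter replaces the value of a bounded function
by its mean over an interval whose length is comparable to the distance to the grid. This is
Lipschitz away from the grid (`paramAvg_lipschitz`), whatever the modulus of continuity of f, so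
averaged functions have decaying oscillatory integrals (`norm_integral_avgComp_mul_ex_le`).

The increment of level m is a sum over 2^(m-j) cells of mean zero functions of the parameters. It
must cancel on all dyadic intervals and at all frequencies at once, and a union bound over all
intervals is too expensive for short ones. Therefore the parameters live on a circle, and blocks are
required to stay balanced under every common rotation of their parameters. Rotating such a block
keeps it balanced, so N blocks of N cells can be rotated against each other by an exponential moment
argument; the net of frequencies and rotations has size polynomial in N, independent of the number
of blocks (`OscFamily.exists_shift`). Repeated squaring of N reaches all scales. Interpolation with
the decay in ν gives increments that decrease geometrically in m - j (`exists_level`,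
`exists_levels`).

All constants depend on q only, so finitely many levels can be treated at a time, and a compactness
limit produces h (`exists_biholder_dirichlet_bound`). -/

open MeasureTheory

/-! ### Distance to the dyadic grids. -/

/-- Distance of a real number to the nearest integer. -/
noncomputable def tri (t : ℝ) : ℝ := ‖(t : UnitAddCircle)‖

lemma tri_eq (t : ℝ) : tri t = |t - round t| := by
  simp [tri, UnitAddCircle.norm_eq]

lemma tri_nonneg (t : ℝ) : 0 ≤ tri t := norm_nonneg _

lemma tri_le_half (t : ℝ) : tri t ≤ 1 / 2 := by
  rw [tri_eq]; exact abs_sub_round t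

lemma tri_le_abs_sub_int (t : ℝ) (k : ℤ) : tri t ≤ |t - k| := by
  rw [tri_eq]; exact round_le t k

lemma tri_add_int (t : ℝ) (k : ℤ) : tri (t + k) = tri t := by
  simp [tri_eq]

lemma abs_tri_sub_le (t s : ℝ) : |tri t - tri s| ≤ |t - s| := by
  unfold tri
  refine (abs_norm_sub_norm_le _ _).trans ?_
  rw [← AddCircle.coe_sub]
  have := tri_le_abs_sub_int (t - s) 0
  simpa [tri] using this

lemma continuous_tri : Continuous tri := by
  unfold tri
  exact continuous_norm.comp (AddCircle.continuous_mk' 1)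

lemma tri_eq_self {t : ℝ} (h0 : 0 ≤ t) (h1 : t ≤ 1 / 2) : tri t = t := by
  apply le_antisymm
  · simpa [abs_of_nonneg h0] using tri_le_abs_sub_int t 0
  · rw [tri_eq]
    rcases le_or_gt (round t) 0 with h | h
    · have : (round t : ℝ) ≤ 0 := by exact_mod_cast h
      rw [abs_of_nonneg (by linarith)]; linarith
    · have : (1 : ℝ) ≤ round t := by exact_mod_cast h
      rw [abs_of_nonpos (by linarith)]; linarith

lemma tri_neg (t : ℝ) : tri (-t) = tri t := by simp [tri]

lemma tri_eq_one_sub {t : ℝ} (h0 : 1 / 2 ≤ t) (h1 : t ≤ 1) : tri t = 1 - t := by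
  rw [← tri_eq_self (t := 1 - t) (by linarith) (by linarith), ← tri_neg t, ← tri_add_int (-t) 1]
  congr 1; push_cast; ring

/-- Distance of a real number to the grid `2⁻ᵐ ℤ`. -/
noncomputable def gridDist (m : ℕ) (t : ℝ) : ℝ := tri (2 ^ m * t) / 2 ^ m

lemma gridDist_nonneg (m : ℕ) (t : ℝ) : 0 ≤ gridDist m t :=
  div_nonneg (tri_nonneg _) (by positivity)

lemma gridDist_le (m : ℕ) (t : ℝ) : gridDist m t ≤ 1 / 2 / 2 ^ m := by
  unfold gridDist; gcongr; exact tri_le_half _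

lemma continuous_gridDist (m : ℕ) : Continuous (gridDist m) := by
  unfold gridDist
  exact (continuous_tri.comp (by fun_prop)).div_const _

lemma abs_gridDist_sub_le (m : ℕ) (t s : ℝ) : |gridDist m t - gridDist m s| ≤ |t - s| := by
  unfold gridDist
  rw [← sub_div, abs_div, abs_of_pos (by positivity : (0:ℝ) < 2 ^ m), div_le_iff₀ (by positivity)]
  refine (abs_tri_sub_le _ _).trans ?_
  rw [← mul_sub, abs_mul, abs_of_pos (by positivity : (0:ℝ) < 2 ^ m), mul_comm]

lemma gridDist_le_abs_sub (m : ℕ) (t : ℝ) (k : ℤ) : gridDist m t ≤ |t - k / 2 ^ m| := by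
  unfold gridDist
  rw [div_le_iff₀ (by positivity)]
  refine (tri_le_abs_sub_int _ k).trans (le_of_eq ?_)
  rw [← abs_of_pos (by positivity : (0:ℝ) < 2 ^ m), ← abs_mul,
    abs_of_pos (by positivity : (0:ℝ) < 2 ^ m)]
  congr 1; field_simp

lemma exists_gridDist_eq (m : ℕ) (t : ℝ) : ∃ k : ℤ, gridDist m t = |t - k / 2 ^ m| := by
  refine ⟨round (2 ^ m * t), ?_⟩
  unfold gridDist
  rw [tri_eq, div_eq_iff (by positivity)]
  rw [← abs_of_pos (by positivity : (0:ℝ) < 2 ^ m), ← abs_mul,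
    abs_of_pos (by positivity : (0:ℝ) < 2 ^ m)]
  congr 1; field_simp

lemma gridDist_add_int (m : ℕ) (t : ℝ) (k : ℤ) : gridDist m (t + k) = gridDist m t := by
  unfold gridDist
  rw [← tri_add_int (2 ^ m * t) (2 ^ m * k)]
  congr 2; push_cast; ring

/-! ### Cell maps of one level. -/

/-- Piecewise linear perturbation of the identity fixing the grid `2⁻ᵐ ℤ`; on the cell number `k`
it displaces by `v k` times the distance to the grid. -/
noncomputable def cellMap (m : ℕ) (v : ℤ → ℝ) (t : ℝ) : ℝ := t + v ⌊2 ^ m * t⌋ * gridDist m t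

section
variable {q : ℝ} {m : ℕ} {v : ℤ → ℝ}

/-- The displacement is q-Lipschitz. Inside one cell this is the Lipschitz bound for the grid
distance. In different cells a grid point separates s and t, so the two grid distances add up to at
most |t - s|. -/
lemma abs_cellMap_sub_sub_le (hv : ∀ k, |v k| ≤ q) (t s : ℝ) :
    |cellMap m v t - cellMap m v s - (t - s)| ≤ q * |t - s| := by
  wlog h : s ≤ t generalizing t s
  · rw [abs_sub_comm t s, ← abs_neg]
    convert this s t (le_of_not_ge h) using 2; ring
  have hq : 0 ≤ q := (abs_nonneg _).trans (hv 0)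
  have hp : (0:ℝ) < 2 ^ m := by positivity
  unfold cellMap
  have e : t + v ⌊2 ^ m * t⌋ * gridDist m t - (s + v ⌊2 ^ m * s⌋ * gridDist m s) - (t - s) =
    v ⌊2 ^ m * t⌋ * gridDist m t - v ⌊2 ^ m * s⌋ * gridDist m s := by ring
  rw [e]
  have hfl : ⌊2 ^ m * s⌋ ≤ ⌊2 ^ m * t⌋ := Int.floor_le_floor (by gcongr)
  rcases hfl.eq_or_lt with h1 | h1
  · rw [h1, ← mul_sub, abs_mul]
    exact mul_le_mul (hv _) (abs_gridDist_sub_le _ _ _) (abs_nonneg _) hq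
  · have h2 : (⌊2 ^ m * s⌋ : ℝ) + 1 ≤ ⌊2 ^ m * t⌋ := by exact_mod_cast h1
    have a1 := gridDist_le_abs_sub m t ⌊2 ^ m * t⌋
    have a2 := gridDist_le_abs_sub m s (⌊2 ^ m * s⌋ + 1)
    have b1 : (⌊2 ^ m * t⌋ : ℝ) / 2 ^ m ≤ t := by
      rw [div_le_iff₀ hp, mul_comm]; exact Int.floor_le _
    have b2 : s ≤ ((⌊2 ^ m * s⌋ + 1 : ℤ) : ℝ) / 2 ^ m := by
      rw [le_div_iff₀ hp, mul_comm]; push_cast; exact (Int.lt_floor_add_one _).le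
    have b3 : ((⌊2 ^ m * s⌋ + 1 : ℤ) : ℝ) / 2 ^ m ≤ (⌊2 ^ m * t⌋ : ℝ) / 2 ^ m := by
      push_cast; gcongr
    rw [abs_of_nonneg (by linarith)] at a1
    rw [abs_of_nonpos (by linarith)] at a2
    calc _ ≤ |v ⌊2 ^ m * t⌋ * gridDist m t| + |v ⌊2 ^ m * s⌋ * gridDist m s| := abs_sub _ _
      _ ≤ q * gridDist m t + q * gridDist m s := by
        rw [abs_mul, abs_mul, abs_of_nonneg (gridDist_nonneg _ _),
          abs_of_nonneg (gridDist_nonneg _ _)]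
        exact add_le_add (mul_le_mul_of_nonneg_right (hv _) (gridDist_nonneg _ _))
          (mul_le_mul_of_nonneg_right (hv _) (gridDist_nonneg _ _))
      _ ≤ q * |t - s| := by
        rw [← mul_add, abs_of_nonneg (by linarith)]
        exact mul_le_mul_of_nonneg_left (by linarith) hq

lemma abs_cellMap_sub_le (hv : ∀ k, |v k| ≤ q) (t s : ℝ) :
    |cellMap m v t - cellMap m v s| ≤ (1 + q) * |t - s| := by
  have h := abs_cellMap_sub_sub_le (m := m) hv t s
  have := abs_add_le (cellMap m v t - cellMap m v s - (t - s)) (t - s)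
  rw [sub_add_cancel] at this; linarith

lemma le_abs_cellMap_sub (hv : ∀ k, |v k| ≤ q) (t s : ℝ) :
    (1 - q) * |t - s| ≤ |cellMap m v t - cellMap m v s| := by
  have h := abs_cellMap_sub_sub_le (m := m) hv t s
  have := abs_sub_abs_le_abs_sub (t - s) (cellMap m v t - cellMap m v s)
  rw [abs_sub_comm (t - s) (_ - _)] at this; linarith

lemma abs_cellMap_sub_self_le (hv : ∀ k, |v k| ≤ q) (t : ℝ) :
    |cellMap m v t - t| ≤ q / 2 / 2 ^ m := by
  have hq : 0 ≤ q := (abs_nonneg _).trans (hv 0)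
  unfold cellMap
  rw [add_sub_cancel_left, abs_mul, abs_of_nonneg (gridDist_nonneg _ _)]
  calc _ ≤ q * (1 / 2 / 2 ^ m) :=
        mul_le_mul (hv _) (gridDist_le _ _) (gridDist_nonneg _ _) hq
    _ = _ := by ring

lemma continuous_cellMap (hv : ∀ k, |v k| ≤ q) : Continuous (cellMap m v) := by
  have hq : 0 ≤ q := (abs_nonneg _).trans (hv 0)
  refine LipschitzWith.continuous (K := ⟨1 + q, by linarith⟩) (LipschitzWith.of_dist_le_mul ?_)
  intro t s
  exact abs_cellMap_sub_le hv t s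

lemma cellMap_add_int (hv : ∀ k, v (k + 2 ^ m) = v k) (t : ℝ) :
    cellMap m v (t + 1) = cellMap m v t + 1 := by
  unfold cellMap
  have h1 := gridDist_add_int m t 1
  have : ⌊2 ^ m * (t + 1)⌋ = ⌊2 ^ m * t⌋ + 2 ^ m := by
    rw [mul_add, mul_one]; exact_mod_cast Int.floor_add_intCast (2 ^ m * t) (2 ^ m)
  push_cast at h1
  rw [h1, this, hv]; ring

lemma floor_mul_pow_eq_ediv {a m : ℕ} (h : a ≤ m) (t : ℝ) :
    ⌊2 ^ a * t⌋ = ⌊2 ^ m * t⌋ / 2 ^ (m - a) := by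
  have := Int.floor_div_natCast (2 ^ m * t) (2 ^ (m - a))
  rw [Nat.cast_pow, Nat.cast_pow] at this
  push_cast at this
  rw [← this]
  congr 1
  rw [eq_div_iff (by positivity)]
  rw [mul_right_comm, ← pow_add, Nat.add_sub_cancel' h]

/-- Since the displacement is less than the distance to the grid, no point leaves its cell, nor any
coarser cell containing it. -/
lemma floor_cellMap {a : ℕ} (h : a ≤ m) (hv : ∀ k, |v k| < 1) (t : ℝ) :
    ⌊2 ^ a * cellMap m v t⌋ = ⌊2 ^ a * t⌋ := by
  rw [floor_mul_pow_eq_ediv h, floor_mul_pow_eq_ediv h t]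
  congr 1
  rw [Int.floor_eq_iff]
  set k := ⌊2 ^ m * t⌋ with hk
  have hp : (0:ℝ) < 2 ^ m := by positivity
  have e : 2 ^ m * cellMap m v t = 2 ^ m * t + v k * tri (2 ^ m * t) := by
    unfold cellMap gridDist; rw [← hk]; field_simp
  have h1 := tri_le_abs_sub_int (2 ^ m * t) k
  have h2 := tri_le_abs_sub_int (2 ^ m * t) (k + 1)
  have h3 : (k : ℝ) ≤ 2 ^ m * t := Int.floor_le _
  have h4 : 2 ^ m * t < k + 1 := Int.lt_floor_add_one _
  push_cast at h2
  rw [abs_of_nonneg (by linarith)] at h1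
  rw [abs_of_nonpos (by linarith)] at h2
  have h5 := abs_lt.1 (hv k)
  have h6 := tri_nonneg (2 ^ m * t)
  rw [e]
  constructor <;> nlinarith

lemma cellMap_grid {a : ℕ} (h : a ≤ m) (k : ℤ) :
    cellMap m v (k / 2 ^ a) = k / 2 ^ a := by
  unfold cellMap
  have : gridDist m (k / 2 ^ a) = 0 := by
    apply le_antisymm _ (gridDist_nonneg _ _)
    refine (gridDist_le_abs_sub m _ (k * 2 ^ (m - a))).trans (le_of_eq ?_)
    rw [abs_eq_zero, sub_eq_zero]
    push_cast
    rw [div_eq_div_iff (by positivity) (by positivity), mul_assoc, ← pow_add, Nat.sub_add_cancel h]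
  rw [this]; ring

end

/-! ### Compositions of cell maps and their Hölder bounds. -/

/-- The composition of the cell maps of levels `a, …, a + n - 1`, finest level innermost. -/
noncomputable def cellComp (v : ℕ → ℤ → ℝ) (a : ℕ) : ℕ → ℝ → ℝ
  | 0 => id
  | n + 1 => cellComp v a n ∘ cellMap (a + n) (v (a + n))

section
variable {q : ℝ} {v : ℕ → ℤ → ℝ}

lemma cellComp_succ (a n : ℕ) (t : ℝ) :
    cellComp v a (n + 1) t = cellComp v a n (cellMap (a + n) (v (a + n)) t) := rfl

lemma cellComp_add (a k n : ℕ) (t : ℝ) :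
    cellComp v a (k + n) t = cellComp v a k (cellComp v (a + k) n t) := by
  induction n generalizing t with
  | zero => rfl
  | succ n ih => rw [← add_assoc, cellComp_succ, ih, cellComp_succ, add_assoc]

lemma cellComp_congr {w : ℕ → ℤ → ℝ} {a n : ℕ} (h : ∀ i, i < a + n → v i = w i) :
    cellComp v a n = cellComp w a n := by
  induction n with
  | zero => rfl
  | succ n ih =>
    simp only [cellComp]
    rw [ih fun i hi => h i (by omega), h (a + n) (by omega)]

lemma continuous_cellComp (hv : ∀ m k, |v m k| ≤ q) (a n : ℕ) : Continuous (cellComp v a n) := by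
  induction n with
  | zero => exact continuous_id
  | succ n ih => exact ih.comp (continuous_cellMap (hv _))

lemma cellComp_add_one (hv : ∀ m k, v m (k + 2 ^ m) = v m k) (a n : ℕ) (t : ℝ) :
    cellComp v a n (t + 1) = cellComp v a n t + 1 := by
  induction n generalizing t with
  | zero => rfl
  | succ n ih => rw [cellComp_succ, cellMap_add_int (hv _), ih, cellComp_succ]

lemma floor_cellComp {b a : ℕ} (h : b ≤ a) (hv : ∀ m k, |v m k| < 1) (n : ℕ) (t : ℝ) :
    ⌊2 ^ b * cellComp v a n t⌋ = ⌊2 ^ b * t⌋ := by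
  induction n generalizing t with
  | zero => rfl
  | succ n ih => rw [cellComp_succ, ih, floor_cellMap (by omega) (hv _)]

lemma cellComp_grid {b a : ℕ} (h : b ≤ a) (n : ℕ) (k : ℤ) :
    cellComp v a n (k / 2 ^ b) = k / 2 ^ b := by
  induction n with
  | zero => rfl
  | succ n ih => rw [cellComp_succ, cellMap_grid (by omega), ih]

lemma abs_cellComp_sub_self_le (hv : ∀ m k, |v m k| ≤ q) (a n : ℕ) (t : ℝ) :
    |cellComp v a n t - t| ≤ q / 2 ^ a := by
  have hq : 0 ≤ q := (abs_nonneg _).trans (hv 0 0)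
  -- The subtracted tail of the geometric series makes the induction close: each level moves points
  -- by half the previous bound.
  have : |cellComp v a n t - t| ≤ q / 2 ^ a - q / 2 ^ (a + n) := by
    induction n generalizing t with
    | zero => simp [cellComp]
    | succ n ih =>
      rw [cellComp_succ]
      have h1 := ih (cellMap (a + n) (v (a + n)) t)
      have h2 := abs_cellMap_sub_self_le (m := a + n) (hv (a + n)) t
      have h3 := abs_add_le (cellComp v a n (cellMap (a + n) (v (a + n)) t) -
        cellMap (a + n) (v (a + n)) t) (cellMap (a + n) (v (a + n)) t - t)
      rw [sub_add_sub_cancel] at h3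
      have h4 : q / 2 ^ (a + (n + 1)) = q / 2 / 2 ^ (a + n) := by
        rw [← add_assoc, pow_succ]; field_simp
      have h5 : q / 2 ^ (a + n) = 2 * (q / 2 / 2 ^ (a + n)) := by ring
      linarith
  have h2 : 0 ≤ q / 2 ^ (a + n) := by positivity
  linarith

/-- The k coarsest maps are applied last and expand by at most 1 + q each; all finer ones together
move a point by at most q / 2^(a+k). -/
lemma abs_cellComp_sub_le_pow (hv : ∀ m k, |v m k| ≤ q) (a n k : ℕ) (t s : ℝ) :
    |cellComp v a n t - cellComp v a n s| ≤ (1 + q) ^ k * (|t - s| + 2 * q / 2 ^ (a + k)) := by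
  have hq : 0 ≤ q := (abs_nonneg _).trans (hv 0 0)
  have lip : ∀ n t s, |cellComp v a n t - cellComp v a n s| ≤ (1 + q) ^ n * |t - s| := by
    intro n
    induction n with
    | zero => intro t s; simp [cellComp]
    | succ n ih =>
      intro t s
      rw [cellComp_succ, cellComp_succ]
      refine (ih _ _).trans ?_
      rw [pow_succ, mul_assoc]
      exact mul_le_mul_of_nonneg_left (abs_cellMap_sub_le (hv _) _ _) (by positivity)
  rcases le_or_gt k n with h | h
  · obtain ⟨r, rfl⟩ := Nat.exists_eq_add_of_le h
    rw [cellComp_add, cellComp_add]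
    refine (lip _ _ _).trans (mul_le_mul_of_nonneg_left ?_ (by positivity))
    have h1 := abs_le.1 (abs_cellComp_sub_self_le hv (a + k) r t)
    have h2 := abs_le.1 (abs_cellComp_sub_self_le hv (a + k) r s)
    have h3 := abs_le.1 (le_refl |t - s|)
    have h4 : 2 * q / 2 ^ (a + k) = 2 * (q / 2 ^ (a + k)) := by ring
    rw [abs_le, h4]; constructor <;> linarith
  · refine (lip _ _ _).trans ?_
    refine mul_le_mul (pow_le_pow_right₀ (by linarith) h.le) ?_ (abs_nonneg _) (by positivity)
    have : 0 ≤ 2 * q / 2 ^ (a + k) := by positivity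
    linarith

lemma pow_mul_le_abs_cellComp_sub (hv : ∀ m k, |v m k| ≤ q) (hq1 : q ≤ 1) (a n k : ℕ) (t s : ℝ) :
    (1 - q) ^ k * (|t - s| - 2 * q / 2 ^ (a + k)) ≤ |cellComp v a n t - cellComp v a n s| := by
  have hq : 0 ≤ q := (abs_nonneg _).trans (hv 0 0)
  have hq2 : 0 ≤ 1 - q := by linarith
  have lip : ∀ n t s, (1 - q) ^ n * |t - s| ≤ |cellComp v a n t - cellComp v a n s| := by
    intro n
    induction n with
    | zero => intro t s; simp [cellComp]
    | succ n ih =>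
      intro t s
      rw [cellComp_succ, cellComp_succ]
      refine le_trans ?_ (ih _ _)
      rw [pow_succ, mul_assoc]
      exact mul_le_mul_of_nonneg_left (le_abs_cellMap_sub (hv _) _ _) (by positivity)
  rcases le_or_gt k n with h | h
  · obtain ⟨r, rfl⟩ := Nat.exists_eq_add_of_le h
    rw [cellComp_add, cellComp_add]
    refine le_trans (mul_le_mul_of_nonneg_left ?_ (by positivity)) (lip _ _ _)
    have h1 := abs_cellComp_sub_self_le hv (a + k) r t
    have h2 := abs_cellComp_sub_self_le hv (a + k) r s
    have h4 : 2 * q / 2 ^ (a + k) = 2 * (q / 2 ^ (a + k)) := by ring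
    have h5 := abs_add_three (t - cellComp v (a + k) r t)
      (cellComp v (a + k) r t - cellComp v (a + k) r s) (cellComp v (a + k) r s - s)
    have e : t - cellComp v (a + k) r t + (cellComp v (a + k) r t - cellComp v (a + k) r s) +
      (cellComp v (a + k) r s - s) = t - s := by ring
    rw [e, abs_sub_comm t (cellComp v (a + k) r t)] at h5
    linarith
  · refine le_trans ?_ (lip _ _ _)
    have h6 : 0 ≤ 2 * q / 2 ^ (a + k) := by positivity
    calc _ ≤ (1 - q) ^ k * |t - s| := by gcongr; linarith
      _ ≤ _ := mul_le_mul_of_nonneg_right (pow_le_pow_of_le_one hq2 (by linarith) h.le)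
        (abs_nonneg _)

lemma exists_half_pow_near {x : ℝ} (h0 : 0 < x) (h1 : x ≤ 1) :
    ∃ k : ℕ, (1 / 2 : ℝ) ^ k ≤ x ∧ x ≤ 2 * (1 / 2) ^ k := by
  obtain ⟨n, h2, h3⟩ := exists_nat_pow_near_of_lt_one h0 h1 (by norm_num : (0:ℝ) < 1 / 2)
    (by norm_num)
  exact ⟨n + 1, h2.le, by rw [pow_succ]; linarith⟩

/-- Split the levels at the k for which 2^-k is comparable to the rescaled distance. The expansion
(1 + q)^k is then at most a power 1 - α of the inverse distance. -/
lemma cellComp_holder (hv : ∀ m k, |v m k| ≤ q) (hq1 : q ≤ 1 / 2) {α : ℝ} (hα0 : 0 < α)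
    (hα1 : α ≤ 1) (hq : 1 + q ≤ 2 ^ (1 - α)) (a n : ℕ) {t s : ℝ} (hts : 2 ^ a * |t - s| ≤ 1) :
    2 ^ a * |cellComp v a n t - cellComp v a n s| ≤ 4 * (2 ^ a * |t - s|) ^ α := by
  have hq0 : 0 ≤ q := (abs_nonneg _).trans (hv 0 0)
  have hp : (0:ℝ) < 2 ^ a := by positivity
  rcases eq_or_ne t s with rfl | hne
  · simp [Real.zero_rpow hα0.ne']
  set x := 2 ^ a * |t - s| with hx
  have hx0 : 0 < x := mul_pos hp (abs_pos.2 (sub_ne_zero.2 hne))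
  obtain ⟨k, hk1, hk2⟩ := exists_half_pow_near hx0 hts
  have h := abs_cellComp_sub_le_pow hv a n k t s
  have h2 : 2 ^ a * |cellComp v a n t - cellComp v a n s| ≤ (1 + q) ^ k * (2 * x) := by
    calc _ ≤ 2 ^ a * ((1 + q) ^ k * (|t - s| + 2 * q / 2 ^ (a + k))) := by gcongr
      _ = (1 + q) ^ k * (x + 2 * q * (1 / 2) ^ k) := by
        rw [pow_add, hx, one_div, inv_pow]; field_simp
      _ ≤ (1 + q) ^ k * (x + 1 * x) := by gcongr; linarith
      _ = _ := by ring
  have h3 : (1 + q) ^ k ≤ (2 / x) ^ (1 - α) := by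
    calc (1 + q) ^ k ≤ ((2:ℝ) ^ (1 - α)) ^ k := by gcongr
      _ = ((2:ℝ) ^ k) ^ (1 - α) := by
        rw [← Real.rpow_natCast, ← Real.rpow_mul (by norm_num), mul_comm, Real.rpow_mul (by norm_num),
          Real.rpow_natCast]
      _ ≤ _ := by
        apply Real.rpow_le_rpow (by positivity) _ (by linarith)
        rw [le_div_iff₀ hx0]
        calc 2 ^ k * x ≤ 2 ^ k * (2 * (1 / 2) ^ k) := by gcongr
          _ = 2 := by rw [one_div, inv_pow]; field_simp
  calc _ ≤ (2 / x) ^ (1 - α) * (2 * x) := h2.trans (by gcongr)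
    _ = 2 * 2 ^ (1 - α) * (x ^ (1 - (1 - α))) := by
      rw [Real.div_rpow (by norm_num) hx0.le, Real.rpow_sub hx0 1 (1 - α), Real.rpow_one]; ring
    _ ≤ 2 * 2 * x ^ α := by
      rw [sub_sub_cancel]
      gcongr
      calc (2:ℝ) ^ (1 - α) ≤ 2 ^ (1:ℝ) := Real.rpow_le_rpow_of_exponent_le (by norm_num) (by linarith)
        _ = 2 := by simp
    _ = _ := by ring

/-- The same splitting with the contraction factor 1 - q. The exponent β is the inverse of the
Hölder exponent of the inverse map. A lower bound x replaces the distance itself because the points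
may be further than one cell apart. -/
lemma cellComp_inv_holder (hv : ∀ m k, |v m k| ≤ q) (hq1 : q ≤ 1 / 2) {β : ℝ} (hβ : 1 ≤ β)
    (hq : (1 / 2 : ℝ) ^ (β - 1) ≤ 1 - q) (a n : ℕ) {t s x : ℝ} (hx0 : 0 < x) (hx1 : x ≤ 1)
    (hts : x ≤ 2 ^ a * |t - s|) :
    (x / 4) ^ β ≤ 2 ^ a * |cellComp v a n t - cellComp v a n s| := by
  have hq0 : 0 ≤ q := (abs_nonneg _).trans (hv 0 0)
  have hp : (0:ℝ) < 2 ^ a := by positivity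
  obtain ⟨k, hk1, hk2⟩ := exists_half_pow_near (half_pos hx0) (by linarith)
  have h := pow_mul_le_abs_cellComp_sub hv (by linarith) a n k t s
  have hk0 : (0:ℝ) ≤ (1 / 2) ^ k := by positivity
  calc (x / 4) ^ β = (x / 4) ^ (β - 1) * (x / 4) := by
        rw [Real.rpow_sub_one (by positivity)]; field_simp
    _ ≤ ((1 / 2 : ℝ) ^ k) ^ (β - 1) * (x / 2) := by
      gcongr
      · linarith
      · linarith
    _ = ((1 / 2 : ℝ) ^ (β - 1)) ^ k * (x / 2) := by
      rw [← Real.rpow_natCast, ← Real.rpow_mul (by norm_num), mul_comm (k : ℝ),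
        Real.rpow_mul (by norm_num), Real.rpow_natCast]
    _ ≤ (1 - q) ^ k * (2 ^ a * |t - s| - 2 * q * (1 / 2) ^ k) := by
      refine mul_le_mul (pow_le_pow_left₀ (by positivity) hq k) ?_ (by linarith)
        (pow_nonneg (by linarith) k)
      nlinarith
    _ = 2 ^ a * ((1 - q) ^ k * (|t - s| - 2 * q / 2 ^ (a + k))) := by
      rw [pow_add, one_div, inv_pow]; field_simp
    _ ≤ _ := by gcongr

end

/-! ### Averaging over the parameters. -/

lemma swap_of_continuous {E : Type*} [NormedAddCommGroup E] [NormedSpace ℝ E] {F : ℝ → ℝ → E}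
    (hF : Continuous F.uncurry) (a b c d : ℝ) :
    ∫ x in a..b, ∫ y in c..d, F x y = ∫ y in c..d, ∫ x in a..b, F x y := by
  refine intervalIntegral_intervalIntegral_swap ?_
  have : IntegrableOn F.uncurry (Set.uIcc a b ×ˢ Set.uIcc c d) :=
    hF.continuousOn.integrableOn_compact (isCompact_uIcc.prod isCompact_uIcc)
  exact this.mono_set (Set.prod_mono Set.uIoc_subset_uIcc Set.uIoc_subset_uIcc)

/-- The parameter `q (4 tri θ - 1)` is uniformly distributed on `[-q, q]` when `θ` is uniformly
distributed on the circle. -/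
noncomputable def circParam (q θ : ℝ) : ℝ := q * (4 * tri θ - 1)

lemma continuous_circParam (q : ℝ) : Continuous (circParam q) := by
  unfold circParam; have := continuous_tri; fun_prop

lemma abs_circParam_le {q : ℝ} (hq : 0 ≤ q) (θ : ℝ) : |circParam q θ| ≤ q := by
  unfold circParam
  rw [abs_mul, abs_of_nonneg hq]
  have h1 := tri_nonneg θ
  have h2 := tri_le_half θ
  exact mul_le_of_le_one_right hq (abs_le.2 ⟨by linarith, by linarith⟩)

lemma abs_circParam_sub_le {q : ℝ} (hq : 0 ≤ q) (θ θ' : ℝ) :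
    |circParam q θ - circParam q θ'| ≤ 4 * q * |θ - θ'| := by
  unfold circParam
  rw [show q * (4 * tri θ - 1) - q * (4 * tri θ' - 1) = 4 * q * (tri θ - tri θ') by ring, abs_mul,
    abs_of_nonneg (by positivity : 0 ≤ 4 * q)]
  exact mul_le_mul_of_nonneg_left (abs_tri_sub_le _ _) (by positivity)

lemma circParam_add_one (q θ : ℝ) : circParam q (θ + 1) = circParam q θ := by
  unfold circParam
  have := tri_add_int θ 1
  push_cast at this
  rw [this]

/-- The average of `g` over the interval of center `c` and radius `q e`. -/
noncomputable def paramAvg (q : ℝ) (g : ℝ → ℝ) (c e : ℝ) : ℝ :=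
  ∫ θ in (0:ℝ)..1, g (c + circParam q θ * e)

/-- The tent is affine with opposite slopes on the two halves of the circle, and each half sweeps
the whole interval once. -/
lemma paramAvg_eq {q : ℝ} (hq : 0 < q) {g : ℝ → ℝ} (hg : Continuous g) (c : ℝ) {e : ℝ}
    (he : 0 < e) : paramAvg q g c e = (∫ y in (c - q * e)..(c + q * e), g y) / (2 * (q * e)) := by
  unfold paramAvg
  have hc : Continuous fun θ => g (c + circParam q θ * e) := by
    have := continuous_circParam q; fun_prop
  rw [← intervalIntegral.integral_add_adjacent_intervals (b := 1 / 2)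
    (hc.intervalIntegrable _ _) (hc.intervalIntegrable _ _)]
  have h1 : ∫ θ in (0:ℝ)..(1/2), g (c + circParam q θ * e) =
      ∫ θ in (0:ℝ)..(1/2), g ((4 * q * e) * θ + (c - q * e)) := by
    refine intervalIntegral.integral_congr fun θ hθ => ?_
    rw [Set.uIcc_of_le (by norm_num)] at hθ
    simp only [circParam]
    rw [tri_eq_self hθ.1 hθ.2]; ring_nf
  have h2 : ∫ θ in (1/2:ℝ)..1, g (c + circParam q θ * e) =
      ∫ θ in (1/2:ℝ)..1, g ((c + 3 * q * e) - (4 * q * e) * θ) := by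
    refine intervalIntegral.integral_congr fun θ hθ => ?_
    rw [Set.uIcc_of_le (by norm_num)] at hθ
    simp only [circParam]
    rw [tri_eq_one_sub hθ.1 hθ.2]; ring_nf
  rw [h1, h2, intervalIntegral.integral_comp_mul_add g (by positivity),
    intervalIntegral.integral_comp_sub_mul g (by positivity)]
  have e1 : 4 * q * e * 0 + (c - q * e) = c - q * e := by ring
  have e2 : 4 * q * e * (1 / 2) + (c - q * e) = c + q * e := by ring
  have e3 : c + 3 * q * e - 4 * q * e * 1 = c - q * e := by ring
  have e4 : c + 3 * q * e - 4 * q * e * (1 / 2) = c + q * e := by ring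
  rw [e1, e2, e3, e4, smul_eq_mul]
  field_simp
  ring

/-- A mean of a bounded function over an interval changes only through the endpoints and the length
of the interval. No regularity of g enters the constant, only the lower bound q δ for the radius. -/
lemma paramAvg_lipschitz {q : ℝ} (hq : 0 < q) (hq1 : q ≤ 1 / 2) {g : ℝ → ℝ} (hg : Continuous g)
    (hg1 : ∀ x, |g x| ≤ 1) {c c' e e' δ : ℝ} (hδ : 0 < δ) (he : δ ≤ e) (he' : δ ≤ e') :
    |paramAvg q g c e - paramAvg q g c' e'| ≤ (|c - c'| + |e - e'|) / (q * δ) := by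
  have he0 : 0 < e := by linarith
  have he0' : 0 < e' := by linarith
  rw [paramAvg_eq hq hg c he0, paramAvg_eq hq hg c' he0']
  have bd : ∀ a b : ℝ, |∫ y in a..b, g y| ≤ |b - a| := fun a b => by
    simpa using intervalIntegral.norm_integral_le_of_norm_le_const (C := 1) (f := g) (a := a) (b := b)
      (fun x _ => hg1 x)
  set N := ∫ y in (c - q * e)..(c + q * e), g y with hN
  set N' := ∫ y in (c' - q * e')..(c' + q * e'), g y with hN'
  have hN1 : |N| ≤ 2 * (q * e) := by
    refine (bd _ _).trans (le_of_eq ?_)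
    rw [show c + q * e - (c - q * e) = 2 * (q * e) by ring, abs_of_nonneg (by positivity)]
  have hNN : |N - N'| ≤ 2 * (|c - c'| + q * |e - e'|) := by
    rw [hN, hN', intervalIntegral.integral_interval_sub_interval_comm
      (hg.intervalIntegrable _ _) (hg.intervalIntegrable _ _) (hg.intervalIntegrable _ _)]
    have h1 := bd (c - q * e) (c' - q * e')
    have h2 := bd (c + q * e) (c' + q * e')
    have h3 : |c' - q * e' - (c - q * e)| ≤ |c - c'| + q * |e - e'| := by
      rw [show c' - q * e' - (c - q * e) = -(c - c') + q * (e - e') by ring]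
      refine (abs_add_le _ _).trans ?_
      rw [abs_neg, abs_mul, abs_of_pos hq]
    have h4 : |c' + q * e' - (c + q * e)| ≤ |c - c'| + q * |e - e'| := by
      rw [show c' + q * e' - (c + q * e) = -((c - c') + q * (e - e')) by ring, abs_neg]
      refine (abs_add_le _ _).trans ?_
      rw [abs_mul, abs_of_pos hq]
    have h5 := abs_sub (∫ y in (c - q * e)..(c' - q * e'), g y)
      (∫ y in (c + q * e)..(c' + q * e'), g y)
    linarith
  have key : N / (2 * (q * e)) - N' / (2 * (q * e')) =
      (N - N') / (2 * (q * e')) + N / (2 * (q * e)) * ((e' - e) / e') := by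
    field_simp; ring
  rw [key]
  have t1 : |(N - N') / (2 * (q * e'))| ≤ (|c - c'| + q * |e - e'|) / (q * δ) := by
    rw [abs_div, abs_of_pos (by positivity : 0 < 2 * (q * e')), div_le_div_iff₀ (by positivity)
      (by positivity)]
    calc |N - N'| * (q * δ) ≤ (2 * (|c - c'| + q * |e - e'|)) * (q * e') := by gcongr
      _ = _ := by ring
  have t2 : |N / (2 * (q * e)) * ((e' - e) / e')| ≤ (q * |e - e'|) / (q * δ) := by
    have u1 : |N / (2 * (q * e))| ≤ 1 := by
      rw [abs_div, abs_of_pos (by positivity : 0 < 2 * (q * e))]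
      exact div_le_one_of_le₀ hN1 (by positivity)
    have u2 : |(e' - e) / e'| ≤ (q * |e - e'|) / (q * δ) := by
      rw [abs_div, abs_of_pos he0', abs_sub_comm, mul_div_mul_left _ _ hq.ne']
      gcongr
    rw [abs_mul]
    calc _ ≤ 1 * ((q * |e - e'|) / (q * δ)) := by gcongr
      _ = _ := one_mul _
  calc _ ≤ _ := abs_add_le _ _
    _ ≤ (|c - c'| + q * |e - e'|) / (q * δ) + (q * |e - e'|) / (q * δ) := add_le_add t1 t2
    _ = (|c - c'| + 2 * q * |e - e'|) / (q * δ) := by ring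
    _ ≤ _ := by
      gcongr
      have := abs_nonneg (e - e')
      nlinarith

/-- Averaging of `g` over the cell maps of level `m` with constant parameter. -/
noncomputable def avgOp (q : ℝ) (m : ℕ) (g : ℝ → ℝ) (t : ℝ) : ℝ := paramAvg q g t (gridDist m t)

/-- The composition of the averaging operators of levels `a, …, a + n - 1`, coarsest first. -/
noncomputable def avgComp (q : ℝ) (a : ℕ) : ℕ → (ℝ → ℝ) → ℝ → ℝ
  | 0, g => g
  | n + 1, g => avgOp q (a + n) (avgComp q a n g)

lemma avgOp_eq (q : ℝ) (m : ℕ) (g : ℝ → ℝ) (t : ℝ) :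
    avgOp q m g t = ∫ θ in (0:ℝ)..1, g (cellMap m (fun _ => circParam q θ) t) := rfl

/-- Isolates the coarsest averaging, which acts directly on g and supplies the Lipschitz regularity.
-/
lemma avgComp_succ_front (q : ℝ) (a n : ℕ) (g : ℝ → ℝ) :
    avgComp q a (n + 1) g = avgComp q (a + 1) n (avgOp q a g) := by
  induction n with
  | zero => rfl
  | succ n ih => rw [avgComp, ih, avgComp, add_right_comm, add_assoc]

lemma continuous_avgComp_param {X : Type*} [TopologicalSpace X] (q : ℝ) (a n : ℕ)
    {g : X → ℝ → ℝ} (hg : Continuous g.uncurry) :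
    Continuous (Function.uncurry fun x t => avgComp q a n (g x) t) := by
  induction n with
  | zero => exact hg
  | succ n ih =>
    have h1 := continuous_circParam q
    have h2 := continuous_gridDist (a + n)
    have : Continuous (Function.uncurry fun (p : X × ℝ) (θ : ℝ) =>
        avgComp q a n (g p.1) (p.2 + circParam q θ * gridDist (a + n) p.2)) := by
      exact ih.comp (f := fun r : (X × ℝ) × ℝ =>
        (r.1.1, r.1.2 + circParam q r.2 * gridDist (a + n) r.1.2)) (by fun_prop)
    exact intervalIntegral.continuous_parametric_intervalIntegral_of_continuous' this 0 1

lemma continuous_avgComp (q : ℝ) (a n : ℕ) {g : ℝ → ℝ} (hg : Continuous g) :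
    Continuous (avgComp q a n g) := by
  have := continuous_avgComp_param (X := Unit) q a n (g := fun _ => g) (by fun_prop)
  exact this.comp (f := fun t => ((), t)) (by fun_prop)

lemma continuous_avgOp (q : ℝ) (m : ℕ) {g : ℝ → ℝ} (hg : Continuous g) :
    Continuous (avgOp q m g) := continuous_avgComp q m 1 hg

lemma integral_avgComp (q : ℝ) (a n : ℕ) {g : ℝ → ℝ → ℝ} (hg : Continuous g.uncurry) (t : ℝ) :
    ∫ θ in (0:ℝ)..1, avgComp q a n (g θ) t = avgComp q a n (fun y => ∫ θ in (0:ℝ)..1, g θ y) t := by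
  induction n generalizing t with
  | zero => rfl
  | succ n ih =>
    simp only [avgComp, avgOp, paramAvg]
    rw [swap_of_continuous]
    · exact intervalIntegral.integral_congr fun y _ => ih _
    · have h1 := continuous_circParam q
      exact (continuous_avgComp_param q a n hg).comp (f := fun r : ℝ × ℝ =>
        (r.1, t + circParam q r.2 * gridDist (a + n) t)) (by fun_prop)

/-- Coupling principle: both averages run over the same parameters, so a bound for every realization
passes to the averages. One parameter for all cells of a level suffices, since an average at a point
sees only one cell per level. -/
lemma abs_avgComp_sub_le {q : ℝ} (hq : 0 ≤ q) {g g' : ℝ → ℝ} (hg : Continuous g)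
    (hg' : Continuous g') {B : ℝ} (a n : ℕ) {t t' : ℝ}
    (h : ∀ v : ℕ → ℤ → ℝ, (∀ m k, |v m k| ≤ q) →
      |g (cellComp v a n t) - g' (cellComp v a n t')| ≤ B) :
    |avgComp q a n g t - avgComp q a n g' t'| ≤ B := by
  induction n generalizing t t' with
  | zero => exact h 0 (by simpa using hq)
  | succ n ih =>
    simp only [avgComp, avgOp_eq]
    have hc : ∀ {g : ℝ → ℝ}, Continuous g → ∀ t, IntervalIntegrable
        (fun θ => avgComp q a n g (cellMap (a + n) (fun _ => circParam q θ) t)) volume 0 1 := by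
      intro g hg t
      refine Continuous.intervalIntegrable ?_ _ _
      have h1 := continuous_circParam q
      have h2 := continuous_avgComp q a n hg
      unfold cellMap
      fun_prop
    rw [← intervalIntegral.integral_sub (hc hg t) (hc hg' t')]
    have e : B = B * |(1:ℝ) - 0| := by rw [sub_zero, abs_one, mul_one]
    rw [e, ← Real.norm_eq_abs]
    refine intervalIntegral.norm_integral_le_of_norm_le_const fun θ _ => ?_
    rw [Real.norm_eq_abs]
    refine ih fun v hv => ?_
    have := h (Function.update v (a + n) fun _ => circParam q θ) fun m k => by
      by_cases hm : m = a + n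
      · subst hm; simpa using abs_circParam_le hq θ
      · rw [Function.update_of_ne hm]; exact hv m k
    have e : cellComp (Function.update v (a + n) fun _ => circParam q θ) a n = cellComp v a n :=
      cellComp_congr fun i hi => Function.update_of_ne (by omega) _ _
    rwa [cellComp_succ, cellComp_succ, e, Function.update_self] at this

lemma avgComp_const (q : ℝ) (a n : ℕ) (c : ℝ) : (avgComp q a n fun _ => c) = fun _ => c := by
  induction n with
  | zero => rfl
  | succ n ih => simp only [avgComp, ih]; ext t; simp [avgOp, paramAvg]

lemma abs_avgComp_le {q : ℝ} (hq : 0 ≤ q) {g : ℝ → ℝ} (hg : Continuous g) {B : ℝ}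
    (h : ∀ x, |g x| ≤ B) (a n : ℕ) (t : ℝ) : |avgComp q a n g t| ≤ B := by
  have := abs_avgComp_sub_le hq hg (continuous_const (y := (0:ℝ))) (B := B) a n (t := t) (t' := t)
    fun v _ => by simpa using h _
  rwa [avgComp_const, sub_zero] at this

/-! ### Decay of oscillatory integrals of averaged functions. -/

/-- The additive character `x ↦ exp (2πix)`. -/
noncomputable def ex (x : ℝ) : ℂ := Complex.exp ((2 * Real.pi * x : ℝ) * Complex.I)

lemma norm_ex (x : ℝ) : ‖ex x‖ = 1 := Complex.norm_exp_ofReal_mul_I _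

lemma ex_add (x y : ℝ) : ex (x + y) = ex x * ex y := by
  unfold ex; rw [← Complex.exp_add]; congr 1; push_cast; ring

lemma continuous_ex : Continuous ex := by unfold ex; fun_prop

lemma ex_half : ex (1 / 2) = -1 := by
  unfold ex
  rw [show 2 * Real.pi * (1 / 2) = Real.pi by ring, Complex.exp_pi_mul_I]

lemma ex_int (k : ℤ) : ex k = 1 := by
  unfold ex
  rw [Complex.exp_eq_one_iff]
  exact ⟨k, by push_cast; ring⟩

lemma ex_zero : ex 0 = 1 := by simpa using ex_int 0

lemma norm_ex_sub_le (x y : ℝ) : ‖ex x - ex y‖ ≤ 2 * Real.pi * |x - y| := by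
  have h : ex x - ex y = ex y * (ex (x - y) - 1) := by
    rw [mul_sub, ← ex_add, mul_one]; congr 2; ring
  rw [h, norm_mul, norm_ex, one_mul]
  unfold ex
  have := Real.norm_exp_I_mul_ofReal_sub_one_le (x := 2 * Real.pi * (x - y))
  rw [mul_comm] at this
  refine this.trans (le_of_eq ?_)
  rw [Real.norm_eq_abs, abs_mul, abs_of_pos (by positivity)]

/-- Oscillatory integrals are controlled by the modulus of continuity in the mean. -/
lemma norm_integral_mul_ex_le {φ : ℝ → ℝ} (hφ : Continuous φ) (h1 : ∀ x, |φ x| ≤ 1) {c d ν : ℝ}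
    (hcd : c ≤ d) (hν : 0 < ν) :
    ‖∫ t in c..d, φ t * ex (ν * t)‖ ≤
      (∫ t in c..d, |φ t - φ (t + 1 / (2 * ν))|) / 2 + 1 / (2 * ν) := by
  set s := 1 / (2 * ν) with hs
  have hs0 : 0 < s := by positivity
  have hex := continuous_ex
  have cont : Continuous fun t => (φ t : ℂ) * ex (ν * t) := by fun_prop
  have ii := fun a b => cont.intervalIntegrable (μ := volume) a b
  have bd : ∀ a b : ℝ, ‖∫ t in a..b, (φ t : ℂ) * ex (ν * t)‖ ≤ |b - a| := fun a b => by
    refine (intervalIntegral.norm_integral_le_of_norm_le_const (C := 1) fun x _ => ?_).trans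
      (by simp)
    rw [norm_mul, norm_ex, mul_one, Complex.norm_real]; exact h1 x
  -- A translation by half a period changes the sign of the character.
  have shift : ∫ t in c..d, (φ (t + s) : ℂ) * ex (ν * t) =
      -∫ t in (c + s)..(d + s), (φ t : ℂ) * ex (ν * t) := by
    rw [← intervalIntegral.integral_comp_add_right (fun t => (φ t : ℂ) * ex (ν * t)),
      ← intervalIntegral.integral_neg]
    refine intervalIntegral.integral_congr fun t _ => ?_
    have : ν * (t + s) = ν * t + 1 / 2 := by rw [hs]; field_simp
    simp only [this, ex_add, ex_half]; ring
  have key : 2 * ∫ t in c..d, (φ t : ℂ) * ex (ν * t) =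
      (∫ t in c..d, ((φ t - φ (t + s) : ℝ) : ℂ) * ex (ν * t)) +
      ((∫ t in c..(c + s), (φ t : ℂ) * ex (ν * t)) -
        ∫ t in d..(d + s), (φ t : ℂ) * ex (ν * t)) := by
    have e : (∫ t in c..d, ((φ t - φ (t + s) : ℝ) : ℂ) * ex (ν * t)) =
        (∫ t in c..d, (φ t : ℂ) * ex (ν * t)) - ∫ t in c..d, (φ (t + s) : ℂ) * ex (ν * t) := by
      rw [← intervalIntegral.integral_sub (ii _ _)
        (Continuous.intervalIntegrable (by fun_prop) _ _)]
      refine intervalIntegral.integral_congr fun t _ => ?_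
      push_cast; ring
    have e2 := intervalIntegral.integral_interval_sub_interval_comm (ii c d) (ii (c + s) (d + s))
      (ii c (c + s))
    rw [e, shift, ← e2]; ring
  have n1 : ‖∫ t in c..d, ((φ t - φ (t + s) : ℝ) : ℂ) * ex (ν * t)‖ ≤
      ∫ t in c..d, |φ t - φ (t + s)| := by
    refine (intervalIntegral.norm_integral_le_integral_norm hcd).trans (le_of_eq ?_)
    refine intervalIntegral.integral_congr fun t _ => ?_
    simp only [norm_mul, norm_ex, mul_one, Complex.norm_real, Real.norm_eq_abs]
  have n2 := bd c (c + s)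
  have n3 := bd d (d + s)
  rw [add_sub_cancel_left, abs_of_pos hs0] at n2 n3
  have n4 : 2 * ‖∫ t in c..d, (φ t : ℂ) * ex (ν * t)‖ ≤
      (∫ t in c..d, |φ t - φ (t + s)|) + (s + s) := by
    calc _ = ‖2 * ∫ t in c..d, (φ t : ℂ) * ex (ν * t)‖ := by simp
      _ ≤ _ := by
        rw [key]
        exact (norm_add_le _ _).trans (add_le_add n1 ((norm_sub_le _ _).trans (add_le_add n2 n3)))
  linarith

/-- A function small away from the end points of a dyadic cell has small integral over it. -/
lemma integral_cell_le {ψ : ℝ → ℝ} (hψ : Continuous ψ) {a : ℕ} {p : ℤ} {η β : ℝ} (hη : 0 ≤ η)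
    (hβ : 0 ≤ β) (h2 : ∀ t, |ψ t| ≤ 2)
    (h : ∀ t, η / 2 ^ a ≤ gridDist a t → |ψ t| ≤ β) :
    ∫ t in (p / 2 ^ a : ℝ)..((p + 1) / 2 ^ a), |ψ t| ≤ (4 * η + β) / 2 ^ a := by
  have hp : (0:ℝ) < 2 ^ a := by positivity
  have ii := fun x y => hψ.abs.intervalIntegrable (μ := volume) x y
  have bd : ∀ (B x y : ℝ), x ≤ y → (∀ t ∈ Set.Ioc x y, |ψ t| ≤ B) →
      ∫ t in x..y, |ψ t| ≤ B * (y - x) := fun B x y hxy hB => by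
    have := intervalIntegral.norm_integral_le_of_norm_le_const (a := x) (b := y) (C := B)
      (f := fun t => |ψ t|) (fun t ht => by
        rw [Set.uIoc_of_le hxy] at ht
        simpa using hB t ht)
    rw [abs_of_nonneg (sub_nonneg.2 hxy)] at this
    exact (le_abs_self _).trans this
  rcases le_or_gt (1 / 2) η with h5 | h5
  · refine (bd 2 _ _ (by gcongr; linarith) fun t _ => h2 t).trans ?_
    rw [← sub_div, ← mul_div_assoc]; gcongr; linarith
  rw [← intervalIntegral.integral_add_adjacent_intervals (b := (p + η) / 2 ^ a) (ii _ _) (ii _ _),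
    ← intervalIntegral.integral_add_adjacent_intervals (a := (p + η) / 2 ^ a)
      (b := (p + 1 - η) / 2 ^ a) (ii _ _) (ii _ _)]
  have i1 := bd 2 (p / 2 ^ a) ((p + η) / 2 ^ a) (by gcongr; linarith) fun t _ => h2 t
  have i3 := bd 2 ((p + 1 - η) / 2 ^ a) ((p + 1) / 2 ^ a) (by gcongr; linarith) fun t _ => h2 t
  have i2 := bd β ((p + η) / 2 ^ a) ((p + 1 - η) / 2 ^ a) (by gcongr; linarith) fun t ht => by
    apply h
    unfold gridDist
    gcongr
    have k1 := (div_lt_iff₀ hp).1 ht.1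
    have k2 := (le_div_iff₀ hp).1 ht.2
    rw [mul_comm] at k1 k2
    have e : tri (2 ^ a * t) = tri (2 ^ a * t - p) := by
      rw [← tri_add_int (2 ^ a * t - p) p, sub_add_cancel]
    rw [e]
    rcases le_total (2 ^ a * t - p) (1 / 2) with h6 | h6
    · rw [tri_eq_self (by linarith) h6]; linarith
    · rw [tri_eq_one_sub h6 (by linarith)]; linarith
  rw [← sub_div, ← mul_div_assoc] at i1 i2 i3
  refine (add_le_add i1 (add_le_add i2 i3)).trans ?_
  rw [← add_div, ← add_div]
  refine div_le_div_of_nonneg_right ?_ hp.le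
  nlinarith

/-- This is where 2 / 5 comes from: (7/5)^2 < 2 makes every composition Hölder of order 1/2. -/
lemma rpow_half_eq_sqrt_two_le {q : ℝ} (hq0 : 0 ≤ q) (hq : q ≤ 2 / 5) :
    1 + q ≤ (2:ℝ) ^ (1 - (1 / 2 : ℝ)) := by
  rw [show (1 - 1 / 2 : ℝ) = 1 / 2 by norm_num, ← Real.sqrt_eq_rpow]
  exact Real.le_sqrt_of_sq_le (by nlinarith)

/-- Grid points of level a are fixed by all finer maps, and the inverse Hölder bound with exponent 2
keeps other points away from them. -/
lemma le_gridDist_cellComp {q : ℝ} (hq : q ≤ 2 / 5) {v : ℕ → ℤ → ℝ} (hv : ∀ m k, |v m k| ≤ q)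
    {η : ℝ} (hη : 0 < η) (hη1 : η ≤ 1 / 2) {a : ℕ} (n : ℕ) {t : ℝ}
    (ht : η / 2 ^ a ≤ gridDist a t) : η ^ 2 / 8 / 2 ^ a ≤ gridDist a (cellComp v (a + 1) n t) := by
  have hp : (0:ℝ) < 2 ^ a := by positivity
  obtain ⟨k, hk⟩ := exists_gridDist_eq a (cellComp v (a + 1) n t)
  have h1 : η / 2 ^ a ≤ |t - k / 2 ^ a| := ht.trans (gridDist_le_abs_sub a t k)
  have h2 := cellComp_inv_holder hv (by linarith) (β := 2) (by norm_num)
    (by norm_num; linarith) (a + 1) n (t := t) (s := k / 2 ^ a) (x := 2 * η) (by linarith)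
    (by linarith) (by
      rw [div_le_iff₀ hp] at h1
      rw [pow_succ]; linarith)
  rw [cellComp_grid (Nat.le_succ a), ← hk] at h2
  rw [div_le_iff₀ hp]
  norm_num at h2
  rw [pow_succ (2:ℝ) a] at h2
  nlinarith

/-- Decay of the Fourier integrals of averaged functions over a dyadic cell. -/
lemma norm_integral_avgComp_mul_ex_le {q : ℝ} (hq0 : 0 < q) (hq : q ≤ 2 / 5) {g : ℝ → ℝ}
    (hg : Continuous g) (hg1 : ∀ x, |g x| ≤ 1) (a n : ℕ) (p : ℤ) {ν : ℝ} (hν : 0 < ν) :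
    ‖∫ t in (p / 2 ^ a : ℝ)..((p + 1) / 2 ^ a), avgComp q a (n + 1) g t * ex (ν * t)‖ ≤
      70 / q * (ν / 2 ^ a) ^ (-(1 / 8) : ℝ) / 2 ^ a := by
  have hp : (0:ℝ) < 2 ^ a := by positivity
  have hG := continuous_avgComp q a (n + 1) hg
  have hG1 := abs_avgComp_le hq0.le hg hg1 a (n + 1)
  set G := avgComp q a (n + 1) g with hGdef
  set x := ν / 2 ^ a with hx
  have hx0 : 0 < x := by positivity
  have hxν : ν = x * 2 ^ a := by rw [hx]; field_simp
  have hcq : 1 ≤ 70 / q := by rw [le_div_iff₀ hq0]; linarith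
  rcases le_or_gt 1 x with hx1 | hx1
  swap
  · have : 1 ≤ x ^ (-(1 / 8) : ℝ) := Real.one_le_rpow_of_pos_of_le_one_of_nonpos hx0 hx1.le (by norm_num)
    have h := intervalIntegral.norm_integral_le_of_norm_le_const (C := 1)
      (a := (p / 2 ^ a : ℝ)) (b := (p + 1) / 2 ^ a) (f := fun t => (G t : ℂ) * ex (ν * t))
      (fun t _ => by rw [norm_mul, norm_ex, mul_one, Complex.norm_real]; exact hG1 t)
    rw [← sub_div, add_sub_cancel_left, abs_of_pos (by positivity), one_mul] at h
    refine h.trans ?_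
    gcongr
    nlinarith
  -- Points within about y / 2^a of the grid cost O(y). Elsewhere a half-period shift moves the
  -- image by O(y^4 / 2^a), by Hölder continuity of order 1/2, while the Lipschitz constant is O(2^a
  -- / (q y^2)). The exponent 1/8 leaves room to spare.
  set y := x ^ (-(1 / 8) : ℝ) with hy
  have hy0 : 0 < y := by positivity
  have hy1 : y ≤ 1 := Real.rpow_le_one_of_one_le_of_nonpos hx1 (by norm_num)
  set s := 1 / (2 * ν) with hs
  have hs0 : 0 < s := by positivity
  have hxi : x⁻¹ ≤ y := by
    rw [hy, ← Real.rpow_neg_one]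
    exact Real.rpow_le_rpow_of_exponent_le hx1 (by norm_num)
  have hs2 : s = x⁻¹ / 2 / 2 ^ a := by rw [hs, hxν]; field_simp
  -- The extra x⁻¹ / 2 is the length of the shift, so that t + s is also at distance y / 2 from the
  -- grid in units of the cell.
  have hpt : ∀ t, (y / 2 + x⁻¹ / 2) / 2 ^ a ≤ gridDist a t → |G t - G (t + s)| ≤ 128 / q * y := by
    intro t ht
    rw [hGdef, avgComp_succ_front]
    refine abs_avgComp_sub_le hq0.le (continuous_avgOp q a hg) (continuous_avgOp q a hg) _ _ ?_
    intro v hv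
    set w := cellComp v (a + 1) n t
    set w' := cellComp v (a + 1) n (t + s)
    have hts : |t - (t + s)| = s := by rw [sub_add_cancel_left, abs_neg, abs_of_pos hs0]
    have e1 : 2 ^ (a + 1) * |t - (t + s)| = x⁻¹ := by
      rw [hts, hs2, pow_succ]; field_simp
    have k1 := cellComp_holder hv (by linarith) (α := 1 / 2) (by norm_num) (by norm_num)
      (rpow_half_eq_sqrt_two_le hq0.le hq) (a + 1) n (t := t) (s := t + s)
      (by rw [e1]; exact inv_le_one_of_one_le₀ hx1)
    rw [e1] at k1
    have k2 := le_gridDist_cellComp hq hv (η := y / 2) (by linarith) (by linarith) n (t := t)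
      (a := a) (le_trans (by gcongr; linarith [inv_pos.2 hx0]) ht)
    have k3 := le_gridDist_cellComp hq hv (η := y / 2) (by linarith) (by linarith) n (t := t + s)
      (a := a) (by
        have := (abs_le.1 (abs_gridDist_sub_le a t (t + s))).2
        rw [hts] at this
        rw [add_div, ← hs2] at ht
        linarith)
    refine (paramAvg_lipschitz hq0 (by linarith) hg hg1 (by positivity) k2 k3).trans ?_
    rw [div_le_iff₀ (by positivity)]
    have k4 := abs_gridDist_sub_le a w w'
    have e2 : (x⁻¹) ^ (1 / 2 : ℝ) = y ^ 4 := by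
      rw [hy, ← Real.rpow_natCast, ← Real.rpow_mul hx0.le, Real.inv_rpow hx0.le,
        ← Real.rpow_neg hx0.le]
      norm_num
    rw [e2, pow_succ] at k1
    have k5 : |w - w'| * 2 ^ a ≤ 2 * y ^ 4 := by
      have : 2 ^ a * 2 * |w - w'| ≤ 4 * y ^ 4 := k1
      linarith
    have k6 : |w - w'| ≤ 2 * y ^ 4 / 2 ^ a := by rwa [le_div_iff₀ hp]
    have e3 : 128 / q * y * (q * ((y / 2) ^ 2 / 8 / 2 ^ a)) = 4 * y ^ 3 / 2 ^ a := by
      field_simp; ring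
    rw [e3]
    have k7 : y ^ 4 ≤ y ^ 3 := by
      rw [pow_succ]; exact mul_le_of_le_one_right (by positivity) hy1
    calc |w - w'| + |gridDist a w - gridDist a w'| ≤ 2 * (2 * y ^ 4 / 2 ^ a) := by linarith
      _ = 4 * y ^ 4 / 2 ^ a := by ring
      _ ≤ _ := by gcongr
  have h2 : ∀ t, |G t - G (t + s)| ≤ 2 := fun t => by
    have := abs_sub (G t) (G (t + s))
    linarith [hG1 t, hG1 (t + s)]
  have h3 := integral_cell_le (ψ := fun t => G t - G (t + s)) (by fun_prop) (a := a) (p := p)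
    (η := y / 2 + x⁻¹ / 2) (β := 128 / q * y) (by positivity) (by positivity) h2 hpt
  have h4 := norm_integral_mul_ex_le hG hG1 (c := p / 2 ^ a) (d := (p + 1) / 2 ^ a) (ν := ν)
    (by gcongr; linarith) hν
  refine h4.trans ?_
  rw [← hs]
  have h5 : s ≤ y / 2 / 2 ^ a := by rw [hs2]; gcongr
  have h6 : (4 * (y / 2 + x⁻¹ / 2) + 128 / q * y) / 2 ^ a ≤ (4 + 128 / q) * y / 2 ^ a := by
    gcongr; linarith
  have h7 : (4 + 128 / q) * y / 2 ^ a / 2 + y / 2 / 2 ^ a ≤ 70 / q * y / 2 ^ a := by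
    have e : (4 + 128 / q) * y / 2 ^ a / 2 + y / 2 / 2 ^ a = (5 / 2 + 64 / q) * y / 2 ^ a := by
      field_simp; ring
    rw [e]
    gcongr
    have : 5 / 2 ≤ 6 / q := by rw [le_div_iff₀ hq0]; linarith
    calc 5 / 2 + 64 / q ≤ 6 / q + 64 / q := by linarith
      _ = _ := by ring
  linarith

/-- On the segment around `w` swept by the cell maps of level `m + 1` the distance to the grid of
level `m` is affine. -/
lemma exists_gridDist_add_eq (m : ℕ) (w : ℝ) : ∃ σ : ℝ, |σ| = 1 ∧ ∀ r : ℝ, |r| ≤ 1 →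
    gridDist m (w + r * gridDist (m + 1) w) = gridDist m w + r * (σ * gridDist (m + 1) w) := by
  have hp : (0:ℝ) < 2 ^ m := by positivity
  set y := Int.fract (2 ^ m * w) with hy
  set d := tri (2 ^ (m + 1) * w) / 2 with hd
  have hy0 : 0 ≤ y := Int.fract_nonneg _
  have hy1 : y < 1 := Int.fract_lt_one _
  have hw : 2 ^ m * w = y + ⌊2 ^ m * w⌋ := (Int.fract_add_floor _).symm
  have e1 : ∀ r, gridDist m (w + r * gridDist (m + 1) w) = tri (y + r * d) / 2 ^ m := by
    intro r
    unfold gridDist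
    rw [← tri_add_int (y + r * d) ⌊2 ^ m * w⌋]
    congr 2
    rw [hd, pow_succ]; field_simp; linarith
  have e2 : gridDist m w = tri y / 2 ^ m := by simpa using e1 0
  have e3 : gridDist (m + 1) w = d / 2 ^ m := by
    rw [hd]; unfold gridDist; rw [pow_succ]; field_simp
  have hd0 : 0 ≤ d := div_nonneg (tri_nonneg _) (by norm_num)
  -- The kinks of the grid distance of level m lie on the grid of level m + 1, so the swept segment
  -- does not cross any.
  have dle : ∀ k : ℤ, d ≤ |y - k / 2| := by
    intro k
    have := tri_le_abs_sub_int (2 ^ (m + 1) * w) (2 * ⌊2 ^ m * w⌋ + k)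
    have e : 2 ^ (m + 1) * w - ((2 * ⌊2 ^ m * w⌋ + k : ℤ) : ℝ) = 2 * (y - k / 2) := by
      rw [pow_succ]; push_cast; linarith
    rw [e, abs_mul, abs_two] at this
    rw [hd]; linarith
  have rd : ∀ r : ℝ, |r| ≤ 1 → -d ≤ r * d ∧ r * d ≤ d := fun r hr => by
    have := abs_le.1 hr
    constructor <;> nlinarith
  rcases le_total y (1 / 2) with h | h
  · refine ⟨1, abs_one, fun r hr => ?_⟩
    have a0 := dle 0
    have a1 := dle 1
    simp only [Int.cast_zero, zero_div, sub_zero, Int.cast_one] at a0 a1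
    rw [abs_of_nonneg hy0] at a0
    rw [abs_of_nonpos (by linarith)] at a1
    obtain ⟨r1, r2⟩ := rd r hr
    rw [e1, e2, e3, tri_eq_self (by linarith) (by linarith), tri_eq_self hy0 h]; ring
  · refine ⟨-1, by simp, fun r hr => ?_⟩
    have a0 := dle 1
    have a1 := dle 2
    norm_num at a0 a1
    rw [abs_of_nonneg (by linarith)] at a0
    rw [abs_of_nonpos (by linarith)] at a1
    obtain ⟨r1, r2⟩ := rd r hr
    rw [e1, e2, e3, tri_eq_one_sub (by linarith) (by linarith), tri_eq_one_sub h hy1.le]; ring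

/-- Averages of `g` composed with a cell map depend on the parameter in a Hölder way, in the mean. -/
lemma integral_abs_avgComp_sub_le {q : ℝ} (hq0 : 0 < q) (hq : q ≤ 2 / 5) {g : ℝ → ℝ}
    (hg : Continuous g) (hg1 : ∀ x, |g x| ≤ 1) (m n : ℕ) (p : ℤ) {u u' : ℝ} (hu : |u| ≤ q)
    (hu' : |u'| ≤ q) :
    ∫ t in (p / 2 ^ (m + 1) : ℝ)..((p + 1) / 2 ^ (m + 1)),
      |avgComp q (m + 1) (n + 1) (fun t => g (t + u * gridDist m t)) t -
        avgComp q (m + 1) (n + 1) (fun t => g (t + u' * gridDist m t)) t| ≤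
      100 / q * |u - u'| ^ (1 / 3 : ℝ) / 2 ^ (m + 1) := by
  have hp : (0:ℝ) < 2 ^ m := by positivity
  have hp1 : (0:ℝ) < 2 ^ (m + 1) := by positivity
  rcases eq_or_ne u u' with rfl | hne
  · simp
  have hgd := continuous_gridDist m
  have hgu : ∀ u : ℝ, Continuous fun t => g (t + u * gridDist m t) := fun u => by fun_prop
  set Δ := |u - u'| with hΔ
  have hΔ0 : 0 < Δ := abs_pos.2 (sub_ne_zero.2 hne)
  have hΔ1 : Δ ≤ 1 := by
    have := abs_sub u u'
    linarith
  -- Balances the excluded part near the grid, O(y), against the Lipschitz estimate Δ / (q y^2)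
  -- elsewhere.
  set y := Δ ^ (1 / 3 : ℝ) with hy
  have hy0 : 0 < y := by positivity
  have hy1 : y ≤ 1 := Real.rpow_le_one hΔ0.le hΔ1 (by norm_num)
  have hy3 : Δ = y ^ 3 := by
    rw [hy, ← Real.rpow_natCast, ← Real.rpow_mul hΔ0.le]; norm_num
  have hG := fun u : ℝ => continuous_avgComp q (m + 1) (n + 1) (hgu u)
  have hG1 := fun u : ℝ => abs_avgComp_le hq0.le (hgu u) (fun x => hg1 _) (m + 1) (n + 1)
  refine (integral_cell_le (η := y / 2) (β := 96 / q * y) ((hG u).sub (hG u')) (by positivity)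
    (by positivity) (fun t => ?_) fun t ht => ?_).trans ?_
  · have := abs_sub (avgComp q (m + 1) (n + 1) (fun t => g (t + u * gridDist m t)) t)
      (avgComp q (m + 1) (n + 1) (fun t => g (t + u' * gridDist m t)) t)
    exact this.trans (by linarith [hG1 u t, hG1 u' t])
  · rw [Pi.sub_apply, avgComp_succ_front, avgComp_succ_front]
    refine abs_avgComp_sub_le hq0.le (continuous_avgOp _ _ (hgu u)) (continuous_avgOp _ _ (hgu u'))
      _ _ fun v hv => ?_
    have k2 := le_gridDist_cellComp hq hv (η := y / 2) (by linarith) (by linarith) n ht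
    set w := cellComp v (m + 1 + 1) n t
    obtain ⟨σ, hσ, hσ2⟩ := exists_gridDist_add_eq m w
    have hq1 : q ≤ 1 := by linarith
    -- By affinity the level m map only changes the center and the radius of the interval over which
    -- g is averaged, and the radius shrinks at most by a factor 1 - q > 1/2.
    have eq : ∀ u : ℝ, avgOp q (m + 1) (fun t => g (t + u * gridDist m t)) w =
        paramAvg q g (w + u * gridDist m w) ((1 + u * σ) * gridDist (m + 1) w) := by
      intro u
      unfold avgOp paramAvg
      refine intervalIntegral.integral_congr fun θ _ => ?_
      simp only
      rw [hσ2 _ ((abs_circParam_le hq0.le θ).trans hq1)]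
      congr 1; ring
    rw [eq, eq]
    have hD0 := gridDist_nonneg (m + 1) w
    have le2 : ∀ u : ℝ, |u| ≤ q → (y / 2) ^ 2 / 8 / 2 ^ (m + 1) / 2 ≤
        (1 + u * σ) * gridDist (m + 1) w := by
      intro u hu
      have : |u * σ| ≤ q := by rw [abs_mul, hσ, mul_one]; exact hu
      have := abs_le.1 this
      nlinarith
    refine (paramAvg_lipschitz hq0 (by linarith) hg hg1 (by positivity) (le2 u hu)
      (le2 u' hu')).trans ?_
    rw [div_le_iff₀ (by positivity)]
    have d1 : |w + u * gridDist m w - (w + u' * gridDist m w)| ≤ Δ * (1 / 2 / 2 ^ m) := by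
      rw [show w + u * gridDist m w - (w + u' * gridDist m w) = (u - u') * gridDist m w by ring,
        abs_mul, abs_of_nonneg (gridDist_nonneg _ _)]
      gcongr
      exact gridDist_le _ _
    have d2 : |(1 + u * σ) * gridDist (m + 1) w - (1 + u' * σ) * gridDist (m + 1) w| ≤
        Δ * (1 / 2 / 2 ^ (m + 1)) := by
      rw [show (1 + u * σ) * gridDist (m + 1) w - (1 + u' * σ) * gridDist (m + 1) w =
        (u - u') * σ * gridDist (m + 1) w by ring,
        abs_mul, abs_mul, hσ, mul_one, abs_of_nonneg hD0]
      gcongr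
      exact gridDist_le _ _
    refine (add_le_add d1 d2).trans ?_
    rw [hy3, pow_succ (2:ℝ) m]
    have e : 96 / q * y * (q * ((y / 2) ^ 2 / 8 / (2 ^ m * 2) / 2)) = (3 / 4) * y ^ 3 / 2 ^ m := by
      field_simp; ring
    rw [e]
    apply le_of_eq
    field_simp; ring
  · gcongr
    have : 2 ≤ 4 / q := by rw [le_div_iff₀ hq0]; linarith
    calc 4 * (y / 2) + 96 / q * y = (2 + 96 / q) * y := by ring
      _ ≤ (4 / q + 96 / q) * y := by gcongr
      _ = _ := by ring

/-! ### Balancing sums by exponential moments. -/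

/-- Hoeffding's chord argument: convexity bounds the exponential on [-b, b] by an affine function of
y, whose linear term disappears after averaging. -/
lemma cosh_add_le {b : ℝ} (hb : 0 < b) (s : ℝ) {y : ℝ} (hy : |y| ≤ b) :
    Real.cosh (s + y) ≤ Real.cosh s * Real.cosh b + y / b * (Real.sinh s * Real.sinh b) := by
  have h1 := abs_le.1 hy
  have key : ∀ x : ℝ, Real.exp (x * y) ≤ (1 - y / b) / 2 * Real.exp (-(x * b)) +
      (1 + y / b) / 2 * Real.exp (x * b) := by
    intro x
    have hyb : |y / b| ≤ 1 := by
      rw [abs_div, abs_of_pos hb]; exact div_le_one_of_le₀ hy hb.le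
    have h2 := abs_le.1 hyb
    have ha : 0 ≤ (1 - y / b) / 2 := by linarith
    have hb' : 0 ≤ (1 + y / b) / 2 := by linarith
    have := convexOn_exp.2 (Set.mem_univ (-(x * b))) (Set.mem_univ (x * b)) ha hb' (by ring)
    simp only [smul_eq_mul] at this
    have e : x * y = (1 - y / b) / 2 * -(x * b) + (1 + y / b) / 2 * (x * b) := by field_simp; ring
    rw [e]; exact this
  have k1 := key 1
  have k2 := key (-1)
  simp only [one_mul, neg_mul, neg_neg] at k1 k2
  have e1 := Real.exp_pos s
  have e2 := Real.exp_pos (-s)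
  rw [Real.cosh_eq, neg_add, Real.exp_add, Real.exp_add, Real.cosh_eq, Real.cosh_eq, Real.sinh_eq,
    Real.sinh_eq]
  have m1 := mul_le_mul_of_nonneg_left k1 e1.le
  have m2 := mul_le_mul_of_nonneg_left k2 e2.le
  have : (Real.exp s + Real.exp (-s)) / 2 * ((Real.exp b + Real.exp (-b)) / 2) +
      y / b * ((Real.exp s - Real.exp (-s)) / 2 * ((Real.exp b - Real.exp (-b)) / 2)) =
      (Real.exp s * ((1 - y / b) / 2 * Real.exp (-b) + (1 + y / b) / 2 * Real.exp b) +
       Real.exp (-s) * ((1 - y / b) / 2 * Real.exp b + (1 + y / b) / 2 * Real.exp (-b))) / 2 := by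
    ring
  rw [this]
  linarith

lemma integral_cosh_add_le {b : ℝ} (hb : 0 < b) (s : ℝ) {Y : ℝ → ℝ} (hY : Continuous Y)
    (hYb : ∀ θ, |Y θ| ≤ b) (h0 : ∫ θ in (0:ℝ)..1, Y θ = 0) :
    ∫ θ in (0:ℝ)..1, Real.cosh (s + Y θ) ≤ Real.exp (b ^ 2 / 2) * Real.cosh s := by
  have h1 : ∫ θ in (0:ℝ)..1, Real.cosh (s + Y θ) ≤
      ∫ θ in (0:ℝ)..1, (Real.cosh s * Real.cosh b + Y θ / b * (Real.sinh s * Real.sinh b)) := by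
    refine intervalIntegral.integral_mono_on zero_le_one
      (Continuous.intervalIntegrable ?_ _ _) (Continuous.intervalIntegrable (by fun_prop) _ _)
      fun θ _ => cosh_add_le hb s (hYb θ)
    exact Real.continuous_cosh.comp (by fun_prop)
  have h2 : ∫ θ in (0:ℝ)..1, (Real.cosh s * Real.cosh b + Y θ / b * (Real.sinh s * Real.sinh b)) =
      Real.cosh s * Real.cosh b := by
    rw [intervalIntegral.integral_add (Continuous.intervalIntegrable (by fun_prop) _ _)
      (Continuous.intervalIntegrable (by fun_prop) _ _), intervalIntegral.integral_mul_const,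
      intervalIntegral.integral_mul_const, intervalIntegral.integral_div, h0]
    simp
  rw [h2] at h1
  refine h1.trans ?_
  rw [mul_comm]
  exact mul_le_mul_of_nonneg_right (Real.cosh_le_exp_half_sq b) (Real.cosh_pos s).le

lemma exists_le_of_integral_le {Φ : ℝ → ℝ} (hΦ : Continuous Φ) {c : ℝ}
    (h : ∫ θ in (0:ℝ)..1, Φ θ ≤ c) : ∃ θ, Φ θ ≤ c := by
  by_contra! hc
  have := intervalIntegral.integral_lt_integral_of_continuousOn_of_le_of_exists_lt
    (f := fun _ => c) (g := Φ) zero_lt_one continuousOn_const hΦ.continuousOn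
    (fun x _ => (hc x).le) ⟨0, by simp, hc 0⟩
  simp at this
  linarith

/-- Sequential choice of parameters balancing finitely many sums of mean zero functions. -/
lemma exists_sum_cosh_le {ι : Type*} (P : Finset ι) (Z : ℕ → ι → ℝ → ℂ) {b : ℝ} (hb : 0 < b)
    (hc : ∀ k p, Continuous (Z k p)) (h0 : ∀ k p, ∫ θ in (0:ℝ)..1, Z k p θ = 0)
    (hZ : ∀ k p θ, ‖Z k p θ‖ ≤ b) (K : ℕ) :
    ∃ σ : ℕ → ℝ, ∑ p ∈ P, (Real.cosh (∑ k ∈ Finset.range K, Z k p (σ k)).re +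
      Real.cosh (∑ k ∈ Finset.range K, Z k p (σ k)).im) ≤
      2 * P.card * Real.exp (K * (b ^ 2 / 2)) := by
  induction K with
  | zero => exact ⟨0, by simp; ring_nf; rfl⟩
  | succ K ih =>
    obtain ⟨σ, hσ⟩ := ih
    set S := fun p => ∑ k ∈ Finset.range K, Z k p (σ k) with hS
    have ere : ∀ p θ, (S p + Z K p θ).re = (S p).re + (Z K p θ).re := fun _ _ => rfl
    have eim : ∀ p θ, (S p + Z K p θ).im = (S p).im + (Z K p θ).im := fun _ _ => rfl
    have cre : ∀ p, Continuous fun θ => (Z K p θ).re := fun p => Complex.continuous_re.comp (hc K p)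
    have cim : ∀ p, Continuous fun θ => (Z K p θ).im := fun p => Complex.continuous_im.comp (hc K p)
    have ccre : ∀ p, Continuous fun θ => Real.cosh (S p + Z K p θ).re := fun p => by
      simp_rw [ere]; exact Real.continuous_cosh.comp (continuous_const.add (cre p))
    have ccim : ∀ p, Continuous fun θ => Real.cosh (S p + Z K p θ).im := fun p => by
      simp_rw [eim]; exact Real.continuous_cosh.comp (continuous_const.add (cim p))
    have ire : ∀ p, ∫ θ in (0:ℝ)..1, (Z K p θ).re = 0 := fun p => by
      have := (Complex.reCLM.intervalIntegral_comp_comm ((hc K p).intervalIntegrable (μ := volume) 0 1))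
      simpa [h0] using this
    have iim : ∀ p, ∫ θ in (0:ℝ)..1, (Z K p θ).im = 0 := fun p => by
      have := (Complex.imCLM.intervalIntegral_comp_comm ((hc K p).intervalIntegrable (μ := volume) 0 1))
      simpa [h0] using this
    obtain ⟨θ, hθ⟩ := exists_le_of_integral_le
      (Φ := fun θ => ∑ p ∈ P, (Real.cosh (S p + Z K p θ).re + Real.cosh (S p + Z K p θ).im))
      (c := Real.exp (b ^ 2 / 2) * ∑ p ∈ P, (Real.cosh (S p).re + Real.cosh (S p).im))
      (continuous_finsetSum _ fun p _ => (ccre p).add (ccim p)) (by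
        rw [intervalIntegral.integral_finsetSum fun p _ => Continuous.intervalIntegrable
          (by have := ccre p; have := ccim p; fun_prop) _ _, Finset.mul_sum]
        refine Finset.sum_le_sum fun p _ => ?_
        rw [intervalIntegral.integral_add ((ccre p).intervalIntegrable _ _)
          ((ccim p).intervalIntegrable _ _), mul_add]
        refine add_le_add ?_ ?_
        · simp_rw [ere]
          exact integral_cosh_add_le hb _ (cre p)
            (fun θ => (Complex.abs_re_le_norm _).trans (hZ _ _ _)) (ire p)
        · simp_rw [eim]
          exact integral_cosh_add_le hb _ (cim p)
            (fun θ => (Complex.abs_im_le_norm _).trans (hZ _ _ _)) (iim p))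
    refine ⟨Function.update σ K θ, ?_⟩
    have e : ∀ p, ∑ k ∈ Finset.range (K + 1), Z k p (Function.update σ K θ k) = S p + Z K p θ := by
      intro p
      rw [Finset.sum_range_succ, Function.update_self]
      congr 1
      refine Finset.sum_congr rfl fun k hk => ?_
      rw [Function.update_of_ne (Finset.mem_range.1 hk).ne]
    simp_rw [e]
    refine hθ.trans ((mul_le_mul_of_nonneg_left hσ (Real.exp_pos _).le).trans (le_of_eq ?_))
    push_cast
    rw [add_mul, one_mul, Real.exp_add]; ring

/-- Dividing by b √K makes the total exponent 1/2, so every cosh is at most a multiple of the number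
of sums, and taking logarithms gives the bound. The loss of a full logarithm instead of its square
root is harmless. -/
lemma exists_norm_sum_le {ι : Type*} (P : Finset ι) (Z : ℕ → ι → ℝ → ℂ) {b : ℝ} (hb : 0 < b)
    (hc : ∀ k p, Continuous (Z k p)) (h0 : ∀ k p, ∫ θ in (0:ℝ)..1, Z k p θ = 0)
    (hZ : ∀ k p θ, ‖Z k p θ‖ ≤ b) {K : ℕ} {y : ℝ} (hy : 0 < y) (hyK : y ^ 2 = K) :
    ∃ σ : ℕ → ℝ, ∀ p ∈ P, ‖∑ k ∈ Finset.range K, Z k p (σ k)‖ ≤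
      2 * b * y * (Real.log (4 * P.card) + 1 / 2) := by
  have hby : 0 < b * y := mul_pos hb hy
  obtain ⟨σ, hσ⟩ := exists_sum_cosh_le P (fun k p θ => ((b * y)⁻¹ : ℝ) • Z k p θ)
    (b := y⁻¹) (inv_pos.2 hy) (fun k p => by have := hc k p; fun_prop) (fun k p => by
      rw [intervalIntegral.integral_smul, h0, smul_zero]) (fun k p θ => by
      rw [norm_smul, Real.norm_eq_abs, abs_of_pos (inv_pos.2 hby), mul_inv]
      calc b⁻¹ * y⁻¹ * ‖Z k p θ‖ ≤ b⁻¹ * y⁻¹ * b := by gcongr; exact hZ _ _ _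
        _ = y⁻¹ := by field_simp) K
  refine ⟨σ, fun p hp => ?_⟩
  have hP : (0:ℝ) < P.card := by exact_mod_cast Finset.card_pos.2 ⟨p, hp⟩
  set S := ∑ k ∈ Finset.range K, Z k p (σ k) with hS
  have h1 := (Finset.single_le_sum (f := fun p =>
      Real.cosh (∑ k ∈ Finset.range K, ((b * y)⁻¹ : ℝ) • Z k p (σ k)).re +
      Real.cosh (∑ k ∈ Finset.range K, ((b * y)⁻¹ : ℝ) • Z k p (σ k)).im)
    (fun p _ => (add_pos (Real.cosh_pos _) (Real.cosh_pos _)).le) hp).trans hσ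
  simp only [← Finset.smul_sum, ← hS, Complex.smul_re, Complex.smul_im, smul_eq_mul] at h1
  have e1 : (K : ℝ) * (y⁻¹ ^ 2 / 2) = 1 / 2 := by rw [← hyK]; field_simp
  rw [e1] at h1
  have main : ∀ x : ℝ, Real.cosh ((b * y)⁻¹ * x) ≤ 2 * P.card * Real.exp (1 / 2) →
      |x| ≤ b * y * (Real.log (4 * P.card) + 1 / 2) := by
    intro x hx
    have h2 : Real.exp (|(b * y)⁻¹ * x|) ≤ 4 * P.card * Real.exp (1 / 2) := by
      rw [← Real.cosh_abs, Real.cosh_eq] at hx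
      have := Real.exp_pos (-|(b * y)⁻¹ * x|)
      linarith
    have h3 := Real.log_le_log (Real.exp_pos _) h2
    rw [Real.log_exp, Real.log_mul (by positivity) (by positivity), Real.log_exp, abs_mul,
      abs_of_pos (inv_pos.2 hby), inv_mul_le_iff₀ hby] at h3
    exact h3
  have hre := main S.re (by linarith [Real.one_le_cosh ((b * y)⁻¹ * S.im)])
  have him := main S.im (by linarith [Real.one_le_cosh ((b * y)⁻¹ * S.re)])
  have := Complex.norm_le_abs_re_add_abs_im S
  linarith

/-! ### Balanced blocks in abstract oscillatory families. -/

/-- Families of oscillatory integrals `Y k ν θ` over consecutive unit cells `k`, with frequency `ν`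
and a periodic parameter `θ`. -/
structure OscFamily (H : ℝ) (Y : ℕ → ℝ → ℝ → ℂ) : Prop where
  cont : ∀ k ν, Continuous (Y k ν)
  periodic : ∀ k ν θ, Y k ν (θ + 1) = Y k ν θ
  mean : ∀ k ν, ∫ θ in (0:ℝ)..1, Y k ν θ = 0
  bound : ∀ k ν θ, ‖Y k ν θ‖ ≤ 2
  holder : ∀ k ν θ θ', ‖Y k ν θ - Y k ν θ'‖ ≤ H * |θ - θ'| ^ (1 / 3 : ℝ)
  lip : ∀ k ν ν' θ, ‖Y k ν θ - Y k ν' θ‖ ≤ H * |ν - ν'|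
  decay : ∀ k ν θ, 0 < ν → ‖Y k ν θ‖ ≤ H * ν ^ (-(1 / 8) : ℝ)

/-- The sum over the `a`-th block of `N` cells, with parameters `θ` shifted by `r`. -/
noncomputable def blockSum (Y : ℕ → ℝ → ℝ → ℂ) (θ : ℕ → ℝ) (N a : ℕ) (ν r : ℝ) : ℂ :=
  ∑ i ∈ Finset.range N, ex (ν * i) * Y (a * N + i) ν (θ (a * N + i) + r)

lemma sum_range_mul {E : Type*} [AddCommMonoid E] (f : ℕ → E) (M N : ℕ) :
    ∑ j ∈ Finset.range (M * N), f j =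
      ∑ k ∈ Finset.range M, ∑ i ∈ Finset.range N, f (k * N + i) := by
  induction M with
  | zero => simp
  | succ M ih => rw [Nat.succ_mul, Finset.sum_range_add, ih, Finset.sum_range_succ]

lemma blockSum_mul (Y : ℕ → ℝ → ℝ → ℂ) (θ : ℕ → ℝ) (M N a : ℕ) (ν r : ℝ) :
    blockSum Y θ (M * N) a ν r =
      ∑ k ∈ Finset.range M, ex (ν * (k * N)) * blockSum Y θ N (a * M + k) ν r := by
  unfold blockSum
  rw [sum_range_mul]
  refine Finset.sum_congr rfl fun k _ => ?_
  rw [Finset.mul_sum]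
  refine Finset.sum_congr rfl fun i _ => ?_
  have e : a * (M * N) + (k * N + i) = (a * M + k) * N + i := by ring
  rw [e, ← mul_assoc, ← ex_add]
  congr 2
  push_cast; ring

/-- The reason for quantifying balance over all r: rotating a whole block does not affect such an
estimate. -/
lemma blockSum_shift (Y : ℕ → ℝ → ℝ → ℂ) {θ θ' : ℕ → ℝ} {N a : ℕ} {s : ℝ}
    (h : ∀ i < N, θ' (a * N + i) = θ (a * N + i) + s) (ν r : ℝ) :
    blockSum Y θ' N a ν r = blockSum Y θ N a ν (r + s) := by
  unfold blockSum
  refine Finset.sum_congr rfl fun i hi => ?_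
  rw [h i (Finset.mem_range.1 hi), add_assoc, add_comm s]

section
variable {H : ℝ} {Y : ℕ → ℝ → ℝ → ℂ}

lemma OscFamily.periodic_int (h : OscFamily H Y) (k : ℕ) (ν θ : ℝ) (z : ℤ) :
    Y k ν (θ + z) = Y k ν θ := by
  have : Function.Periodic (Y k ν) 1 := h.periodic k ν
  simpa using this.int_mul z θ

lemma norm_blockSum_le_of {N a : ℕ} {θ : ℕ → ℝ} {ν r B : ℝ}
    (h : ∀ k, ‖Y k ν (θ k + r)‖ ≤ B) : ‖blockSum Y θ N a ν r‖ ≤ N * B := by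
  unfold blockSum
  refine (norm_sum_le _ _).trans ((Finset.sum_le_card_nsmul _ _ B fun i _ => ?_).trans
    (by rw [Finset.card_range, nsmul_eq_mul]))
  rw [norm_mul, norm_ex, one_mul]; exact h _

/-- Allows frequencies and rotations to be restricted to a finite net. The 14 is the bound 2 for the
terms times 7 > 2π. -/
lemma OscFamily.norm_blockSum_sub_le (h : OscFamily H Y) (hH : 1 ≤ H) (θ : ℕ → ℝ) (N a : ℕ)
    (ν ν' r r' : ℝ) : ‖blockSum Y θ N a ν r - blockSum Y θ N a ν' r'‖ ≤
      N * (14 * H * (N + 1) * |ν - ν'| + H * |r - r'| ^ (1 / 3 : ℝ)) := by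
  unfold blockSum
  rw [← Finset.sum_sub_distrib]
  refine (norm_sum_le _ _).trans ((Finset.sum_le_card_nsmul _ _
    (14 * H * (N + 1) * |ν - ν'| + H * |r - r'| ^ (1 / 3 : ℝ)) fun i hi => ?_).trans
    (by rw [Finset.card_range, nsmul_eq_mul]))
  have hiN : (i : ℝ) ≤ N := by exact_mod_cast (Finset.mem_range.1 hi).le
  set k := a * N + i
  have e : ex (ν * i) * Y k ν (θ k + r) - ex (ν' * i) * Y k ν' (θ k + r') =
      (ex (ν * i) - ex (ν' * i)) * Y k ν (θ k + r) +
      ex (ν' * i) * ((Y k ν (θ k + r) - Y k ν' (θ k + r)) +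
        (Y k ν' (θ k + r) - Y k ν' (θ k + r'))) := by ring
  rw [e]
  refine (norm_add_le _ _).trans ?_
  rw [norm_mul, norm_mul, norm_ex, one_mul]
  have h1 : ‖ex (ν * i) - ex (ν' * i)‖ ≤ 7 * (N * |ν - ν'|) := by
    refine (norm_ex_sub_le _ _).trans ?_
    rw [← sub_mul, abs_mul, Nat.abs_cast, mul_comm |ν - ν'|]
    gcongr
    linarith [Real.pi_lt_d2]
  have h2 := h.bound k ν (θ k + r)
  have h3 := h.lip k ν ν' (θ k + r)
  have h4 := h.holder k ν' (θ k + r) (θ k + r')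
  rw [add_sub_add_left_eq_sub] at h4
  have h5 : ‖ex (ν * i) - ex (ν' * i)‖ * ‖Y k ν (θ k + r)‖ ≤ 7 * (N * |ν - ν'|) * 2 := by gcongr
  have h6 := norm_add_le (Y k ν (θ k + r) - Y k ν' (θ k + r))
    (Y k ν' (θ k + r) - Y k ν' (θ k + r'))
  have h7 : 0 ≤ N * |ν - ν'| := by positivity
  have h8 : 0 ≤ |ν - ν'| := abs_nonneg _
  nlinarith

lemma log_net_le {x : ℝ} (hx : 1 ≤ x) {n : ℝ} (hn : 0 < n) (hn2 : n ≤ 8 * (x ^ 8) ^ 8) :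
    Real.log n + 1 / 2 ≤ 67 * x := by
  have h1 := Real.log_le_log hn hn2
  rw [Real.log_mul (by norm_num) (by positivity), Real.log_pow, Real.log_pow,
    show (8:ℝ) = 2 ^ 3 by norm_num, Real.log_pow] at h1
  have h2 := Real.log_le_sub_one_of_pos (by linarith : 0 < x)
  have h3 := Real.log_two_lt_d9
  push_cast at h1
  linarith

/-- Blocks of `N` cells that are balanced for all shifts can be shifted against each other so that
the blocks of `N ^ 2` cells are balanced for all shifts. -/
lemma OscFamily.exists_shift (h : OscFamily H Y) (hH : 1 ≤ H) {C : ℝ} (hC : H ≤ C) {N : ℕ} {x : ℝ}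
    (hx0 : 0 < x) (hx : 149 ≤ x ^ 2) (hN : x ^ 8 = N) {θ : ℕ → ℝ}
    (hθ : ∀ a ν r, 0 ≤ ν → ‖blockSum Y θ N a ν r‖ ≤ C * x ^ 7) :
    ∃ σ : ℕ → ℝ, ∀ a ν r, 0 ≤ ν →
      ‖blockSum Y (fun j => θ j + σ (j / N)) (N * N) a ν r‖ ≤ C * (x ^ 2) ^ 7 := by
  have hx1 : 1 ≤ x := by nlinarith
  have hN0 : (0:ℝ) < N := by rw [← hN]; positivity
  have hNpos : 0 < N := by exact_mod_cast hN0
  have hN1 : (1:ℝ) ≤ N := by exact_mod_cast hNpos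
  have hC0 : 0 < C := by linarith
  -- The net has mesh N^-3 and covers the frequencies up to N^2 and the rotations in [0, 1).
  let P : Finset (ℕ × ℕ) := Finset.range (N ^ 5 + 1) ×ˢ Finset.range (N ^ 3)
  let Z : ℕ → ℕ → ℕ × ℕ → ℝ → ℂ := fun a k p s => ex (p.1 / (N:ℝ) ^ 3 * (k * N)) *
    blockSum Y θ N (a * N + k) (p.1 / (N:ℝ) ^ 3) (p.2 / (N:ℝ) ^ 3 + s)
  have cS : ∀ a ν r, Continuous fun s => blockSum Y θ N a ν (r + s) := fun a ν r => by
    unfold blockSum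
    refine continuous_finsetSum _ fun i _ => continuous_const.mul ((h.cont _ _).comp (by fun_prop))
  -- The rotations are selected separately inside each block of N^2 cells, so the number of such
  -- blocks never enters.
  have ex1 : ∀ a, ∃ σ : ℕ → ℝ, ∀ p ∈ P, ‖∑ k ∈ Finset.range N, Z a k p (σ k)‖ ≤
      2 * (C * x ^ 7) * x ^ 4 * (Real.log (4 * P.card) + 1 / 2) := fun a => by
    refine exists_norm_sum_le P (Z a) (by positivity) (fun k p => continuous_const.mul (cS _ _ _))
      (fun k p => ?_) (fun k p s => ?_) (by positivity) (by rw [← hN]; ring)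
    · simp only [Z]
      rw [intervalIntegral.integral_const_mul, mul_eq_zero]
      right
      unfold blockSum
      rw [intervalIntegral.integral_finsetSum fun i _ => Continuous.intervalIntegrable (by
        have := h.cont ((a * N + k) * N + i) (p.1 / (N:ℝ) ^ 3); fun_prop) _ _]
      refine Finset.sum_eq_zero fun i _ => ?_
      rw [intervalIntegral.integral_const_mul, mul_eq_zero]
      right
      -- By periodicity the mean over the rotation vanishes whatever parameters were already chosen.
      set Yk := Y ((a * N + k) * N + i) (p.1 / (N:ℝ) ^ 3) with hYk
      set c := θ ((a * N + k) * N + i) + p.2 / (N:ℝ) ^ 3 with hc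
      have per : Function.Periodic Yk 1 := h.periodic _ _
      have := per.intervalIntegral_add_eq c 0
      rw [zero_add, h.mean] at this
      rw [← this]
      simp only [← add_assoc, ← hc]
      rw [intervalIntegral.integral_comp_add_left (fun s => Yk s), add_zero]
    · rw [norm_mul, norm_ex, one_mul]
      exact hθ _ _ _ (by positivity)
  choose σ hσ using ex1
  -- Here j numbers blocks of N cells: j / N is the surrounding block of N^2 cells and j % N the
  -- position in it.
  refine ⟨fun j => σ (j / N) (j % N), fun a ν r hν => ?_⟩
  set θ' := fun j => θ j + σ (j / N / N) (j / N % N) with hθ'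
  have eS : ∀ ν r, blockSum Y θ' (N * N) a ν r = ∑ k ∈ Finset.range N,
      ex (ν * (k * N)) * blockSum Y θ N (a * N + k) ν (r + σ a k) := by
    intro ν r
    rw [blockSum_mul]
    refine Finset.sum_congr rfl fun k hk => ?_
    rw [blockSum_shift Y (s := σ a k)]
    intro i hi
    simp only [hθ']
    have hk := Finset.mem_range.1 hk
    have d1 : ((a * N + k) * N + i) / N = a * N + k := by
      rw [mul_comm, Nat.mul_add_div hNpos, Nat.div_eq_of_lt hi, add_zero]
    have d2 : (a * N + k) / N = a := by
      rw [mul_comm, Nat.mul_add_div hNpos, Nat.div_eq_of_lt hk, add_zero]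
    have d3 : (a * N + k) % N = k := by
      rw [mul_comm, Nat.mul_add_mod, Nat.mod_eq_of_lt hk]
    rw [d1, d2, d3]
  -- Above N^2 the decay alone suffices: ν^(-1/8) ≤ x^-2, and x^16 x^-2 = x^14.
  rcases le_or_gt ((N:ℝ) ^ 2) ν with hν2 | hν2
  · have hν0 : 0 < ν := lt_of_lt_of_le (by positivity) hν2
    refine (norm_blockSum_le_of fun k => h.decay k ν _ hν0).trans ?_
    have : ν ^ (-(1 / 8) : ℝ) ≤ (x ^ 2)⁻¹ := by
      calc ν ^ (-(1 / 8) : ℝ) ≤ ((N:ℝ) ^ 2) ^ (-(1 / 8) : ℝ) :=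
            Real.rpow_le_rpow_of_nonpos (by positivity) hν2 (by norm_num)
        _ = (x ^ 2)⁻¹ := by
          rw [← hN, ← pow_mul, ← Real.rpow_natCast, ← Real.rpow_mul hx0.le, ← Real.rpow_natCast,
            ← Real.rpow_neg hx0.le]
          norm_num
    push_cast
    rw [← hN]
    calc x ^ 8 * x ^ 8 * (H * ν ^ (-(1 / 8) : ℝ)) ≤ x ^ 8 * x ^ 8 * (C * (x ^ 2)⁻¹) := by gcongr
      _ = _ := by field_simp
  · have N3 : (0:ℝ) < (N:ℝ) ^ 3 := by positivity
    set i := ⌊ν * N ^ 3⌋₊ with hi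
    set r1 := Int.fract r with hr1
    set i' := ⌊r1 * N ^ 3⌋₊ with hi'
    have hr0 : 0 ≤ r1 := Int.fract_nonneg _
    have hper : blockSum Y θ' (N * N) a ν r = blockSum Y θ' (N * N) a ν r1 := by
      unfold blockSum
      refine Finset.sum_congr rfl fun i _ => ?_
      rw [← Int.fract_add_floor r, ← add_assoc, h.periodic_int]
    have a1 : (i : ℝ) ≤ ν * N ^ 3 := Nat.floor_le (by positivity)
    have a2 : ν * N ^ 3 < i + 1 := Nat.lt_floor_add_one _
    have b1 : (i' : ℝ) ≤ r1 * N ^ 3 := Nat.floor_le (by positivity)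
    have b2 : r1 * N ^ 3 < i' + 1 := Nat.lt_floor_add_one _
    have hmem : (i, i') ∈ P := by
      simp only [P, Finset.mem_product, Finset.mem_range]
      constructor
      · rw [Nat.lt_succ_iff]
        have : (i : ℝ) ≤ (N:ℝ) ^ 5 := by
          refine a1.trans ?_
          calc ν * N ^ 3 ≤ N ^ 2 * N ^ 3 := by gcongr
            _ = _ := by ring
        exact_mod_cast this
      · have : (i' : ℝ) < (N:ℝ) ^ 3 := by
          refine b1.trans_lt ?_
          calc r1 * (N:ℝ) ^ 3 < 1 * N ^ 3 := by gcongr; exact Int.fract_lt_one _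
            _ = _ := one_mul _
        exact_mod_cast this
    have h1 := hσ a (i, i') hmem
    simp only [Z] at h1
    rw [← eS] at h1
    have h2 := h.norm_blockSum_sub_le hH θ' (N * N) a ν (i / (N:ℝ) ^ 3) r1 (i' / (N:ℝ) ^ 3)
    have c1 : |ν - i / (N:ℝ) ^ 3| ≤ 1 / (N:ℝ) ^ 3 := by
      rw [abs_le]
      constructor
      · have : i / (N:ℝ) ^ 3 ≤ ν := by rwa [div_le_iff₀ N3]
        have : 0 < 1 / (N:ℝ) ^ 3 := by positivity
        linarith
      · rw [sub_le_iff_le_add, ← add_div, le_div_iff₀ N3]; linarith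
    have c2 : |r1 - i' / (N:ℝ) ^ 3| ≤ 1 / (N:ℝ) ^ 3 := by
      rw [abs_le]
      constructor
      · have : i' / (N:ℝ) ^ 3 ≤ r1 := by rwa [div_le_iff₀ N3]
        have : 0 < 1 / (N:ℝ) ^ 3 := by positivity
        linarith
      · rw [sub_le_iff_le_add, ← add_div, le_div_iff₀ N3]; linarith
    have c3 : |r1 - i' / (N:ℝ) ^ 3| ^ (1 / 3 : ℝ) ≤ 1 / N := by
      calc _ ≤ (1 / (N:ℝ) ^ 3) ^ (1 / 3 : ℝ) := by gcongr
        _ = 1 / N := by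
          rw [← one_div_pow, ← Real.rpow_natCast, ← Real.rpow_mul (by positivity)]; norm_num
    have h3 : ‖blockSum Y θ' (N * N) a ν r1 -
        blockSum Y θ' (N * N) a (i / (N:ℝ) ^ 3) (i' / (N:ℝ) ^ 3)‖ ≤ 29 * C * x ^ 8 := by
      refine h2.trans ?_
      push_cast
      calc _ ≤ (N:ℝ) * N * (14 * H * (N * N + N * N) * (1 / (N:ℝ) ^ 3) + H * (1 / N)) := by
            gcongr
            nlinarith
        _ = 29 * H * N := by field_simp; ring
        _ ≤ _ := by rw [← hN]; gcongr
    have hPc : (P.card : ℝ) ≤ 2 * (x ^ 8) ^ 8 := by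
      simp only [P, Finset.card_product, Finset.card_range]
      rw [hN]; push_cast
      have : (1:ℝ) ≤ (N:ℝ) ^ 5 := one_le_pow₀ hN1
      calc ((N:ℝ) ^ 5 + 1) * N ^ 3 ≤ (N ^ 5 + N ^ 5) * N ^ 3 := by gcongr
        _ = _ := by ring
    have hPpos : (0:ℝ) < P.card := by exact_mod_cast Finset.card_pos.2 ⟨_, hmem⟩
    have h4 := log_net_le hx1 (n := 4 * P.card) (by positivity) (by linarith)
    have h5 : 2 * (C * x ^ 7) * x ^ 4 * (Real.log (4 * P.card) + 1 / 2) ≤ 134 * C * x ^ 12 := by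
      calc _ ≤ 2 * (C * x ^ 7) * x ^ 4 * (67 * x) := by gcongr
        _ = _ := by ring
    rw [hper]
    have h6 := norm_add_le (blockSum Y θ' (N * N) a ν r1 -
        blockSum Y θ' (N * N) a (i / (N:ℝ) ^ 3) (i' / (N:ℝ) ^ 3))
      (blockSum Y θ' (N * N) a (i / (N:ℝ) ^ 3) (i' / (N:ℝ) ^ 3))
    rw [sub_add_cancel] at h6
    have h7 : 29 * C * x ^ 8 ≤ C * x ^ 12 := by
      have : 29 ≤ x ^ 4 := by nlinarith
      calc 29 * C * x ^ 8 ≤ x ^ 4 * C * x ^ 8 := by gcongr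
        _ = _ := by ring
    -- Square root cancellation gives x^7 · x^4, the logarithm at most another x, and the spare
    -- factor x^2 ≥ 149 absorbs the constants. Thus C does not grow under iteration.
    have h8 : 149 * C * x ^ 12 ≤ C * (x ^ 2) ^ 7 := by
      calc 149 * C * x ^ 12 ≤ x ^ 2 * C * x ^ 12 := by gcongr
        _ = _ := by ring
    have h9 : 0 ≤ C * x ^ 12 := by positivity
    linarith

end

section
variable {H : ℝ} {Y : ℕ → ℝ → ℝ → ℂ}

/-- Parameters for which all blocks of `2 ^ (32 * 2 ^ i')` cells, `i' ≤ i`, are balanced. -/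
lemma OscFamily.exists_balanced_squares (h : OscFamily H Y) (hH : 1 ≤ H) (i : ℕ) :
    ∃ θ : ℕ → ℝ, ∀ i' ≤ i, ∀ a ν r, 0 ≤ ν →
      ‖blockSum Y θ (2 ^ (32 * 2 ^ i')) a ν r‖ ≤ 32 * H * (2 ^ (4 * 2 ^ i')) ^ 7 := by
  induction i with
  | zero =>
    refine ⟨0, fun i' hi a ν r _ => ?_⟩
    obtain rfl : i' = 0 := by omega
    -- The trivial bound 2 · 2^32 equals 32 · 2^28. Starting at 2^32 cells ensures x^2 ≥ 2^8 ≥ 149.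
    refine (norm_blockSum_le_of fun k => h.bound k ν _).trans ?_
    norm_num
    linarith
  | succ i ih =>
    obtain ⟨θ, hθ⟩ := ih
    obtain ⟨σ, hσ⟩ := h.exists_shift hH (C := 32 * H) (by linarith)
      (N := 2 ^ (32 * 2 ^ i)) (x := 2 ^ (4 * 2 ^ i)) (by positivity)
      (by
        rw [← pow_mul]
        calc (149:ℝ) ≤ 2 ^ 8 := by norm_num
          _ ≤ _ := pow_le_pow_right₀ (by norm_num) (by
            have := Nat.one_le_two_pow (n := i); omega))
      (by rw [← pow_mul]; push_cast; congr 1; ring) (hθ i le_rfl)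
    refine ⟨fun j => θ j + σ (j / 2 ^ (32 * 2 ^ i)), fun i' hi a ν r hν => ?_⟩
    rcases Nat.le_succ_iff.1 hi with hi | rfl
    -- The new rotation is constant on each smaller block, so the earlier balance survives.
    · rw [blockSum_shift Y (θ := θ) (s := σ (a * 2 ^ (32 * 2 ^ i') / 2 ^ (32 * 2 ^ i)))]
      · exact hθ i' hi a ν _ hν
      · intro t ht
        congr 2
        have hle : 32 * 2 ^ i' ≤ 32 * 2 ^ i := by gcongr; norm_num
        rw [← Nat.add_sub_cancel' hle, pow_add, ← Nat.div_div_eq_div_mul, ← Nat.div_div_eq_div_mul]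
        congr 1
        rw [mul_comm, Nat.mul_add_div (by positivity), Nat.div_eq_of_lt ht,
          Nat.mul_div_cancel_left _ (by positivity), add_zero]
    · have e1 : 2 ^ (32 * 2 ^ (i + 1)) = 2 ^ (32 * 2 ^ i) * 2 ^ (32 * 2 ^ i) := by
        rw [← pow_add]; congr 1; ring
      have e2 : (2:ℝ) ^ (4 * 2 ^ (i + 1)) = (2 ^ (4 * 2 ^ i)) ^ 2 := by
        rw [← pow_mul]; congr 1; ring
      rw [e1, e2]
      exact hσ a ν r hν

/-- A block of 2^l cells splits into balanced ones of 2^(32·2^i) cells with 32·2^i ≤ l < 64·2^i.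
Their gain 2^(-4·2^i) is at most 2^(-l/16). -/
lemma OscFamily.exists_balanced (h : OscFamily H Y) (hH : 1 ≤ H) (L : ℕ) :
    ∃ θ : ℕ → ℝ, ∀ l ≤ L, ∀ a ν, 0 ≤ ν →
      ‖blockSum Y θ (2 ^ l) a ν 0‖ ≤ 32 * H * 2 ^ l * (2 ^ l : ℝ) ^ (-(1 / 16) : ℝ) := by
  obtain ⟨θ, hθ⟩ := h.exists_balanced_squares hH L
  refine ⟨θ, fun l hl a ν hν => ?_⟩
  have hpow : (2 ^ l : ℝ) ^ (-(1 / 16) : ℝ) = 2 ^ (-(l / 16) : ℝ) := by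
    rw [← Real.rpow_natCast, ← Real.rpow_mul (by norm_num)]; congr 1; ring
  rcases lt_or_ge l 32 with h32 | h32
  · refine (norm_blockSum_le_of fun k => h.bound k ν _).trans ?_
    have : (2:ℝ) ^ (-2 : ℝ) ≤ (2 ^ l : ℝ) ^ (-(1 / 16) : ℝ) := by
      rw [hpow]
      apply Real.rpow_le_rpow_of_exponent_le (by norm_num)
      have : (l:ℝ) ≤ 32 := by exact_mod_cast h32.le
      linarith
    have e : (2:ℝ) ^ (-2 : ℝ) = 1 / 4 := by
      rw [Real.rpow_neg (by norm_num)]; norm_num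
    rw [e] at this
    push_cast
    calc (2:ℝ) ^ l * 2 ≤ 32 * 1 * 2 ^ l * (1 / 4) := by
          have : (0:ℝ) < 2 ^ l := by positivity
          linarith
      _ ≤ _ := by gcongr
  · set i := Nat.log 2 (l / 32) with hi
    have hl0 : l / 32 ≠ 0 := by omega
    have h1 : 2 ^ i ≤ l / 32 := Nat.pow_log_le_self 2 hl0
    have h2 : l / 32 < 2 ^ (i + 1) := Nat.lt_pow_succ_log_self (by norm_num) _
    have h3 : 32 * 2 ^ i ≤ l := by omega
    have h4 : l < 64 * 2 ^ i := by rw [pow_succ] at h2; omega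
    have h5 : i ≤ L := by
      have : i < 2 ^ i := Nat.lt_two_pow_self
      omega
    obtain ⟨r, hr⟩ := Nat.exists_eq_add_of_le h3
    have e1 : 2 ^ l = 2 ^ r * 2 ^ (32 * 2 ^ i) := by rw [hr, pow_add, mul_comm]
    rw [e1, blockSum_mul]
    refine (norm_sum_le _ _).trans ((Finset.sum_le_card_nsmul _ _
      (32 * H * (2 ^ (4 * 2 ^ i)) ^ 7) fun k _ => ?_).trans ?_)
    · rw [norm_mul, norm_ex, one_mul]
      exact hθ i h5 _ _ _ hν
    · rw [Finset.card_range, nsmul_eq_mul]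
      push_cast
      have e2 : (2:ℝ) ^ (32 * 2 ^ i) = (2 ^ (4 * 2 ^ i)) ^ 7 * 2 ^ (4 * 2 ^ i) := by
        rw [← pow_succ, ← pow_mul]; congr 1; ring
      have e3 : (1:ℝ) ≤ 2 ^ (4 * 2 ^ i) * (2 ^ l : ℝ) ^ (-(1 / 16) : ℝ) := by
        rw [hpow, ← Real.rpow_natCast, ← Real.rpow_add (by norm_num)]
        apply Real.one_le_rpow (by norm_num)
        push_cast
        have : (l:ℝ) ≤ 64 * 2 ^ i := by exact_mod_cast h4.le
        linarith
      calc (2:ℝ) ^ r * (32 * H * (2 ^ (4 * 2 ^ i)) ^ 7)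
          ≤ (2:ℝ) ^ r * (32 * H * (2 ^ (4 * 2 ^ i)) ^ 7) *
            (2 ^ (4 * 2 ^ i) * (2 ^ l : ℝ) ^ (-(1 / 16) : ℝ)) :=
            le_mul_of_one_le_right (by positivity) e3
        _ = 32 * H * (2 ^ r * ((2 ^ (4 * 2 ^ i)) ^ 7 * 2 ^ (4 * 2 ^ i))) *
            (2 ^ l : ℝ) ^ (-(1 / 16) : ℝ) := by ring
        _ = _ := by
          rw [← e2]
          congr 3
          rw [← pow_add, hr, add_comm]; 

end

/-! ### The oscillatory family of one level. -/

/-- The effect on the averaged function of the choice of the parameter `θ` at level `m`. -/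
noncomputable def levelDiff (q : ℝ) (g : ℝ → ℝ) (m n : ℕ) (θ t : ℝ) : ℝ :=
  avgComp q (m + 1) (n + 1) (fun t => g (t + circParam q θ * gridDist m t)) t -
    avgComp q m (n + 2) g t

/-- The Fourier integral of `levelDiff` over the `k`-th cell, rescaled to unit length. -/
noncomputable def cellOsc (q : ℝ) (g : ℝ → ℝ) (m n k : ℕ) (ν θ : ℝ) : ℂ :=
  ∫ s in (0:ℝ)..1, levelDiff q g m n θ ((s + k) / 2 ^ m) * ex (ν * s)

section
variable {q : ℝ} {g : ℝ → ℝ}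

lemma continuous_levelDiff (hg : Continuous g) (m n : ℕ) :
    Continuous (levelDiff q g m n).uncurry := by
  have h1 := continuous_circParam q
  have h2 := continuous_gridDist m
  have h3 : Continuous (Function.uncurry fun θ t =>
      avgComp q (m + 1) (n + 1) (fun t => g (t + circParam q θ * gridDist m t)) t) :=
    continuous_avgComp_param q (m + 1) (n + 1)
      (g := fun θ t => g (t + circParam q θ * gridDist m t)) (by fun_prop)
  have h4 := continuous_avgComp q m (n + 2) hg
  exact h3.sub (h4.comp continuous_snd)

lemma integral_levelDiff (hg : Continuous g) (m n : ℕ) (t : ℝ) :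
    ∫ θ in (0:ℝ)..1, levelDiff q g m n θ t = 0 := by
  have h1 := continuous_circParam q
  have h2 := continuous_gridDist m
  have hc : Continuous (Function.uncurry fun θ t => g (t + circParam q θ * gridDist m t)) := by
    fun_prop
  have h3 := continuous_avgComp_param q (m + 1) (n + 1) hc
  have h4 : Continuous fun θ =>
      avgComp q (m + 1) (n + 1) (fun t => g (t + circParam q θ * gridDist m t)) t :=
    h3.comp (f := fun θ => (θ, t)) (by fun_prop)
  unfold levelDiff
  rw [intervalIntegral.integral_sub (h4.intervalIntegrable _ _)
    (continuous_const.intervalIntegrable _ _), integral_avgComp q _ _ hc, avgComp_succ_front q m]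
  rw [intervalIntegral.integral_const, sub_zero, one_smul]
  exact sub_self _

lemma abs_levelDiff_le (hq0 : 0 ≤ q) (hg : Continuous g) (hg1 : ∀ x, |g x| ≤ 1) (m n : ℕ)
    (θ t : ℝ) : |levelDiff q g m n θ t| ≤ 2 := by
  have h2 := continuous_gridDist m
  have a1 := abs_avgComp_le hq0 (g := fun t => g (t + circParam q θ * gridDist m t))
    (by fun_prop) (fun x => hg1 _) (m + 1) (n + 1) t
  have a2 := abs_avgComp_le hq0 hg hg1 m (n + 2) t
  have := abs_sub (avgComp q (m + 1) (n + 1) (fun t => g (t + circParam q θ * gridDist m t)) t)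
    (avgComp q m (n + 2) g t)
  unfold levelDiff
  linarith

lemma integral_cell_eq {E : Type*} [NormedAddCommGroup E] [NormedSpace ℝ E] (F : ℝ → E)
    (m k : ℕ) : ∫ s in (0:ℝ)..1, F ((s + k) / 2 ^ m) =
      (2 ^ m : ℝ) • ∫ t in (k / 2 ^ m : ℝ)..((k + 1) / 2 ^ m), F t := by
  have h := intervalIntegral.integral_comp_div_add (a := 0) (b := 1) F
    (c := (2 ^ m : ℝ)) (by positivity) (k / 2 ^ m : ℝ)
  simp only [← add_div] at h
  rw [h, zero_add, add_comm (1:ℝ)]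

lemma cellOsc_eq (m n k : ℕ) (ν θ : ℝ) :
    ∫ t in (k / 2 ^ m : ℝ)..((k + 1) / 2 ^ m), levelDiff q g m n θ t * ex (ν * t) =
      (2 ^ m : ℝ)⁻¹ • (ex (ν / 2 ^ m * k) * cellOsc q g m n k (ν / 2 ^ m) θ) := by
  unfold cellOsc
  rw [← intervalIntegral.integral_const_mul]
  have e : ∫ s in (0:ℝ)..1, ex (ν / 2 ^ m * k) *
        (levelDiff q g m n θ ((s + k) / 2 ^ m) * ex (ν / 2 ^ m * s)) =
      ∫ s in (0:ℝ)..1, (fun t : ℝ => (levelDiff q g m n θ t : ℂ) * ex (ν * t)) ((s + k) / 2 ^ m) := by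
    refine intervalIntegral.integral_congr fun s _ => ?_
    simp only
    rw [show ν * ((s + k) / 2 ^ m) = ν / 2 ^ m * k + ν / 2 ^ m * s by ring, ex_add]; ring
  rw [e, integral_cell_eq fun t : ℝ => (levelDiff q g m n θ t : ℂ) * ex (ν * t), smul_smul, inv_mul_cancel₀ (by positivity), one_smul]

/-- Once level m is fixed, averaging starts at level m + 1, so the estimates are available only on
the two half cells. -/
lemma integral_cell_split {E : Type*} [NormedAddCommGroup E] [NormedSpace ℝ E] {F : ℝ → E}
    (hF : Continuous F) (m k : ℕ) :
    ∫ t in (k / 2 ^ m : ℝ)..((k + 1) / 2 ^ m), F t =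
      (∫ t in ((2 * k : ℤ) / 2 ^ (m + 1) : ℝ)..(((2 * k : ℤ) + 1) / 2 ^ (m + 1)), F t) +
      ∫ t in ((2 * k + 1 : ℤ) / 2 ^ (m + 1) : ℝ)..(((2 * k + 1 : ℤ) + 1) / 2 ^ (m + 1)), F t := by
  have e1 : (k / 2 ^ m : ℝ) = (2 * k : ℤ) / 2 ^ (m + 1) := by
    rw [pow_succ]; push_cast; field_simp
  have e2 : ((k + 1) / 2 ^ m : ℝ) = ((2 * k + 1 : ℤ) + 1) / 2 ^ (m + 1) := by
    rw [pow_succ]; push_cast; field_simp; ring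
  have e3 : (((2 * k : ℤ) + 1) / 2 ^ (m + 1) : ℝ) = (2 * k + 1 : ℤ) / 2 ^ (m + 1) := by
    push_cast; ring
  rw [e1, e2, e3, intervalIntegral.integral_add_adjacent_intervals (hF.intervalIntegrable _ _)
    (hF.intervalIntegrable _ _)]

lemma norm_cellOsc_le (hq0 : 0 < q) (hq : q ≤ 2 / 5) (hg : Continuous g) (hg1 : ∀ x, |g x| ≤ 1)
    (m n k : ℕ) {ν : ℝ} (θ : ℝ) (hν : 0 < ν) :
    ‖cellOsc q g m n k ν θ‖ ≤ 210 / q * ν ^ (-(1 / 8) : ℝ) := by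
  have hp : (0:ℝ) < 2 ^ m := by positivity
  have h2 := continuous_gridDist m
  set gθ := fun t => g (t + circParam q θ * gridDist m t) with hgθ
  have hgc : Continuous gθ := by fun_prop
  have hG1 := continuous_avgComp q (m + 1) (n + 1) hgc
  have hG2 := continuous_avgComp q m (n + 2) hg
  have hex := continuous_ex
  have h := cellOsc_eq (q := q) (g := g) m n k (ν * 2 ^ m) θ
  rw [mul_div_cancel_right₀ _ hp.ne'] at h
  have hn := congrArg norm h
  rw [norm_smul, norm_mul, norm_ex, one_mul, norm_inv, Real.norm_eq_abs, abs_of_pos hp] at hn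
  have hY : ‖cellOsc q g m n k ν θ‖ = 2 ^ m * ‖∫ t in (k / 2 ^ m : ℝ)..((k + 1) / 2 ^ m),
      levelDiff q g m n θ t * ex (ν * 2 ^ m * t)‖ := by
    rw [hn]; field_simp
  have hsub : ∫ t in (k / 2 ^ m : ℝ)..((k + 1) / 2 ^ m),
      levelDiff q g m n θ t * ex (ν * 2 ^ m * t) =
      (∫ t in (k / 2 ^ m : ℝ)..((k + 1) / 2 ^ m),
        avgComp q (m + 1) (n + 1) gθ t * ex (ν * 2 ^ m * t)) -
      ∫ t in (k / 2 ^ m : ℝ)..((k + 1) / 2 ^ m), avgComp q m (n + 2) g t * ex (ν * 2 ^ m * t) := by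
    rw [← intervalIntegral.integral_sub (Continuous.intervalIntegrable (by fun_prop) _ _)
      (Continuous.intervalIntegrable (by fun_prop) _ _)]
    refine intervalIntegral.integral_congr fun t _ => ?_
    simp only [levelDiff]
    push_cast; ring
  have hν2 : (0:ℝ) < ν * 2 ^ m := by positivity
  have b1 := fun p => norm_integral_avgComp_mul_ex_le hq0 hq hgc (fun x => hg1 _) (m + 1) n p hν2
  have b2 := norm_integral_avgComp_mul_ex_le hq0 hq hg hg1 m (n + 1) k hν2
  rw [mul_div_cancel_right₀ _ hp.ne'] at b2
  rw [Int.cast_natCast] at b2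
  have e1 : ν * 2 ^ m / 2 ^ (m + 1) = ν / 2 := by rw [pow_succ]; field_simp
  rw [e1] at b1
  have e2 : (ν / 2) ^ (-(1 / 8) : ℝ) ≤ 2 * ν ^ (-(1 / 8) : ℝ) := by
    rw [Real.div_rpow hν.le (by norm_num), Real.rpow_neg (by norm_num : (0:ℝ) ≤ 2), div_inv_eq_mul,
      mul_comm]
    gcongr
    calc (2:ℝ) ^ (1 / 8 : ℝ) ≤ 2 ^ (1 : ℝ) :=
          Real.rpow_le_rpow_of_exponent_le (by norm_num) (by norm_num)
      _ = 2 := Real.rpow_one 2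
  rw [hY, hsub, integral_cell_split (by fun_prop) m k]
  calc _ ≤ 2 ^ m * ((70 / q * (ν / 2) ^ (-(1 / 8) : ℝ) / 2 ^ (m + 1) +
        70 / q * (ν / 2) ^ (-(1 / 8) : ℝ) / 2 ^ (m + 1)) + 70 / q * ν ^ (-(1 / 8) : ℝ) / 2 ^ m) := by
        gcongr
        exact (norm_sub_le _ _).trans
          (add_le_add ((norm_add_le _ _).trans (add_le_add (b1 _) (b1 _))) b2)
    _ = 70 / q * ((ν / 2) ^ (-(1 / 8) : ℝ) + ν ^ (-(1 / 8) : ℝ)) := by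
      rw [pow_succ]; field_simp; ring
    _ ≤ 70 / q * (2 * ν ^ (-(1 / 8) : ℝ) + ν ^ (-(1 / 8) : ℝ)) := by gcongr
    _ = _ := by ring

lemma norm_cellOsc_sub_le (hq0 : 0 < q) (hq : q ≤ 2 / 5) (hg : Continuous g)
    (hg1 : ∀ x, |g x| ≤ 1) (m n k : ℕ) (ν θ θ' : ℝ) :
    ‖cellOsc q g m n k ν θ - cellOsc q g m n k ν θ'‖ ≤ 210 / q * |θ - θ'| ^ (1 / 3 : ℝ) := by
  have hp : (0:ℝ) < 2 ^ m := by positivity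
  have h2 := continuous_gridDist m
  have hL := continuous_levelDiff (q := q) hg m n
  have hLθ : ∀ θ, Continuous (levelDiff q g m n θ) := fun θ => hL.comp (f := fun t => (θ, t)) (by fun_prop)
  have hex := continuous_ex
  set D := fun t => levelDiff q g m n θ t - levelDiff q g m n θ' t with hD
  have hDc : Continuous D := (hLθ θ).sub (hLθ θ')
  have e1 : cellOsc q g m n k ν θ - cellOsc q g m n k ν θ' =
      ∫ s in (0:ℝ)..1, (D ((s + k) / 2 ^ m) : ℂ) * ex (ν * s) := by
    unfold cellOsc
    have := hLθ θ
    have := hLθ θ'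
    rw [← intervalIntegral.integral_sub (Continuous.intervalIntegrable (by fun_prop) _ _)
      (Continuous.intervalIntegrable (by fun_prop) _ _)]
    refine intervalIntegral.integral_congr fun t _ => ?_
    simp only [hD]
    push_cast; ring
  rw [e1]
  refine (intervalIntegral.norm_integral_le_integral_norm zero_le_one).trans ?_
  simp only [norm_mul, norm_ex, mul_one, Complex.norm_real, Real.norm_eq_abs]
  rw [integral_cell_eq (fun t => |D t|), integral_cell_split hDc.abs]
  have hb := fun p => integral_abs_avgComp_sub_le hq0 hq hg hg1 m n p
    (abs_circParam_le hq0.le θ) (abs_circParam_le hq0.le θ')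
  have hDe : ∀ t, |D t| =
      |avgComp q (m + 1) (n + 1) (fun t => g (t + circParam q θ * gridDist m t)) t -
        avgComp q (m + 1) (n + 1) (fun t => g (t + circParam q θ' * gridDist m t)) t| := by
    intro t; simp only [hD, levelDiff]; congr 1; ring
  simp only [hDe]
  -- The parameter is 4q-Lipschitz in θ, with 4q ≤ 8, and the cube root of 8 is 2.
  have c1 : |circParam q θ - circParam q θ'| ^ (1 / 3 : ℝ) ≤ 2 * |θ - θ'| ^ (1 / 3 : ℝ) := by
    have : (8:ℝ) ^ (1 / 3 : ℝ) = 2 := by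
      rw [show (8:ℝ) = 2 ^ (3:ℝ) by norm_num, ← Real.rpow_mul (by norm_num)]; norm_num
    rw [← this, ← Real.mul_rpow (by norm_num) (abs_nonneg _)]
    gcongr
    exact (abs_circParam_sub_le hq0.le θ θ').trans (by gcongr; linarith)
  have hw : 100 / q * |circParam q θ - circParam q θ'| ^ (1 / 3 : ℝ) / 2 ^ (m + 1) ≤
      100 / q * (2 * |θ - θ'| ^ (1 / 3 : ℝ)) / 2 ^ (m + 1) := by gcongr
  rw [smul_eq_mul]
  calc _ ≤ 2 ^ m * (100 / q * (2 * |θ - θ'| ^ (1 / 3 : ℝ)) / 2 ^ (m + 1) +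
        100 / q * (2 * |θ - θ'| ^ (1 / 3 : ℝ)) / 2 ^ (m + 1)) := by
        gcongr
        · exact (hb _).trans hw
        · exact (hb _).trans hw
    _ = 200 / q * |θ - θ'| ^ (1 / 3 : ℝ) := by rw [pow_succ]; field_simp; ring
    _ ≤ _ := by gcongr; norm_num

lemma oscFamily_cellOsc (hq0 : 0 < q) (hq : q ≤ 2 / 5) (hg : Continuous g)
    (hg1 : ∀ x, |g x| ≤ 1) (m n : ℕ) : OscFamily (210 / q) (cellOsc q g m n) := by
  have hL := continuous_levelDiff (q := q) hg m n
  have hLθ : ∀ θ, Continuous (levelDiff q g m n θ) := fun θ => hL.comp (f := fun t => (θ, t)) (by fun_prop)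
  have hex := continuous_ex
  have hcomp : ∀ (k : ℕ) (ν : ℝ), Continuous (Function.uncurry fun θ s : ℝ =>
      (levelDiff q g m n θ ((s + k) / 2 ^ m) : ℂ) * ex (ν * s)) := fun k ν => by
    have : Continuous fun r : ℝ × ℝ => levelDiff q g m n r.1 ((r.2 + k) / 2 ^ m) :=
      hL.comp (f := fun r : ℝ × ℝ => (r.1, (r.2 + k) / 2 ^ m)) (by fun_prop)
    exact (Complex.continuous_ofReal.comp this).mul (by fun_prop)
  refine ⟨fun k ν => ?_, fun k ν θ => ?_, fun k ν => ?_, fun k ν θ => ?_, ?_, fun k ν ν' θ => ?_, ?_⟩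
  · exact intervalIntegral.continuous_parametric_intervalIntegral_of_continuous' (hcomp k ν) 0 1
  · unfold cellOsc levelDiff
    simp_rw [circParam_add_one]
  · unfold cellOsc
    rw [swap_of_continuous (hcomp k ν)]
    simp_rw [intervalIntegral.integral_mul_const, intervalIntegral.integral_ofReal]
    simp [integral_levelDiff hg]
  · unfold cellOsc
    have := intervalIntegral.norm_integral_le_of_norm_le_const (a := (0:ℝ)) (b := 1) (C := 2)
      (f := fun s => (levelDiff q g m n θ ((s + k) / 2 ^ m) : ℂ) * ex (ν * s)) fun s _ => by
        rw [norm_mul, norm_ex, mul_one, Complex.norm_real]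
        exact abs_levelDiff_le hq0.le hg hg1 m n _ _
    simpa using this
  · exact norm_cellOsc_sub_le hq0 hq hg hg1 m n
  · unfold cellOsc
    have := hLθ θ
    rw [← intervalIntegral.integral_sub (Continuous.intervalIntegrable (by fun_prop) _ _)
      (Continuous.intervalIntegrable (by fun_prop) _ _)]
    have := intervalIntegral.norm_integral_le_of_norm_le_const (a := (0:ℝ)) (b := 1)
      (C := 14 * |ν - ν'|) (f := fun s => (levelDiff q g m n θ ((s + k) / 2 ^ m) : ℂ) * ex (ν * s) -
        (levelDiff q g m n θ ((s + k) / 2 ^ m) : ℂ) * ex (ν' * s)) fun s hs => by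
        rw [Set.uIoc_of_le zero_le_one] at hs
        rw [← mul_sub, norm_mul, Complex.norm_real]
        have h1 := abs_levelDiff_le hq0.le hg hg1 m n θ ((s + k) / 2 ^ m)
        have h2 := norm_ex_sub_le (ν * s) (ν' * s)
        rw [← sub_mul, abs_mul, abs_of_pos hs.1] at h2
        have h3 : 2 * Real.pi * (|ν - ν'| * s) ≤ 7 * (|ν - ν'| * 1) := by
          have := hs.2
          have := hs.1
          gcongr
          linarith [Real.pi_lt_d2]
        calc _ ≤ 2 * (7 * (|ν - ν'| * 1)) := by
              refine mul_le_mul h1 (h2.trans h3) (norm_nonneg _) (by norm_num)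
          _ = _ := by ring
    rw [sub_zero, abs_one, mul_one] at this
    refine this.trans ?_
    gcongr
    rw [le_div_iff₀ hq0]; linarith
  · intro k ν θ hν
    exact norm_cellOsc_le hq0 hq hg hg1 m n k θ hν

end

/-! ### Choice of the parameters of all levels. -/

lemma le_mul_rpow_of_le {X c a b : ℝ} (hX : 0 ≤ X) (hc : 0 < c) (ha : 0 ≤ a)
    (h1 : X ≤ c * a) (h2 : X ≤ c * b) : X ≤ c * (a ^ (4 / 5 : ℝ) * b ^ (1 / 5 : ℝ)) := by
  rw [← div_le_iff₀' hc] at h1 h2 ⊢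
  have hXc : 0 ≤ X / c := by positivity
  calc X / c = (X / c) ^ (4 / 5 : ℝ) * (X / c) ^ (1 / 5 : ℝ) := by
        rw [← Real.rpow_add_of_nonneg hXc (by norm_num) (by norm_num)]; norm_num
    _ ≤ _ := by gcongr

section
variable {q : ℝ} {g : ℝ → ℝ}

lemma floor_mul_of_mem_Ioo {m : ℕ} {k : ℤ} {t : ℝ}
    (ht : t ∈ Set.Ioo (k / 2 ^ m : ℝ) ((k + 1) / 2 ^ m)) : ⌊2 ^ m * t⌋ = k := by
  have hp : (0:ℝ) < 2 ^ m := by positivity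
  rw [Int.floor_eq_iff]
  have h1 := (div_lt_iff₀ hp).1 ht.1
  have h2 := (lt_div_iff₀ hp).1 ht.2
  constructor <;> linarith

/-- Finer maps preserve the cells of level m, so only the parameter of the cell of t is seen. -/
lemma avgComp_comp_cellMap_eq (hq0 : 0 < q) (hq : q ≤ 2 / 5) (hg : Continuous g) (m n : ℕ)
    {w : ℤ → ℝ} (hw : ∀ k, |w k| ≤ q) {k : ℤ} {t : ℝ} (ht : ⌊2 ^ m * t⌋ = k) :
    avgComp q (m + 1) n (g ∘ cellMap m w) t =
      avgComp q (m + 1) n (fun t => g (t + w k * gridDist m t)) t := by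
  have h2 := continuous_gridDist m
  have := abs_avgComp_sub_le hq0.le (hg.comp (continuous_cellMap (m := m) hw))
    (g' := fun t => g (t + w k * gridDist m t)) (by fun_prop) (B := 0) (m + 1) n (t := t) (t' := t)
    fun v hv => by
      have hfl := floor_cellComp (Nat.le_succ m) (v := v)
        (fun m k => (hv m k).trans_lt (by linarith)) n t
      simp only [Function.comp_apply, cellMap]
      rw [hfl, ht]; simp
  exact sub_eq_zero.1 (abs_nonpos_iff.1 this)

/-- Choice of the parameters of one level. -/
lemma exists_level (hq0 : 0 < q) (hq : q ≤ 2 / 5) (hg : Continuous g) (hg1 : ∀ x, |g x| ≤ 1)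
    (m n : ℕ) : ∃ w : ℤ → ℝ, (∀ k, |w k| ≤ q) ∧ (∀ k, w (k + 2 ^ m) = w k) ∧
      ∀ j ≤ m, ∀ p : ℕ, p < 2 ^ j → ∀ ν : ℝ, 0 < ν →
        ‖∫ t in (p / 2 ^ j : ℝ)..((p + 1) / 2 ^ j),
          ((avgComp q (m + 1) (n + 1) (g ∘ cellMap m w) t - avgComp q m (n + 2) g t : ℝ) : ℂ) *
            ex (ν * t)‖ ≤ 32 * (210 / q) * ((ν / 2 ^ j) ^ (-(1 / 40) : ℝ) *
              ((2:ℝ) ^ (m - j)) ^ (-(1 / 40) : ℝ)) / 2 ^ j := by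
  have hH : 1 ≤ 210 / q := by rw [le_div_iff₀ hq0]; linarith
  have hosc := oscFamily_cellOsc hq0 hq hg hg1 m n
  obtain ⟨θ, hθ⟩ := hosc.exists_balanced hH m
  set w : ℤ → ℝ := fun k => circParam q (θ (k % 2 ^ m).toNat) with hw
  have hwq : ∀ k, |w k| ≤ q := fun k => abs_circParam_le hq0.le _
  refine ⟨w, hwq, fun k => by simp [hw], fun j hj p hp ν hν => ?_⟩
  obtain ⟨r, rfl⟩ := Nat.exists_eq_add_of_le hj
  rw [Nat.add_sub_cancel_left]
  set m := j + r with hm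
  have hpm : (0:ℝ) < 2 ^ m := by positivity
  have hex := continuous_ex
  have hcd : Continuous fun t => avgComp q (m + 1) (n + 1) (g ∘ cellMap m w) t -
      avgComp q m (n + 2) g t :=
    (continuous_avgComp _ _ _ (hg.comp (continuous_cellMap hwq))).sub (continuous_avgComp _ _ _ hg)
  have hF : Continuous fun t : ℝ =>
      ((avgComp q (m + 1) (n + 1) (g ∘ cellMap m w) t - avgComp q m (n + 2) g t : ℝ) : ℂ) *
        ex (ν * t) := by fun_prop
  have hcell : ∀ k : ℕ, k < 2 ^ m → ∫ t in (k / 2 ^ m : ℝ)..((k + 1) / 2 ^ m),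
      ((avgComp q (m + 1) (n + 1) (g ∘ cellMap m w) t - avgComp q m (n + 2) g t : ℝ) : ℂ) *
        ex (ν * t) =
      (2 ^ m : ℝ)⁻¹ • (ex (ν / 2 ^ m * k) * cellOsc q g m n k (ν / 2 ^ m) (θ k)) := by
    intro k hk
    rw [← cellOsc_eq]
    refine intervalIntegral.integral_congr_Ioo_of_le (by gcongr; linarith) fun t ht => ?_
    have e : w k = circParam q (θ k) := by
      simp only [hw]
      congr 2
      rw [Int.emod_eq_of_lt (by positivity) (by exact_mod_cast hk), Int.toNat_natCast]
    simp only [levelDiff]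
    rw [avgComp_comp_cellMap_eq hq0 hq hg m (n + 1) hwq (k := (k : ℤ))
      (floor_mul_of_mem_Ioo (by simpa using ht)), e]
  have hsum : ∫ t in (p / 2 ^ j : ℝ)..((p + 1) / 2 ^ j),
      ((avgComp q (m + 1) (n + 1) (g ∘ cellMap m w) t - avgComp q m (n + 2) g t : ℝ) : ℂ) *
        ex (ν * t) =
      (2 ^ m : ℝ)⁻¹ • (ex (ν / 2 ^ m * (p * 2 ^ r : ℕ)) *
        blockSum (cellOsc q g m n) θ (2 ^ r) p (ν / 2 ^ m) 0) := by
    have h := intervalIntegral.sum_integral_adjacent_intervals (μ := volume) (n := 2 ^ r)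
      (a := fun i => ((p * 2 ^ r + i : ℕ) : ℝ) / 2 ^ m) (fun k _ => hF.intervalIntegrable _ _)
    have a0 : ((p * 2 ^ r + 0 : ℕ) : ℝ) / 2 ^ m = p / 2 ^ j := by
      rw [hm, pow_add]; push_cast; field_simp; simp
    have a1 : ((p * 2 ^ r + 2 ^ r : ℕ) : ℝ) / 2 ^ m = (p + 1) / 2 ^ j := by
      rw [hm, pow_add]; push_cast; field_simp
    rw [a0, a1] at h
    rw [← h]
    unfold blockSum
    rw [Finset.mul_sum, Finset.smul_sum]
    refine Finset.sum_congr rfl fun i hi => ?_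
    have hi := Finset.mem_range.1 hi
    have hlt : p * 2 ^ r + i < 2 ^ m := by
      rw [hm, pow_add]
      calc p * 2 ^ r + i < p * 2 ^ r + 2 ^ r := by omega
        _ = (p + 1) * 2 ^ r := by ring
        _ ≤ 2 ^ j * 2 ^ r := by gcongr; exact hp
    have := hcell (p * 2 ^ r + i) hlt
    rw [show ((p * 2 ^ r + (i + 1) : ℕ) : ℝ) = (p * 2 ^ r + i : ℕ) + 1 by push_cast; ring, this,
      add_zero, ← mul_assoc, ← ex_add, ← mul_add]
    push_cast
    rfl
  rw [hsum, norm_smul, norm_mul, norm_ex, one_mul, norm_inv, Real.norm_eq_abs, abs_of_pos hpm]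
  set y : ℝ := 2 ^ r with hy
  set z := ν / 2 ^ j with hz
  have hy0 : 0 < y := by positivity
  have hz0 : 0 < z := by positivity
  have hzy : ν / 2 ^ m = z / y := by rw [hz, hy, hm, pow_add]; field_simp
  have b1 := hθ r (by omega) p (ν / 2 ^ m) (by positivity)
  have b2 : ‖blockSum (cellOsc q g m n) θ (2 ^ r) p (ν / 2 ^ m) 0‖ ≤
      32 * (210 / q) * y * (z / y) ^ (-(1 / 8) : ℝ) := by
    refine (norm_blockSum_le_of fun k => hosc.decay k (ν / 2 ^ m) _ (by positivity)).trans ?_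
    rw [hzy]
    push_cast
    rw [← hy]
    have : 0 ≤ 210 / q * y * (z / y) ^ (-(1 / 8) : ℝ) := by positivity
    linarith
  -- Weights 4/5 and 1/5 combine y^(-1/16) with (z/y)^(-1/8). The positive power of y in the second
  -- is outweighed, leaving decay in both z and y.
  have b3 := le_mul_rpow_of_le (norm_nonneg _) (by positivity) (by positivity) b1 b2
  have e : (y ^ (-(1 / 16) : ℝ)) ^ (4 / 5 : ℝ) * ((z / y) ^ (-(1 / 8) : ℝ)) ^ (1 / 5 : ℝ) =
      z ^ (-(1 / 40) : ℝ) * y ^ (-(1 / 40) : ℝ) := by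
    rw [← Real.rpow_mul hy0.le, ← Real.rpow_mul (by positivity), Real.div_rpow hz0.le hy0.le,
      div_eq_mul_inv (z ^ _), ← Real.rpow_neg hy0.le, mul_left_comm, ← Real.rpow_add hy0]
    norm_num
  rw [e] at b3
  calc _ ≤ (2 ^ m)⁻¹ * (32 * (210 / q) * y * (z ^ (-(1 / 40) : ℝ) * y ^ (-(1 / 40) : ℝ))) := by
        gcongr
    _ = _ := by rw [hm, pow_add, ← hy]; field_simp

end

/-- The average of `f` composed with the cell maps of levels below `m` fixed, and those of levels
`m, …, M` averaged. -/
noncomputable def avgStage (q : ℝ) (f : ℝ → ℝ) (v : ℕ → ℤ → ℝ) (M m : ℕ) : ℝ → ℝ :=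
  avgComp q m (M - m + 1) (f ∘ cellComp v 0 m)

section
variable {q : ℝ} {f : ℝ → ℝ}

lemma continuous_avgStage (hf : Continuous f) {v : ℕ → ℤ → ℝ} (hv : ∀ m k, |v m k| ≤ q)
    (M m : ℕ) : Continuous (avgStage q f v M m) :=
  continuous_avgComp _ _ _ (hf.comp (continuous_cellComp hv 0 m))

lemma avgComp_periodic {g : ℝ → ℝ} (hg : ∀ t, g (t + 1) = g t) (a n : ℕ) (t : ℝ) :
    avgComp q a n g (t + 1) = avgComp q a n g t := by
  induction n generalizing t with
  | zero => exact hg t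
  | succ n ih =>
    simp only [avgComp, avgOp, paramAvg]
    have := gridDist_add_int (a + n) t 1
    push_cast at this
    rw [this]
    refine intervalIntegral.integral_congr fun θ _ => ?_
    rw [add_right_comm, ih]

/-- Greedy choice from coarse to fine: the estimate for level m involves only parameters of levels
up to m and averages over the finer ones, so later choices do not disturb it. Level M is never
fixed, which guarantees at least one averaging at each stage. -/
lemma exists_levels_aux (hq0 : 0 < q) (hq : q ≤ 2 / 5) (hf : Continuous f) (hf1 : ∀ x, |f x| ≤ 1)
    (M k : ℕ) (hk : k ≤ M) : ∃ v : ℕ → ℤ → ℝ, (∀ m k, |v m k| ≤ q) ∧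
      (∀ m k, v m (k + 2 ^ m) = v m k) ∧ ∀ m < k, ∀ j ≤ m, ∀ p : ℕ, p < 2 ^ j → ∀ ν : ℝ, 0 < ν →
        ‖∫ t in (p / 2 ^ j : ℝ)..((p + 1) / 2 ^ j),
          ((avgStage q f v M (m + 1) t - avgStage q f v M m t : ℝ) : ℂ) * ex (ν * t)‖ ≤
          32 * (210 / q) * ((ν / 2 ^ j) ^ (-(1 / 40) : ℝ) *
              ((2:ℝ) ^ (m - j)) ^ (-(1 / 40) : ℝ)) / 2 ^ j := by
  induction k with
  | zero => exact ⟨fun _ _ => 0, by simpa using hq0.le, by simp, by simp⟩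
  | succ k ih =>
    obtain ⟨v, hv, hvp, h⟩ := ih (by omega)
    obtain ⟨w, hw, hwp, h'⟩ := exists_level hq0 hq (hf.comp (continuous_cellComp hv 0 k))
      (fun x => hf1 _) k (M - (k + 1))
    refine ⟨Function.update v k w, fun m i => ?_, fun m i => ?_, fun m hm => ?_⟩
    · rcases eq_or_ne m k with rfl | hne
      · simpa using hw i
      · rw [Function.update_of_ne hne]; exact hv m i
    · rcases eq_or_ne m k with rfl | hne
      · simpa using hwp i
      · rw [Function.update_of_ne hne]; exact hvp m i
    · have hcong : ∀ i ≤ k, cellComp (Function.update v k w) 0 i = cellComp v 0 i := fun i hi =>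
        cellComp_congr fun l hl => Function.update_of_ne (by omega) _ _
      rcases Nat.lt_succ_iff_lt_or_eq.1 hm with hm | rfl
      · have e1 : avgStage q f (Function.update v k w) M (m + 1) = avgStage q f v M (m + 1) := by
          unfold avgStage; rw [hcong _ hm]
        have e2 : avgStage q f (Function.update v k w) M m = avgStage q f v M m := by
          unfold avgStage; rw [hcong _ hm.le]
        rw [e1, e2]
        exact h m hm
      · have e1 : avgStage q f (Function.update v m w) M (m + 1) =
            avgComp q (m + 1) (M - (m + 1) + 1) ((f ∘ cellComp v 0 m) ∘ cellMap m w) := by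
          unfold avgStage
          congr 1
          ext t
          simp only [Function.comp_apply]
          rw [cellComp_succ, hcong m le_rfl, zero_add, Function.update_self]
        have e2 : avgStage q f (Function.update v m w) M m =
            avgComp q m (M - (m + 1) + 2) (f ∘ cellComp v 0 m) := by
          unfold avgStage
          rw [hcong m le_rfl]
          congr 1; omega
        rw [e1, e2]
        exact h'

/-- The constant in the decay estimate for Fourier integrals over dyadic intervals. -/
noncomputable def dyadicConst (q : ℝ) : ℝ :=
  70 / q + 32 * (210 / q) * (1 - (2:ℝ) ^ (-(1 / 40) : ℝ))⁻¹

lemma two_rpow_lt_one : (2:ℝ) ^ (-(1 / 40) : ℝ) < 1 :=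
  Real.rpow_lt_one_of_one_lt_of_neg (by norm_num) (by norm_num)

lemma one_le_dyadicConst (hq0 : 0 < q) (hq : q ≤ 2 / 5) : 1 ≤ dyadicConst q := by
  unfold dyadicConst
  have h1 : 1 ≤ 70 / q := by rw [le_div_iff₀ hq0]; linarith
  have h2 : 0 < 1 - (2:ℝ) ^ (-(1 / 40) : ℝ) := sub_pos.2 two_rpow_lt_one
  have : 0 ≤ 32 * (210 / q) * (1 - (2:ℝ) ^ (-(1 / 40) : ℝ))⁻¹ := by positivity
  linarith

/-- There are cell maps such that the Fourier integrals of `f` composed with them decay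
on all dyadic intervals. -/
lemma exists_levels (hq0 : 0 < q) (hq : q ≤ 2 / 5) (hf : Continuous f) (hf1 : ∀ x, |f x| ≤ 1)
    (hfp : ∀ t, f (t + 1) = f t) (M : ℕ) : ∃ v : ℕ → ℤ → ℝ, (∀ m k, |v m k| ≤ q) ∧
      (∀ m k, v m (k + 2 ^ m) = v m k) ∧ ∀ j ≤ M, ∀ p : ℤ, ∀ ν : ℝ, 2 ^ j ≤ ν →
        ‖∫ t in (p / 2 ^ j : ℝ)..((p + 1) / 2 ^ j), (avgStage q f v M M t : ℂ) * ex (ν * t)‖ ≤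
          dyadicConst q * (ν / 2 ^ j) ^ (-(1 / 40) : ℝ) / 2 ^ j := by
  obtain ⟨v, hv, hvp, h⟩ := exists_levels_aux hq0 hq hf hf1 M M le_rfl
  refine ⟨v, hv, hvp, fun j hj p ν hν => ?_⟩
  have hpj : (0:ℝ) < 2 ^ j := by positivity
  have hν0 : 0 < ν := hpj.trans_le hν
  have hex := continuous_ex
  have hc := continuous_avgStage hf hv M
  have hper : ∀ t, avgStage q f v M M (t + 1) = avgStage q f v M M t := fun t => by
    refine avgComp_periodic (fun t => ?_) _ _ t
    simp only [Function.comp_apply]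
    rw [cellComp_add_one hvp, hfp]
  -- Translation by an integer multiplies the integral by a unimodular phase, even for non-integer
  -- ν.
  wlog hp : 0 ≤ p ∧ p < 2 ^ j generalizing p
  · have h2j : (0:ℤ) < 2 ^ j := by positivity
    have := this (p % 2 ^ j) ⟨Int.emod_nonneg _ h2j.ne', Int.emod_lt_of_pos _ h2j⟩
    convert this using 1
    have hdm : ((p % 2 ^ j : ℤ) : ℝ) + 2 ^ j * ((p / 2 ^ j : ℤ) : ℝ) = p := by
      exact_mod_cast Int.emod_add_mul_ediv p (2 ^ j)
    set p0 : ℤ := p % 2 ^ j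
    set k : ℤ := p / 2 ^ j
    have e1 : (p / 2 ^ j : ℝ) = p0 / 2 ^ j + k := by rw [← hdm]; field_simp
    have e2 : ((p + 1) / 2 ^ j : ℝ) = (p0 + 1) / 2 ^ j + k := by rw [← hdm]; field_simp; ring
    rw [e1, e2, ← intervalIntegral.integral_comp_add_right
      (fun t => (avgStage q f v M M t : ℂ) * ex (ν * t))]
    have hper' : ∀ t, avgStage q f v M M (t + k) = avgStage q f v M M t := fun t => by
      have : Function.Periodic (avgStage q f v M M) 1 := hper
      simpa using this.int_mul k t
    have : ∀ t, (avgStage q f v M M (t + k) : ℂ) * ex (ν * (t + k)) =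
        ex (ν * k) * ((avgStage q f v M M t : ℂ) * ex (ν * t)) := fun t => by
      rw [hper', mul_add, ex_add]; ring
    simp_rw [this]
    rw [intervalIntegral.integral_const_mul, norm_mul, norm_ex, one_mul]
  obtain ⟨p, rfl⟩ := Int.eq_ofNat_of_zero_le hp.1
  have hp2 : p < 2 ^ j := by exact_mod_cast hp.2
  obtain ⟨r, rfl⟩ := Nat.exists_eq_add_of_le hj
  set z := ν / 2 ^ j with hz
  have hz1 : 1 ≤ z := by rwa [hz, one_le_div hpj]
  -- The fully averaged stage j decays by regularity, and the increments of levels j + i sum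
  -- geometrically in i.
  have htel : ∀ t, avgStage q f v (j + r) (j + r) t = avgStage q f v (j + r) j t +
      ∑ i ∈ Finset.range r,
        (avgStage q f v (j + r) (j + i + 1) t - avgStage q f v (j + r) (j + i) t) := fun t => by
    have := Finset.sum_range_sub (fun i => avgStage q f v (j + r) (j + i) t) r
    simp only [← add_assoc, add_zero] at this
    rw [this]; ring
  have e : ∫ t in (((p:ℤ):ℝ) / 2 ^ j : ℝ)..((((p:ℤ):ℝ) + 1) / 2 ^ j),
      (avgStage q f v (j + r) (j + r) t : ℂ) * ex (ν * t) =
      (∫ t in (p / 2 ^ j : ℝ)..((p + 1) / 2 ^ j), (avgStage q f v (j + r) j t : ℂ) * ex (ν * t)) +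
      ∑ i ∈ Finset.range r, ∫ t in (p / 2 ^ j : ℝ)..((p + 1) / 2 ^ j),
        ((avgStage q f v (j + r) (j + i + 1) t - avgStage q f v (j + r) (j + i) t : ℝ) : ℂ) *
          ex (ν * t) := by
    have hii : ∀ i, Continuous fun t =>
        ((avgStage q f v (j + r) (j + i + 1) t - avgStage q f v (j + r) (j + i) t : ℝ) : ℂ) *
          ex (ν * t) := fun i => by
      have := hc (j + i + 1)
      have := hc (j + i)
      fun_prop
    have := hc j
    rw [Int.cast_natCast, ← intervalIntegral.integral_finsetSum fun i _ =>
      (hii i).intervalIntegrable _ _, ← intervalIntegral.integral_add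
      (Continuous.intervalIntegrable (by fun_prop) _ _)
      (Continuous.intervalIntegrable (continuous_finsetSum _ fun i _ => hii i) _ _)]
    refine intervalIntegral.integral_congr fun t _ => ?_
    rw [htel, Complex.ofReal_add, add_mul, Complex.ofReal_sum, Finset.sum_mul]
  rw [e]
  have b1 := norm_integral_avgComp_mul_ex_le hq0 hq (hf.comp (continuous_cellComp hv 0 j))
    (fun x => hf1 _) j (j + r - j) p hν0
  have b2 : ∀ i ∈ Finset.range r, ‖∫ t in (p / 2 ^ j : ℝ)..((p + 1) / 2 ^ j),
        ((avgStage q f v (j + r) (j + i + 1) t - avgStage q f v (j + r) (j + i) t : ℝ) : ℂ) *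
          ex (ν * t)‖ ≤ 32 * (210 / q) * z ^ (-(1 / 40) : ℝ) / 2 ^ j *
            ((2:ℝ) ^ (-(1 / 40) : ℝ)) ^ i := fun i hi => by
    have hi := Finset.mem_range.1 hi
    refine (h (j + i) (by omega) j (by omega) p hp2 ν hν0).trans (le_of_eq ?_)
    rw [Nat.add_sub_cancel_left]
    have : ((2:ℝ) ^ i) ^ (-(1 / 40) : ℝ) = ((2:ℝ) ^ (-(1 / 40) : ℝ)) ^ i := by
      rw [← Real.rpow_natCast, ← Real.rpow_mul (by norm_num), mul_comm, Real.rpow_mul (by norm_num),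
        Real.rpow_natCast]
    rw [this]; ring
  have hz40 : z ^ (-(1 / 8) : ℝ) ≤ z ^ (-(1 / 40) : ℝ) :=
    Real.rpow_le_rpow_of_exponent_le hz1 (by norm_num)
  have hgeom : ∑ i ∈ Finset.range r, ((2:ℝ) ^ (-(1 / 40) : ℝ)) ^ i ≤
      (1 - (2:ℝ) ^ (-(1 / 40) : ℝ))⁻¹ := by
    rw [← tsum_geometric_of_lt_one (by positivity) two_rpow_lt_one]
    exact (summable_geometric_of_lt_one (by positivity) two_rpow_lt_one).sum_le_tsum _
      fun i _ => by positivity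
  calc _ ≤ 70 / q * z ^ (-(1 / 8) : ℝ) / 2 ^ j + ∑ i ∈ Finset.range r,
        32 * (210 / q) * z ^ (-(1 / 40) : ℝ) / 2 ^ j * ((2:ℝ) ^ (-(1 / 40) : ℝ)) ^ i :=
        (norm_add_le _ _).trans (add_le_add b1 (norm_sum_le_of_le _ b2))
    _ ≤ 70 / q * z ^ (-(1 / 40) : ℝ) / 2 ^ j + 32 * (210 / q) * z ^ (-(1 / 40) : ℝ) / 2 ^ j *
        (1 - (2:ℝ) ^ (-(1 / 40) : ℝ))⁻¹ := by
        rw [← Finset.mul_sum]; gcongr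
    _ = _ := by unfold dyadicConst; ring

end

/-! ### From dyadic intervals to arbitrary intervals. -/

lemma norm_integral_mul_ex_le_length {F : ℝ → ℝ} (hF1 : ∀ x, |F x| ≤ 1) (ν c d : ℝ) :
    ‖∫ t in c..d, (F t : ℂ) * ex (ν * t)‖ ≤ |d - c| := by
  refine (intervalIntegral.norm_integral_le_of_norm_le_const (C := 1) fun x _ => ?_).trans
    (by rw [one_mul])
  rw [norm_mul, norm_ex, mul_one, Complex.norm_real]; exact hF1 x

/-- Decay over dyadic intervals implies decay over all intervals. -/
lemma norm_integral_mul_ex_le_of_dyadic {F : ℝ → ℝ} (hF : Continuous F) (hF1 : ∀ x, |F x| ≤ 1)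
    {C : ℝ} (hC : 1 ≤ C) {M : ℕ} (hD : ∀ j ≤ M, ∀ p : ℤ, ∀ ν : ℝ, 2 ^ j ≤ ν →
      ‖∫ t in (p / 2 ^ j : ℝ)..((p + 1) / 2 ^ j), (F t : ℂ) * ex (ν * t)‖ ≤
        C * (ν / 2 ^ j) ^ (-(1 / 40) : ℝ) / 2 ^ j)
    {ν c L : ℝ} (hL0 : 0 < L) (hL1 : L ≤ 1) (hνL : 1 ≤ ν * L) (hνM : ν ≤ 2 ^ M) :
    ‖∫ t in c..(c + L), (F t : ℂ) * ex (ν * t)‖ ≤ 4 * C * L * (ν * L) ^ (-(1 / 80) : ℝ) := by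
  set z := ν * L with hz
  have hz0 : 0 < z := by linarith
  have hex := continuous_ex
  have hc : Continuous fun t : ℝ => (F t : ℂ) * ex (ν * t) := by fun_prop
  have ii := fun a b => hc.intervalIntegrable (μ := volume) a b
  have hlen : ∀ c d : ℝ, _ := norm_integral_mul_ex_le_length hF1 ν
  have htriv : ‖∫ t in c..(c + L), (F t : ℂ) * ex (ν * t)‖ ≤ L := by
    have := hlen c (c + L)
    rwa [add_sub_cancel_left, abs_of_pos hL0] at this
  set X := z ^ (-(1 / 80) : ℝ) with hX
  have hX0 : 0 < X := by positivity
  rcases lt_or_ge z 4 with hz4 | hz4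
  · have : (1 / 4 : ℝ) ≤ X := by
      calc (1 / 4 : ℝ) = 4 ^ (-1 : ℝ) := by rw [Real.rpow_neg_one]; norm_num
        _ ≤ 4 ^ (-(1 / 80) : ℝ) := Real.rpow_le_rpow_of_exponent_le (by norm_num) (by norm_num)
        _ ≤ X := Real.rpow_le_rpow_of_nonpos hz0 hz4.le (by norm_num)
    refine htriv.trans ?_
    calc L = 4 * 1 * L * (1 / 4) := by ring
      _ ≤ _ := by gcongr
  set s := Real.sqrt z with hs
  have hs2 : s ^ 2 = z := Real.sq_sqrt hz0.le
  have hs4 : 2 ≤ s := Real.le_sqrt_of_sq_le (by linarith)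
  have hsX : s⁻¹ ≤ X := by
    rw [hs, hX, Real.sqrt_eq_rpow, ← Real.rpow_neg hz0.le]
    exact Real.rpow_le_rpow_of_exponent_le (by linarith) (by norm_num)
  -- Cells of length about L / √z: the two incomplete cells cost L / √z, and each complete one sees
  -- about √z oscillations, which halves the exponent 1/40.
  obtain ⟨j, hj1, hj2⟩ := exists_half_pow_near (x := L / s) (by positivity)
    (div_le_one_of_le₀ (by linarith) (by positivity))
  have hp : (0:ℝ) < 2 ^ j := by positivity
  rw [one_div, inv_pow] at hj1 hj2
  have hjν : 2 ^ j ≤ ν := by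
    have h1 : 2 ^ j * (L / s) ≤ 2 := by
      calc 2 ^ j * (L / s) ≤ 2 ^ j * (2 * (2 ^ j)⁻¹) := by gcongr
        _ = 2 := by field_simp
    rw [mul_div_assoc', div_le_iff₀ (by positivity)] at h1
    have h2 : 2 ^ j * L ≤ ν * L := by nlinarith
    exact le_of_mul_le_mul_right h2 hL0
  have hjM : j ≤ M := by
    have : (2:ℝ) ^ j ≤ 2 ^ M := hjν.trans hνM
    exact (pow_le_pow_iff_right₀ (by norm_num)).1 this
  have hj3 : ((2:ℝ) ^ j)⁻¹ ≤ L * X := by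
    calc _ ≤ L / s := hj1
      _ = L * s⁻¹ := rfl
      _ ≤ _ := by gcongr
  set a := ⌈2 ^ j * c⌉ with ha
  set b := ⌊2 ^ j * (c + L)⌋ with hb
  have a1 : 2 ^ j * c ≤ a := Int.le_ceil _
  have a2 : (a : ℝ) < 2 ^ j * c + 1 := Int.ceil_lt_add_one _
  have b1 : (b : ℝ) ≤ 2 ^ j * (c + L) := Int.floor_le _
  have b2 : 2 ^ j * (c + L) < b + 1 := Int.lt_floor_add_one _
  rcases lt_or_ge b a with hba | hba
  · have : (b : ℝ) + 1 ≤ a := by exact_mod_cast hba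
    have h1 : 2 ^ j * L ≤ 2 := by linarith
    have h2 : L ≤ 2 * (2 ^ j)⁻¹ := by
      rw [← div_eq_mul_inv, le_div_iff₀ hp]; linarith
    refine htriv.trans ?_
    have : 0 < L * X := by positivity
    nlinarith
  · obtain ⟨N, hN⟩ := Int.eq_ofNat_of_zero_le (sub_nonneg.2 hba)
    have hbN : (b : ℝ) = a + N := by
      have : b = a + N := by omega
      rw [this]; push_cast; rfl
    have hNL : (N : ℝ) / 2 ^ j ≤ L := by
      rw [div_le_iff₀ hp]; linarith
    have hsum := intervalIntegral.sum_integral_adjacent_intervals (μ := volume) (n := N)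
      (a := fun i => ((a + i : ℤ) : ℝ) / 2 ^ j) (fun k _ => ii _ _)
    have hmid : ‖∫ t in (a / 2 ^ j : ℝ)..(b / 2 ^ j), (F t : ℂ) * ex (ν * t)‖ ≤
        N * (C * (ν / 2 ^ j) ^ (-(1 / 40) : ℝ) / 2 ^ j) := by
      have e1 : (a / 2 ^ j : ℝ) = ((a + (0 : ℕ) : ℤ) : ℝ) / 2 ^ j := by push_cast; ring
      have e2 : (b / 2 ^ j : ℝ) = ((a + (N : ℕ) : ℤ) : ℝ) / 2 ^ j := by rw [hbN]; push_cast; ring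
      rw [e1, e2, ← hsum]
      refine (norm_sum_le _ _).trans ((Finset.sum_le_card_nsmul _ _
        (C * (ν / 2 ^ j) ^ (-(1 / 40) : ℝ) / 2 ^ j) fun i _ => ?_).trans
        (by rw [Finset.card_range, nsmul_eq_mul]))
      have := hD j hjM (a + i) ν hjν
      have e : ((a + (i + 1 : ℕ) : ℤ) : ℝ) = ((a + i : ℤ) : ℝ) + 1 := by push_cast; ring
      rwa [e]
    have hν2 : (ν / 2 ^ j) ^ (-(1 / 40) : ℝ) ≤ 2 * X := by
      have h1 : s / 2 ≤ ν / 2 ^ j := by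
        have : L / s / 2 ≤ (2 ^ j)⁻¹ := by linarith
        have hν0 : 0 < ν := hp.trans_le hjν
        calc s / 2 = z / s / 2 := by rw [← hs2]; field_simp
          _ = ν * (L / s / 2) := by rw [hz]; ring
          _ ≤ ν * (2 ^ j)⁻¹ := by gcongr
          _ = _ := rfl
      calc (ν / 2 ^ j) ^ (-(1 / 40) : ℝ) ≤ (s / 2) ^ (-(1 / 40) : ℝ) :=
            Real.rpow_le_rpow_of_nonpos (by positivity) h1 (by norm_num)
        _ = s ^ (-(1 / 40) : ℝ) * 2 ^ (1 / 40 : ℝ) := by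
          rw [Real.div_rpow (by positivity) (by norm_num), Real.rpow_neg (by norm_num : (0:ℝ) ≤ 2),
            div_inv_eq_mul]
        _ ≤ s ^ (-(1 / 40) : ℝ) * 2 ^ (1 : ℝ) := by
          gcongr
          · norm_num
          · norm_num
        _ = 2 * X := by
          rw [hs, hX, Real.sqrt_eq_rpow, ← Real.rpow_mul hz0.le, Real.rpow_one]
          norm_num [mul_comm]
    have l1 := hlen c (a / 2 ^ j)
    have l2 := hlen (b / 2 ^ j) (c + L)
    have ca : c ≤ a / 2 ^ j := by rw [le_div_iff₀ hp]; linarith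
    have cb : b / 2 ^ j ≤ c + L := by rw [div_le_iff₀ hp]; linarith
    have m1 : a / 2 ^ j - c ≤ (2 ^ j)⁻¹ := by
      rw [sub_le_iff_le_add, div_le_iff₀ hp, add_mul, inv_mul_cancel₀ hp.ne']; linarith
    have m2 : c + L - b / 2 ^ j ≤ (2 ^ j)⁻¹ := by
      rw [sub_le_comm, sub_le_iff_le_add, ← one_div, ← add_div, le_div_iff₀ hp]; linarith
    rw [abs_of_nonneg (sub_nonneg.2 ca)] at l1
    rw [abs_of_nonneg (sub_nonneg.2 cb)] at l2
    rw [← intervalIntegral.integral_add_adjacent_intervals (ii c (a / 2 ^ j)) (ii _ _),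
      ← intervalIntegral.integral_add_adjacent_intervals (ii (a / 2 ^ j) (b / 2 ^ j)) (ii _ _)]
    have hν0 : 0 < ν := hp.trans_le hjν
    have h3 : N * (C * (ν / 2 ^ j) ^ (-(1 / 40) : ℝ) / 2 ^ j) ≤ L * (C * (2 * X)) := by
      calc N * (C * (ν / 2 ^ j) ^ (-(1 / 40) : ℝ) / 2 ^ j) =
          N / 2 ^ j * (C * (ν / 2 ^ j) ^ (-(1 / 40) : ℝ)) := by ring
        _ ≤ _ := by gcongr
    refine (norm_add_le _ _).trans (le_trans (add_le_add l1 ((norm_add_le _ _).trans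
      (add_le_add hmid l2))) ?_)
    have : 0 < L * X := by positivity
    nlinarith

/-! ### Dirichlet kernel and Fourier partial sums. -/

lemma norm_ex_neg_sub_one_ge {s : ℝ} (h0 : 0 ≤ s) (h1 : s ≤ 1 / 2) : 4 * s ≤ ‖ex (-s) - 1‖ := by
  unfold ex
  have hpi := Real.pi_pos
  rw [mul_comm _ Complex.I, Complex.norm_exp_I_mul_ofReal_sub_one,
    show 2 * Real.pi * -s / 2 = -(Real.pi * s) by ring, Real.sin_neg, norm_mul, norm_neg]
  have h := Real.mul_le_sin (x := Real.pi * s) (by positivity) (by nlinarith)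
  have e : 2 / Real.pi * (Real.pi * s) = 2 * s := by field_simp
  rw [e] at h
  simp only [Real.norm_eq_abs, abs_two]
  have := le_abs_self (Real.sin (Real.pi * s))
  linarith

lemma hasDerivAt_ex_neg (s : ℝ) :
    HasDerivAt (fun s => ex (-s)) (-(2 * Real.pi * Complex.I) * ex (-s)) s := by
  have h1 : HasDerivAt (fun s : ℝ => ((2 * Real.pi * -s : ℝ) : ℂ) * Complex.I)
      (((2 * Real.pi * -1 : ℝ) : ℂ) * Complex.I) s :=
    (((hasDerivAt_id s).neg.const_mul (2 * Real.pi)).ofReal_comp).mul_const _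
  have h2 := h1.cexp
  unfold ex
  convert h2 using 1
  push_cast; ring

/-- Integration by parts against the singular factor of the Dirichlet kernel. -/
lemma norm_integral_mul_kernel_le {G : ℝ → ℝ} (hG : Continuous G) {C μ δ : ℝ} (hC : 0 ≤ C)
    (hδ : 0 < δ) (hδ1 : δ ≤ 1 / 2) (hμδ : 1 ≤ |μ| * δ)
    (hΦ : ∀ s, δ ≤ s → s ≤ 1 / 2 → ‖∫ t in (0:ℝ)..s, (G t : ℂ) * ex (μ * t)‖ ≤
      C * s * (|μ| * s) ^ (-(1 / 80) : ℝ)) :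
    ‖∫ s in δ..(1 / 2), (ex (-s) - 1)⁻¹ * ((G s : ℂ) * ex (μ * s))‖ ≤ 41 * C := by
  have hμ : 0 < |μ| := by
    by_contra h
    have : |μ| = 0 := le_antisymm (not_lt.1 h) (abs_nonneg _)
    rw [this] at hμδ; linarith
  have hex := continuous_ex
  have hc : Continuous fun t : ℝ => (G t : ℂ) * ex (μ * t) := by fun_prop
  set Φ := fun s : ℝ => ∫ t in (0:ℝ)..s, (G t : ℂ) * ex (μ * t) with hΦdef
  have hΦd : ∀ s, HasDerivAt Φ ((G s : ℂ) * ex (μ * s)) s := fun s =>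
    (hc.integral_hasStrictDerivAt 0 s).hasDerivAt
  have hne : ∀ s ∈ Set.uIcc δ (1 / 2), ex (-s) - 1 ≠ 0 := fun s hs => by
    rw [Set.uIcc_of_le hδ1] at hs
    have := norm_ex_neg_sub_one_ge (hδ.le.trans hs.1) hs.2
    rw [← norm_pos_iff]
    linarith [hs.1]
  have hκd : ∀ s ∈ Set.uIcc δ (1 / 2), HasDerivAt (fun s => (ex (-s) - 1)⁻¹)
      (-(-(2 * Real.pi * Complex.I) * ex (-s)) / (ex (-s) - 1) ^ 2) s := fun s hs =>
    ((hasDerivAt_ex_neg s).sub_const 1).fun_inv (hne s hs)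
  have hκc : ContinuousOn (fun s => -(-(2 * Real.pi * Complex.I) * ex (-s)) / (ex (-s) - 1) ^ 2)
      (Set.uIcc δ (1 / 2)) := by
    refine ContinuousOn.div (by fun_prop) (by fun_prop) fun s hs => pow_ne_zero 2 (hne s hs)
  rw [intervalIntegral.integral_mul_deriv_eq_deriv_mul hκd (fun s _ => hΦd s)
    hκc.intervalIntegrable (hc.intervalIntegrable _ _)]
  have bκ : ∀ s, δ ≤ s → s ≤ 1 / 2 → ‖(ex (-s) - 1)⁻¹‖ ≤ (4 * s)⁻¹ := fun s h1 h2 => by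
    have h0 : 0 < s := hδ.trans_le h1
    rw [norm_inv]
    gcongr
    exact norm_ex_neg_sub_one_ge h0.le h2
  have bb : ∀ s, δ ≤ s → s ≤ 1 / 2 → ‖(ex (-s) - 1)⁻¹ * Φ s‖ ≤ C / 4 := fun s h1 h2 => by
    have h0 : 0 < s := hδ.trans_le h1
    rw [norm_mul]
    have h3 : (|μ| * s) ^ (-(1 / 80) : ℝ) ≤ 1 :=
      Real.rpow_le_one_of_one_le_of_nonpos (hμδ.trans (by gcongr)) (by norm_num)
    calc _ ≤ (4 * s)⁻¹ * (C * s * 1) := by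
          gcongr
          · exact bκ s h1 h2
          · exact (hΦ s h1 h2).trans (by gcongr)
      _ = _ := by field_simp
  have bI : ‖∫ s in δ..(1 / 2), -(-(2 * Real.pi * Complex.I) * ex (-s)) / (ex (-s) - 1) ^ 2 * Φ s‖ ≤
      40 * C := by
    -- The derivative of the kernel is at most 1 / (2 s^2) and Φ is O(s (|μ| s)^(-1/80)). The
    -- surplus power makes the integral converge to a bound independent of μ, with 40 = 80 / 2.
    have hpt : ∀ s ∈ Set.Ioc δ (1 / 2),
        ‖-(-(2 * Real.pi * Complex.I) * ex (-s)) / (ex (-s) - 1) ^ 2 * Φ s‖ ≤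
        C / 2 * |μ| ^ (-(1 / 80) : ℝ) * s ^ (-(1 / 80) - 1 : ℝ) := fun s hs => by
      have h0 : 0 < s := hδ.trans hs.1
      have k1 : ‖-(-(2 * Real.pi * Complex.I) * ex (-s)) / (ex (-s) - 1) ^ 2‖ ≤
          8 * ((4 * s)⁻¹) ^ 2 := by
        rw [norm_div, norm_neg, norm_mul, norm_neg, norm_ex, mul_one, norm_pow, div_eq_mul_inv,
          ← inv_pow, ← norm_inv]
        have : ‖(2 * Real.pi * Complex.I : ℂ)‖ = 2 * Real.pi := by
          simp [abs_of_pos Real.pi_pos]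
        rw [this]
        gcongr
        · linarith [Real.pi_lt_four]
        · exact bκ s hs.1.le hs.2
      rw [norm_mul]
      calc _ ≤ 8 * ((4 * s)⁻¹) ^ 2 * (C * s * (|μ| * s) ^ (-(1 / 80) : ℝ)) := by
            gcongr
            exact hΦ s hs.1.le hs.2
        _ = _ := by
          rw [Real.mul_rpow hμ.le h0.le, Real.rpow_sub_one h0.ne']; field_simp; ring
    have hnot : (0:ℝ) ∉ Set.uIcc δ (1 / 2) := by
      rw [Set.uIcc_of_le hδ1]; intro h; linarith [h.1]
    have hint : IntervalIntegrable (fun s : ℝ => C / 2 * |μ| ^ (-(1 / 80) : ℝ) *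
        s ^ (-(1 / 80) - 1 : ℝ)) volume δ (1 / 2) :=
      (intervalIntegral.intervalIntegrable_rpow (Or.inr hnot)).const_mul _
    refine (intervalIntegral.norm_integral_le_of_norm_le hδ1
      (Filter.Eventually.of_forall hpt) hint).trans ?_
    rw [intervalIntegral.integral_const_mul, integral_rpow (Or.inr ⟨by norm_num, hnot⟩),
      sub_add_cancel]
    have e1 : 0 ≤ (1 / 2 : ℝ) ^ (-(1 / 80) : ℝ) := by positivity
    have e2 : |μ| ^ (-(1 / 80) : ℝ) * δ ^ (-(1 / 80) : ℝ) ≤ 1 := by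
      rw [← Real.mul_rpow hμ.le hδ.le]
      exact Real.rpow_le_one_of_one_le_of_nonpos hμδ (by norm_num)
    have e3 : 0 ≤ |μ| ^ (-(1 / 80) : ℝ) := by positivity
    calc _ = 40 * C * (|μ| ^ (-(1 / 80) : ℝ) * δ ^ (-(1 / 80) : ℝ)) -
        40 * C * (|μ| ^ (-(1 / 80) : ℝ) * (1 / 2 : ℝ) ^ (-(1 / 80) : ℝ)) := by ring
      _ ≤ 40 * C * 1 - 0 := by
        gcongr
        positivity
      _ = _ := by ring
  have b1 := bb (1 / 2) hδ1 le_rfl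
  have b2 := bb δ le_rfl hδ1
  refine (norm_sub_le _ _).trans ((add_le_add (norm_sub_le _ _) bI).trans ?_)
  linarith

/-- The Dirichlet kernel. -/
noncomputable def dirichletKernel (n : ℕ) (s : ℝ) : ℂ :=
  ∑ k ∈ Finset.Icc (-(n : ℤ)) n, ex (-(k * s))

lemma norm_dirichletKernel_le (n : ℕ) (s : ℝ) : ‖dirichletKernel n s‖ ≤ 2 * n + 1 := by
  unfold dirichletKernel
  refine (norm_sum_le _ _).trans (le_of_eq ?_)
  simp only [norm_ex, Finset.sum_const, Int.card_Icc, nsmul_eq_mul, mul_one]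
  have : ((n:ℤ) + 1 - -(n:ℤ)).toNat = 2 * n + 1 := by omega
  rw [this]; push_cast; ring

lemma continuous_dirichletKernel (n : ℕ) : Continuous (dirichletKernel n) := by
  have := continuous_ex
  unfold dirichletKernel
  exact continuous_finsetSum _ fun k _ => by fun_prop

lemma sub_one_mul_dirichletKernel (n : ℕ) (s : ℝ) :
    (ex (-s) - 1) * dirichletKernel n s = ex (-(n + 1) * s) - ex (n * s) := by
  induction n with
  | zero => simp [dirichletKernel, ex_zero]
  | succ n ih =>
    have : dirichletKernel (n + 1) s =
        dirichletKernel n s + ex (-((n + 1 : ℤ) * s)) + ex (-((-(n + 1) : ℤ) * s)) := by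
      unfold dirichletKernel
      have e : Finset.Icc (-((n + 1 : ℕ) : ℤ)) ((n + 1 : ℕ) : ℤ) =
          insert (-(n + 1) : ℤ) (insert (n + 1 : ℤ) (Finset.Icc (-(n : ℤ)) n)) := by
        ext k; simp only [Finset.mem_Icc, Finset.mem_insert]; push_cast; omega
      rw [e, Finset.sum_insert (by simp only [Finset.mem_insert, Finset.mem_Icc]; omega),
        Finset.sum_insert (by simp only [Finset.mem_Icc]; omega)]
      push_cast
      ring
    rw [this, mul_add, mul_add, ih, sub_mul, sub_mul, one_mul, one_mul, ← ex_add, ← ex_add]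
    push_cast
    have e1 : -s + -((n + 1 : ℝ) * s) = -(n + 1 + 1) * s := by ring
    have e2 : -s + -(-(n + 1 : ℝ) * s) = n * s := by ring
    have e3 : -((n + 1 : ℝ) * s) = -(n + 1) * s := by ring
    have e4 : -(-(n + 1 : ℝ) * s) = (n + 1) * s := by ring
    rw [e1]
    rw [e2]
    rw [e3]
    rw [e4]
    ring

lemma conj_ex (x : ℝ) : (starRingEnd ℂ) (ex x) = ex (-x) := by
  unfold ex
  rw [← Complex.exp_conj, map_mul, Complex.conj_ofReal, Complex.conj_I]
  congr 1
  push_cast; ring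

lemma conj_integral (f : ℝ → ℂ) (a b : ℝ) :
    (starRingEnd ℂ) (∫ t in a..b, f t) = ∫ t in a..b, (starRingEnd ℂ) (f t) := by
  simp only [intervalIntegral, map_sub, integral_conj]

/-- Decay of Fourier integrals over intervals implies boundedness of the Dirichlet integrals. -/
lemma norm_dirichlet_integral_le {F : ℝ → ℝ} (hF : Continuous F) (hF1 : ∀ x, |F x| ≤ 1)
    {C : ℝ} (hC : 1 ≤ C) {n : ℕ} (hD : ∀ ν c L : ℝ, 0 < L → L ≤ 1 → 1 ≤ ν * L → ν ≤ n + 1 →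
      ‖∫ t in c..(c + L), (F t : ℂ) * ex (ν * t)‖ ≤ C * L * (ν * L) ^ (-(1 / 80) : ℝ)) (x : ℝ) :
    ‖∫ s in (-(1 / 2) : ℝ)..(1 / 2), (F (x + s) : ℂ) * dirichletKernel n s‖ ≤ 170 * C := by
  have hK := continuous_dirichletKernel n
  have hex := continuous_ex
  have hc : Continuous fun s => (F (x + s) : ℂ) * dirichletKernel n s := by fun_prop
  have ii := fun a b => hc.intervalIntegrable (μ := volume) a b
  have hlen : ∀ a b : ℝ, ‖∫ s in a..b, (F (x + s) : ℂ) * dirichletKernel n s‖ ≤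
      (2 * n + 1) * |b - a| := fun a b => by
    refine intervalIntegral.norm_integral_le_of_norm_le_const fun s _ => ?_
    rw [norm_mul, Complex.norm_real, ← one_mul (2 * (n:ℝ) + 1)]
    exact mul_le_mul (hF1 _) (norm_dirichletKernel_le n s) (norm_nonneg _) zero_le_one
  rcases Nat.lt_or_ge n 2 with hn | hn
  · refine (hlen _ _).trans ?_
    have : (n : ℝ) ≤ 1 := by exact_mod_cast Nat.lt_succ_iff.1 hn
    norm_num
    linarith
  have hn2 : (2:ℝ) ≤ n := by exact_mod_cast hn
  have hn0 : (0:ℝ) < n := by linarith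
  -- On [-1/n, 1/n] the trivial bound 2n + 1 for the kernel is enough; outside, the kernel splits
  -- into frequencies n and n + 1 over a common singular factor.
  set δ : ℝ := 1 / n with hδ
  have hδ0 : 0 < δ := by positivity
  have hδ1 : δ ≤ 1 / 2 := by rw [hδ]; gcongr
  have hnδ : n * δ = 1 := by rw [hδ]; field_simp
  -- frequencies of both signs
  have hfreq : ∀ μ c L : ℝ, 0 < L → L ≤ 1 → 1 ≤ |μ| * L → |μ| ≤ n + 1 →
      ‖∫ t in c..(c + L), (F t : ℂ) * ex (μ * t)‖ ≤ C * L * (|μ| * L) ^ (-(1 / 80) : ℝ) := by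
    intro μ c L h1 h2 h3 h4
    rcases le_total 0 μ with h | h
    · rw [abs_of_nonneg h] at *; exact hD μ c L h1 h2 h3 h4
    · rw [abs_of_nonpos h] at *
      have := hD (-μ) c L h1 h2 h3 h4
      rw [← Complex.norm_conj, conj_integral] at this
      simpa only [map_mul, Complex.conj_ofReal, conj_ex, neg_mul, neg_neg] using this
  -- both sides of the singularity
  have hside : ∀ σ : ℝ, (σ = 1 ∨ σ = -1) → ∀ μ : ℝ, 1 ≤ |μ| * δ → |μ| ≤ n + 1 →
      ‖∫ s in δ..(1 / 2), (ex (-s) - 1)⁻¹ * ((F (x + σ * s) : ℂ) * ex (μ * s))‖ ≤ 41 * C := by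
    intro σ hσ μ hμδ hμn
    refine norm_integral_mul_kernel_le (G := fun s => F (x + σ * s)) (by fun_prop) (by linarith)
      hδ0 hδ1 hμδ fun s hs1 hs2 => ?_
    have hs0 : 0 < s := hδ0.trans_le hs1
    have hμs : 1 ≤ |μ| * s := hμδ.trans (by gcongr)
    rcases hσ with rfl | rfl
    · have e : ∫ t in (0:ℝ)..s, (F (x + 1 * t) : ℂ) * ex (μ * t) =
          ex (-(μ * x)) * ∫ t in x..(x + s), (F t : ℂ) * ex (μ * t) := by
        rw [← intervalIntegral.integral_const_mul]
        have := intervalIntegral.integral_comp_add_left (a := 0) (b := s)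
          (fun t => ex (-(μ * x)) * ((F t : ℂ) * ex (μ * t))) x
        rw [add_zero] at this
        rw [← this]
        refine intervalIntegral.integral_congr fun t _ => ?_
        simp only [one_mul]
        rw [mul_left_comm, ← ex_add]; ring_nf
      rw [e, norm_mul, norm_ex, one_mul]
      exact hfreq μ x s hs0 (by linarith) hμs hμn
    · have e : ∫ t in (0:ℝ)..s, (F (x + -1 * t) : ℂ) * ex (μ * t) =
          ex (μ * x) * ∫ t in (x - s)..(x - s + s), (F t : ℂ) * ex (-μ * t) := by
        rw [← intervalIntegral.integral_const_mul, sub_add_cancel]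
        have := intervalIntegral.integral_comp_sub_left (a := 0) (b := s)
          (fun t => ex (μ * x) * ((F t : ℂ) * ex (-μ * t))) x
        rw [sub_zero] at this
        rw [← this]
        refine intervalIntegral.integral_congr fun t _ => ?_
        rw [mul_left_comm, ← ex_add]; ring_nf
      rw [e, norm_mul, norm_ex, one_mul]
      have := hfreq (-μ) (x - s) s hs0 (by linarith) (by rwa [abs_neg]) (by rwa [abs_neg])
      rwa [abs_neg] at this
  have hκ : ∀ s ∈ Set.uIcc δ (1 / 2), ex (-s) - 1 ≠ 0 := fun s hs => by
    rw [Set.uIcc_of_le hδ1] at hs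
    have := norm_ex_neg_sub_one_ge (hδ0.le.trans hs.1) hs.2
    rw [← norm_pos_iff]; linarith [hs.1]
  have hcκ : ∀ σ μ : ℝ, IntervalIntegrable
      (fun s => (ex (-s) - 1)⁻¹ * ((F (x + σ * s) : ℂ) * ex (μ * s))) volume δ (1 / 2) :=
    fun σ μ => ContinuousOn.intervalIntegrable
      (ContinuousOn.mul (ContinuousOn.inv₀ (by fun_prop) hκ) (by fun_prop))
  have hm1 : 1 ≤ |-((n:ℝ) + 1)| * δ := by
    rw [abs_neg, abs_of_pos (by positivity)]; nlinarith
  have hm2 : |-((n:ℝ) + 1)| ≤ n + 1 := by rw [abs_neg, abs_of_pos (by positivity)]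
  have hm3 : 1 ≤ |(n:ℝ)| * δ := by rw [abs_of_pos hn0, hnδ]
  have hm4 : |(n:ℝ)| ≤ n + 1 := by rw [abs_of_pos hn0]; linarith
  have hright : ∀ σ : ℝ, (σ = 1 ∨ σ = -1) →
      ‖∫ s in δ..(1 / 2), (F (x + σ * s) : ℂ) * dirichletKernel n s‖ ≤ 82 * C := by
    intro σ hσ
    have e : ∫ s in δ..(1 / 2), (F (x + σ * s) : ℂ) * dirichletKernel n s =
        (∫ s in δ..(1 / 2), (ex (-s) - 1)⁻¹ * ((F (x + σ * s) : ℂ) * ex (-(n + 1) * s))) -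
        ∫ s in δ..(1 / 2), (ex (-s) - 1)⁻¹ * ((F (x + σ * s) : ℂ) * ex (n * s)) := by
      rw [← intervalIntegral.integral_sub (hcκ _ _) (hcκ _ _)]
      refine intervalIntegral.integral_congr fun s hs => ?_
      have h1 := sub_one_mul_dirichletKernel n s
      have h2 := hκ s hs
      have h3 : dirichletKernel n s = (ex (-s) - 1)⁻¹ * (ex (-(n + 1) * s) - ex (n * s)) := by
        rw [← h1, inv_mul_cancel_left₀ h2]
      simp only [h3]
      ring
    rw [e]
    refine (norm_sub_le _ _).trans ((add_le_add (hside σ hσ _ hm1 hm2) (hside σ hσ _ hm3 hm4)).trans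
      (by linarith))
  have hr := hright 1 (Or.inl rfl)
  have hl := hright (-1) (Or.inr rfl)
  have hDneg : ∀ s, dirichletKernel n (-s) = (starRingEnd ℂ) (dirichletKernel n s) := fun s => by
    simp only [dirichletKernel, map_sum, conj_ex, mul_neg]
  have hleft : ‖∫ s in (-(1 / 2) : ℝ)..(-δ), (F (x + s) : ℂ) * dirichletKernel n s‖ ≤ 82 * C := by
    rw [← intervalIntegral.integral_comp_neg
      (fun s => (F (x + s) : ℂ) * dirichletKernel n s), ← Complex.norm_conj, conj_integral]
    simp only [map_mul, Complex.conj_ofReal, hDneg, Complex.conj_conj]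
    simpa only [neg_mul, one_mul] using hl
  rw [← intervalIntegral.integral_add_adjacent_intervals (ii _ (-δ)) (ii _ _),
    ← intervalIntegral.integral_add_adjacent_intervals (ii (-δ) δ) (ii _ _)]
  have hmid := hlen (-δ) δ
  have e : (2 * (n:ℝ) + 1) * |δ - -δ| ≤ 6 := by
    rw [sub_neg_eq_add, abs_of_pos (by positivity)]; nlinarith
  simp only [one_mul] at hr
  refine (norm_add_le _ _).trans ((add_le_add hleft ((norm_add_le _ _).trans
    (add_le_add (hmid.trans e) hr))).trans ?_)
  linarith

lemma fourier_eq_ex (k : ℤ) (t : ℝ) : fourier k (t : UnitAddCircle) = ex (k * t) := by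
  rw [fourier_coe_apply]; unfold ex; congr 1; push_cast; ring

lemma fourierPartialSum_eq {g : UnitAddCircle → ℂ} {F : ℝ → ℝ} (hF : Continuous F)
    (hg : ∀ t : ℝ, g t = F t) (n : ℕ) (x : ℝ) :
    fourierPartialSum g n x =
      ∫ s in (-(1 / 2) : ℝ)..(1 / 2), (F (x + s) : ℂ) * dirichletKernel n s := by
  have hex := continuous_ex
  unfold fourierPartialSum dirichletKernel
  simp_rw [Finset.mul_sum]
  rw [intervalIntegral.integral_finsetSum fun k _ =>
    Continuous.intervalIntegrable (by fun_prop) _ _]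
  refine Finset.sum_congr rfl fun k _ => ?_
  rw [fourierCoeff_eq_intervalIntegral g k (x - 1 / 2), fourier_eq_ex, div_one, one_smul,
    ← intervalIntegral.integral_mul_const]
  have := intervalIntegral.integral_comp_add_left (a := -(1 / 2)) (b := 1 / 2)
    (fun t : ℝ => fourier (-k) (t : UnitAddCircle) • g t * ex (k * x)) x
  rw [show x + -(1 / 2) = x - 1 / 2 by ring, show x + 1 / 2 = x - 1 / 2 + 1 by ring] at this
  rw [← this]
  refine intervalIntegral.integral_congr fun s _ => ?_
  simp only [hg, fourier_eq_ex, smul_eq_mul]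
  rw [mul_right_comm, ← ex_add, mul_comm]
  congr 2
  push_cast; ring

/-! ### Passage to the limit and to the circle. -/

open Filter Topology

lemma exists_coe_eq_abs_eq_norm (z : UnitAddCircle) : ∃ d : ℝ, (d : UnitAddCircle) = z ∧ |d| = ‖z‖ := by
  induction z using QuotientAddGroup.induction_on with
  | H u =>
    refine ⟨u - round u, ?_, (UnitAddCircle.norm_eq).symm⟩
    have : ((u - (round u : ℤ) : ℝ) : UnitAddCircle) = u - ((round u : ℤ) : ℝ) := AddCircle.coe_sub ..
    rw [this, sub_eq_self, AddCircle.coe_eq_zero_iff]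
    exact ⟨round u, by simp⟩

lemma norm_coe_circle_le (t : ℝ) : ‖(t : UnitAddCircle)‖ ≤ |t| := by
  simpa [tri] using tri_le_abs_sub_int t 0

lemma norm_circle_le_half (z : UnitAddCircle) : ‖z‖ ≤ 1 / 2 := by
  obtain ⟨d, rfl, -⟩ := exists_coe_eq_abs_eq_norm z
  exact tri_le_half d

lemma coe_circle_add_int (t : ℝ) (k : ℤ) : ((t + k : ℝ) : UnitAddCircle) = t := by
  rw [AddCircle.coe_add, add_eq_left, AddCircle.coe_eq_zero_iff]
  exact ⟨k, by simp⟩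

lemma holderWith_of_dist_le {X Y : Type*} [PseudoMetricSpace X] [PseudoMetricSpace Y] {g : X → Y}
    {C α : ℝ≥0} (h : ∀ x y, dist (g x) (g y) ≤ C * dist x y ^ (α : ℝ)) : HolderWith C α g := by
  intro x y
  rw [edist_nndist, edist_nndist, ← ENNReal.coe_rpow_of_nonneg _ α.coe_nonneg, ← ENNReal.coe_mul,
    ENNReal.coe_le_coe, ← NNReal.coe_le_coe]
  simpa using h x y

/-- A degree one map of the line satisfying two-sided Hölder bounds descends to a bi-Hölder
homeomorphism of the circle. -/
lemma exists_homeomorph_of_biholder {h : ℝ → ℝ} {α : ℝ≥0} (hα : 0 < α)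
    (h1 : ∀ t, h (t + 1) = h t + 1) (hd : ∀ t, |h t - t| ≤ 1)
    (hu : ∀ t s, |t - s| ≤ 1 → |h t - h s| ≤ 4 * |t - s| ^ (α : ℝ))
    (hl : ∀ t s x, 0 < x → x ≤ 1 → x ≤ |t - s| → x ≤ 4 * |h t - h s| ^ (α : ℝ)) :
    ∃ H : UnitAddCircle ≃ₜ UnitAddCircle, (∀ t : ℝ, H t = (h t : UnitAddCircle)) ∧
      HolderWith 4 α H ∧ HolderWith 4 α H.symm ∧ Continuous h := by
  have hα' : (0:ℝ) < α := hα
  have hc : Continuous h := by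
    refine continuous_iff_continuousAt.2 fun t => tendsto_iff_dist_tendsto_zero.2 ?_
    have hlim : Tendsto (fun s => 4 * |s - t| ^ (α : ℝ)) (𝓝 t) (𝓝 0) := by
      have : Continuous fun s => 4 * |s - t| ^ (α : ℝ) :=
        continuous_const.mul ((by fun_prop : Continuous fun s : ℝ => |s - t|).rpow_const
          fun _ => Or.inr hα'.le)
      have h' := this.tendsto t
      rwa [sub_self, abs_zero, Real.zero_rpow hα'.ne', mul_zero] at h'
    refine squeeze_zero' (.of_forall fun _ => dist_nonneg) ?_ hlim
    filter_upwards [Metric.closedBall_mem_nhds t one_pos] with s hs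
    exact hu s t hs
  have hZ : ∀ (k : ℤ) t, h (t + k) = h t + k := by
    intro k
    induction k using Int.induction_on with
    | zero => simp
    | succ i ih => intro t; push_cast at ih ⊢; rw [← add_assoc, h1, ih, add_assoc]
    | pred i ih =>
      intro t
      have := h1 (t + ((-i - 1 : ℤ) : ℝ))
      push_cast at ih this ⊢
      rw [add_assoc, sub_add_cancel, ih] at this
      linarith
  have hper : Function.Periodic (fun t => (h t : UnitAddCircle)) 1 := fun t => by
    simp only
    rw [h1, AddCircle.coe_add_period]
  set G : UnitAddCircle → UnitAddCircle := hper.lift with hG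
  have hGt : ∀ t : ℝ, G t = (h t : UnitAddCircle) := fun t => hper.lift_coe t
  have up : ∀ x y, dist (G x) (G y) ≤ (4 : ℝ≥0) * dist x y ^ (α : ℝ) := by
    intro x y
    induction y using QuotientAddGroup.induction_on with
    | H s =>
      obtain ⟨d, hd1, hd2⟩ := exists_coe_eq_abs_eq_norm (x - (s : UnitAddCircle))
      have hx : x = ((s + d : ℝ) : UnitAddCircle) := by rw [AddCircle.coe_add, hd1]; abel
      have hle := norm_circle_le_half (x - (s : UnitAddCircle))
      have hsd : |s + d - s| = ‖x - (s : UnitAddCircle)‖ := by rw [add_sub_cancel_left, hd2]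
      change dist (G x) (G (s : UnitAddCircle)) ≤ _ * dist x (s : UnitAddCircle) ^ (α : ℝ)
      rw [dist_eq_norm, dist_eq_norm, ← hsd]
      rw [hx, hGt, hGt, ← AddCircle.coe_sub]
      exact (norm_coe_circle_le _).trans (hu _ _ (by rw [hsd]; linarith))
  have low : ∀ x y, dist x y ≤ (4 : ℝ≥0) * dist (G x) (G y) ^ (α : ℝ) := by
    intro x y
    rcases eq_or_ne x y with rfl | hne
    · rw [dist_self]; positivity
    have h0 := dist_pos.2 hne
    have hle := norm_circle_le_half (x - y)
    rw [← dist_eq_norm] at hle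
    obtain ⟨t, rfl⟩ := QuotientAddGroup.mk_surjective x
    obtain ⟨s, rfl⟩ := QuotientAddGroup.mk_surjective y
    change dist (t : UnitAddCircle) (s : UnitAddCircle) ≤
      _ * dist (G (t : UnitAddCircle)) (G (s : UnitAddCircle)) ^ (α : ℝ)
    change 0 < dist (t : UnitAddCircle) (s : UnitAddCircle) at h0
    change dist (t : UnitAddCircle) (s : UnitAddCircle) ≤ _ at hle
    -- This lift of the second point makes the distance of the images on the line equal to that on
    -- the circle. The lifted points themselves are at least as far apart as on the circle, hence
    -- the separate lower bound x in `hl`.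
    set k := round (h t - h s)
    have e1 : dist (G (t : UnitAddCircle)) (G (s : UnitAddCircle)) = |h t - h (s + k)| := by
      rw [dist_eq_norm, hGt, hGt, ← AddCircle.coe_sub, UnitAddCircle.norm_eq, hZ]
      congr 1; ring
    rw [e1]
    refine hl _ _ _ h0 (by linarith) ?_
    rw [dist_eq_norm, ← coe_circle_add_int s k, ← AddCircle.coe_sub]
    exact norm_coe_circle_le _
  have inj : Function.Injective G := by
    intro x y hxy
    have := low x y
    rw [hxy, dist_self, Real.zero_rpow hα'.ne', mul_zero] at this
    exact dist_le_zero.1 this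
  have surj : Function.Surjective G := by
    intro y
    obtain ⟨c, rfl⟩ := QuotientAddGroup.mk_surjective y
    obtain ⟨t, ht⟩ := mem_range_of_exists_le_of_exists_ge hc (c := c)
      ⟨c - 1, by have := abs_le.1 (hd (c - 1)); linarith⟩
      ⟨c + 1, by have := abs_le.1 (hd (c + 1)); linarith⟩
    exact ⟨t, by rw [hGt, ht]⟩
  let e := Equiv.ofBijective G ⟨inj, surj⟩
  have hol : HolderWith 4 α G := holderWith_of_dist_le up
  have hols : HolderWith 4 α e.symm := holderWith_of_dist_le fun x y => by
    have := low (e.symm x) (e.symm y)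
    rwa [show G (e.symm x) = x from e.apply_symm_apply x,
      show G (e.symm y) = y from e.apply_symm_apply y] at this
  exact ⟨⟨e, hol.continuous hα, hols.continuous hα⟩, hGt, hol, hols, hc⟩

/-- Along the hyperfilter an equi-Hölder sequence of functions that stay close to the identity
converges, locally uniformly. -/
lemma exists_tendstoUniformlyOn_hyperfilter {H : ℕ → ℝ → ℝ} {α : ℝ} (hα : 0 < α)
    (hd : ∀ M t, |H M t - t| ≤ 1)
    (hu : ∀ M t s, |t - s| ≤ 1 → |H M t - H M s| ≤ 4 * |t - s| ^ α) :
    ∃ h : ℝ → ℝ, (∀ t, Tendsto (fun M => H M t) (hyperfilter ℕ) (𝓝 (h t))) ∧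
      ∀ a b, TendstoUniformlyOn H h (hyperfilter ℕ) (Set.Icc a b) := by
  -- Values at t stay in a compact interval, so an ultrafilter gives all pointwise limits without a
  -- diagonal argument; equicontinuity then makes them locally uniform.
  have hex : ∀ t, ∃ y, Tendsto (fun M => H M t) (hyperfilter ℕ) (𝓝 y) := fun t => by
    obtain ⟨y, -, hy⟩ := (isCompact_Icc (a := t - 1) (b := t + 1)).ultrafilter_le_nhds
      ((hyperfilter ℕ).map fun M => H M t) (by
        rw [Ultrafilter.coe_map, le_principal_iff, mem_map]
        refine Filter.univ_mem' fun M => ?_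
        have := abs_le.1 (hd M t)
        exact ⟨by linarith, by linarith⟩)
    exact ⟨y, hy⟩
  choose h hh using hex
  refine ⟨h, hh, fun a b => ?_⟩
  have heq : Equicontinuous H := by
    refine fun t => Metric.equicontinuousAt_of_continuity_modulus (fun s => 4 * |t - s| ^ α) ?_ H ?_
    · have : Continuous fun s => 4 * |t - s| ^ α :=
        continuous_const.mul ((by fun_prop : Continuous fun s : ℝ => |t - s|).rpow_const
          fun _ => Or.inr hα.le)
      have h' := this.tendsto t
      rwa [sub_self, abs_zero, Real.zero_rpow hα.ne', mul_zero] at h'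
    · filter_upwards [Metric.closedBall_mem_nhds t one_pos] with s hs M
      exact hu M t s (by rwa [abs_sub_comm])
  have := (EquicontinuousOn.tendsto_uniformOnFun_iff_pi (𝔖 := {K : Set ℝ | IsCompact K})
    (fun _ hK => hK) (Set.eq_univ_of_forall fun t => ⟨{t}, isCompact_singleton, rfl⟩)
    (fun K _ => heq.equicontinuousOn K) (hyperfilter ℕ : Filter ℕ) h).2 (tendsto_pi_nhds.2 hh)
  exact UniformOnFun.tendsto_iff_tendstoUniformlyOn.1 this _ isCompact_Icc

/-- The factor 2n + 1 is harmless, because n is fixed while the number of levels grows. -/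
lemma norm_dirichlet_integral_sub_le {F G : ℝ → ℝ} (hF : Continuous F) (hG : Continuous G)
    {x ε : ℝ} (h : ∀ t ∈ Set.Icc (x - 1 / 2) (x + 1 / 2), |F t - G t| ≤ ε) (n : ℕ) :
    ‖∫ s in (-(1 / 2) : ℝ)..(1 / 2), (F (x + s) : ℂ) * dirichletKernel n s‖ ≤
      ‖∫ s in (-(1 / 2) : ℝ)..(1 / 2), (G (x + s) : ℂ) * dirichletKernel n s‖ +
        ε * (2 * n + 1) := by
  have hK := continuous_dirichletKernel n
  rw [← sub_le_iff_le_add']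
  refine (norm_sub_norm_le _ _).trans ?_
  rw [← intervalIntegral.integral_sub (Continuous.intervalIntegrable (by fun_prop) _ _)
    (Continuous.intervalIntegrable (by fun_prop) _ _)]
  refine (intervalIntegral.norm_integral_le_of_norm_le_const (C := ε * (2 * n + 1))
    fun s hs => ?_).trans (by norm_num)
  rw [Set.uIoc_of_le (by norm_num)] at hs
  rw [← sub_mul, ← Complex.ofReal_sub, norm_mul, Complex.norm_real]
  have h1 := h (x + s) ⟨by linarith [hs.1], by linarith [hs.2]⟩
  exact mul_le_mul h1 (norm_dirichletKernel_le n s) (norm_nonneg _) ((abs_nonneg _).trans h1)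

/-- The parameters may change completely with M, but all bounds depend on q and α alone and
therefore survive the limit. -/
lemma exists_biholder_dirichlet_bound {q : ℝ} (hq0 : 0 < q) (hq : q ≤ 2 / 5) {α : ℝ} (hα0 : 0 < α)
    (hα1 : α ≤ 1) (hqα : 1 + q ≤ 2 ^ (1 - α)) (hqα' : (1 / 2 : ℝ) ^ (α⁻¹ - 1) ≤ 1 - q) {f : ℝ → ℝ}
    (hf : UniformContinuous f) (hf1 : ∀ x, |f x| ≤ 1) (hfp : ∀ t, f (t + 1) = f t) :
    ∃ h : ℝ → ℝ, (∀ t, h (t + 1) = h t + 1) ∧ (∀ t, |h t - t| ≤ 1) ∧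
      (∀ t s, |t - s| ≤ 1 → |h t - h s| ≤ 4 * |t - s| ^ α) ∧
      (∀ t s x, 0 < x → x ≤ 1 → x ≤ |t - s| → x ≤ 4 * |h t - h s| ^ α) ∧
      (Continuous h → ∀ n x, ‖∫ s in (-(1 / 2) : ℝ)..(1 / 2),
        (f (h (x + s)) : ℂ) * dirichletKernel n s‖ ≤ 680 * dyadicConst q) := by
  choose v hv hvp hdec using exists_levels hq0 hq hf.continuous hf1 hfp
  set H : ℕ → ℝ → ℝ := fun M => cellComp (v M) 0 M with hH
  have hd : ∀ M t, |H M t - t| ≤ 1 := fun M t => by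
    have := abs_cellComp_sub_self_le (hv M) 0 M t
    rw [pow_zero, div_one] at this
    linarith
  have hu : ∀ M t s, |t - s| ≤ 1 → |H M t - H M s| ≤ 4 * |t - s| ^ α := fun M t s hts => by
    have := cellComp_holder (hv M) (by linarith) hα0 hα1 hqα 0 M (t := t) (s := s) (by simpa using hts)
    simpa using this
  have hl : ∀ M t s x, 0 < x → x ≤ 1 → x ≤ |t - s| → x ≤ 4 * |H M t - H M s| ^ α :=
    fun M t s x hx0 hx1 hx => by
    have := cellComp_inv_holder (hv M) (by linarith) ((one_le_inv₀ hα0).2 hα1) hqα' 0 M hx0 hx1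
      (by simpa using hx)
    rw [pow_zero, one_mul] at this
    have h2 := Real.rpow_le_rpow (by positivity) this hα0.le
    rw [← Real.rpow_mul (by positivity), inv_mul_cancel₀ hα0.ne', Real.rpow_one] at h2
    linarith
  obtain ⟨h, hh, huni⟩ := exists_tendstoUniformlyOn_hyperfilter hα0 hd hu
  have hlim : ∀ t s, Tendsto (fun M => 4 * |H M t - H M s| ^ α) (hyperfilter ℕ)
      (𝓝 (4 * |h t - h s| ^ α)) := fun t s =>
    ((((hh t).sub (hh s)).abs).rpow_const (.inr hα0.le)).const_mul 4
  refine ⟨h, fun t => tendsto_nhds_unique (hh (t + 1)) ?_, fun t => ?_, fun t s hts => ?_,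
    fun t s x hx0 hx1 hx => ?_, fun hc n x => ?_⟩
  · simpa [hH, cellComp_add_one (hvp _)] using (hh t).add_const 1
  · exact le_of_tendsto ((hh t).sub_const t).abs (.of_forall fun M => hd M t)
  · exact le_of_tendsto ((hh t).sub (hh s)).abs (.of_forall fun M => hu M t s hts)
  · exact ge_of_tendsto (hlim t s) (.of_forall fun M => hl M t s x hx0 hx1 hx)
  refine le_of_forall_pos_le_add fun η hη => ?_
  set ε := η / (2 * n + 1) / 2 with hε
  have hε0 : 0 < ε := by positivity
  obtain ⟨δ, hδ0, hδ⟩ := Metric.uniformContinuous_iff.1 hf ε hε0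
  have hatTop : (hyperfilter ℕ : Filter ℕ) ≤ atTop := by
    rw [← Nat.cofinite_eq_atTop]; exact hyperfilter_le_cofinite
  have hpow : Tendsto (fun M : ℕ => (2:ℝ) ^ M) (hyperfilter ℕ) atTop :=
    (tendsto_pow_atTop_atTop_of_one_lt one_lt_two).mono_left hatTop
  have hsmall : Tendsto (fun M : ℕ => 4 * (q / 2 ^ M) ^ α) (hyperfilter ℕ) (𝓝 0) := by
    have := ((hpow.const_div_atTop q).rpow_const (p := α) (.inr hα0.le)).const_mul 4
    rwa [Real.zero_rpow hα0.ne', mul_zero] at this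
  -- Three demands on M: `H M` is close to h on the relevant period, 2^M exceeds all frequencies of
  -- the kernel, and the averaging still present at level M is negligible.
  obtain ⟨M, hM1, hM2, hM3⟩ := ((Metric.tendstoUniformlyOn_iff.1
    (huni (x - 1 / 2) (x + 1 / 2)) δ hδ0).and ((hpow.eventually_ge_atTop (n + 1 : ℝ)).and
      (hsmall.eventually_lt_const hδ0))).exists
  have hc' : Continuous (f ∘ H M) := hf.continuous.comp (continuous_cellComp (hv M) 0 M)
  set F := avgStage q f (v M) M M with hF
  have hFc : Continuous F := continuous_avgStage hf.continuous (hv M) M M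
  have hF1 : ∀ t, |F t| ≤ 1 := abs_avgComp_le hq0.le hc' (fun t => hf1 _) _ _
  have hp : (0:ℝ) < 2 ^ M := by positivity
  have hC := one_le_dyadicConst hq0 hq
  have hFf : ∀ t ∈ Set.Icc (x - 1 / 2) (x + 1 / 2), |f (h t) - F t| ≤ ε * 2 := fun t ht => by
    have h1 : |f (h t) - f (H M t)| ≤ ε := (hδ (hM1 t ht)).le
    have h2 : |f (H M t) - F t| ≤ ε := by
      have := abs_avgComp_sub_le hq0.le hc' (continuous_const (y := f (H M t))) (B := ε) M
        (M - M + 1) (t := t) (t' := t) fun w hw => by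
          have hw' := abs_cellComp_sub_self_le hw M (M - M + 1) t
          have hqM : q / 2 ^ M ≤ 1 :=
            (div_le_self hq0.le (one_le_pow₀ one_le_two)).trans (by linarith)
          refine (hδ (lt_of_le_of_lt ((hu M _ _ (hw'.trans hqM)).trans ?_) hM3)).le
          gcongr
      rwa [avgComp_const, abs_sub_comm] at this
    have := abs_sub_le (f (h t)) (f (H M t)) (F t)
    linarith
  refine (norm_dirichlet_integral_sub_le (hf.continuous.comp hc) hFc hFf n).trans (add_le_add ?_ ?_)
  · refine (norm_dirichlet_integral_le hFc hF1 (C := 4 * dyadicConst q) (by linarith)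
      (fun ν c L hL0 hL1 hνL hν => norm_integral_mul_ex_le_of_dyadic hFc hF1 hC (hdec M) hL0 hL1 hνL
        (hν.trans hM2)) x).trans_eq (by ring)
  · rw [hε]; field_simp; exact le_rfl

/-- Both Hölder conditions hold for small q, because α < 1 makes 2^(1-α) > 1 and (1/2)^(1/α-1) < 1.
-/
lemma exists_holder_parameter {α : ℝ} (hα0 : 0 < α) (hα1 : α < 1) : ∃ q : ℝ, 0 < q ∧ q ≤ 2 / 5 ∧
    1 + q ≤ 2 ^ (1 - α) ∧ (1 / 2 : ℝ) ^ (α⁻¹ - 1) ≤ 1 - q := by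
  have h1 : (1:ℝ) < 2 ^ (1 - α) := Real.one_lt_rpow one_lt_two (by linarith)
  have h2 : (1 / 2 : ℝ) ^ (α⁻¹ - 1) < 1 := Real.rpow_lt_one (by norm_num) (by norm_num)
    (sub_pos.2 ((one_lt_inv₀ hα0).2 hα1))
  refine ⟨min (2 / 5) (min (2 ^ (1 - α) - 1) (1 - (1 / 2) ^ (α⁻¹ - 1))), ?_, min_le_left _ _, ?_, ?_⟩
  · exact lt_min (by norm_num) (lt_min (by linarith) (by linarith))
  · have := (min_le_right (2 / 5 : ℝ) _).trans (min_le_left (2 ^ (1 - α) - 1) (1 - (1 / 2) ^ (α⁻¹ - 1)))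
    linarith
  · have := (min_le_right (2 / 5 : ℝ) _).trans (min_le_right (2 ^ (1 - α) - 1) (1 - (1 / 2) ^ (α⁻¹ - 1)))
    linarith

theorem mainTheorem2 (f : C(UnitAddCircle, ℝ)) (α : ℝ≥0) (hα₀ : 0 < α) (hα₁ : α < 1) :
    ∃ h : UnitAddCircle ≃ₜ UnitAddCircle,
      (∃ K : ℝ≥0, HolderWith K α h) ∧
      (∃ K : ℝ≥0, HolderWith K α h.symm) ∧
      ∃ C : ℝ, ∀ (n : ℕ) (x : UnitAddCircle),
        ‖fourierPartialSum (fun t => (f (h t) : ℂ)) n x‖ ≤ C := by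
  obtain ⟨q, hq0, hq, hqα, hqα'⟩ := exists_holder_parameter (α := α) hα₀ hα₁
  -- The added 1 keeps the normalization valid for f = 0.
  set B := ‖f‖ + 1 with hB
  have hB0 : 0 < B := by positivity
  set f₁ : ℝ → ℝ := fun t => f t / B with hf₁
  have hf₁u : UniformContinuous f₁ := by
    have hcoe : UniformContinuous ((↑) : ℝ → UnitAddCircle) := by
      refine (LipschitzWith.of_dist_le_mul (K := 1) fun x y => ?_).uniformContinuous
      rw [dist_eq_norm, ← AddCircle.coe_sub, NNReal.coe_one, one_mul]
      exact norm_coe_circle_le _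
    exact ((CompactSpace.uniformContinuous_of_continuous
      (f.continuous.div_const B)).comp hcoe : UniformContinuous ((fun x => f x / B) ∘ _))
  obtain ⟨h, h1, hd, hu, hl, hbd⟩ := exists_biholder_dirichlet_bound hq0 hq (α := α) hα₀
    (NNReal.coe_le_one.2 hα₁.le) hqα hqα' hf₁u (fun x => by
      rw [hf₁, abs_div, abs_of_pos hB0, div_le_one hB0]
      exact (f.norm_coe_le_norm x).trans (by linarith)) fun t => by
      simp only [hf₁, AddCircle.coe_add_period]
  obtain ⟨H, hH, hol, hol', hc⟩ := exists_homeomorph_of_biholder hα₀ h1 hd hu hl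
  refine ⟨H, ⟨4, hol⟩, ⟨4, hol'⟩, B * (680 * dyadicConst q), fun n x => ?_⟩
  obtain ⟨t, rfl⟩ := QuotientAddGroup.mk_surjective x
  have hF : Continuous fun t => B * f₁ (h t) :=
    continuous_const.mul (hf₁u.continuous.comp hc)
  have := fourierPartialSum_eq (g := fun t => (f (H t) : ℂ)) hF (fun t => by
    simp only [hf₁]
    rw [hH, mul_div_cancel₀ _ hB0.ne']) n t
  refine (congrArg norm this).trans_le ?_
  simp only [Complex.ofReal_mul, mul_assoc]
  rw [intervalIntegral.integral_const_mul, norm_mul, Complex.norm_real, Real.norm_of_nonneg hB0.le]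
  exact mul_le_mul_of_nonneg_left (hbd hc n t) hB0.le
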